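/- For a finite MDP $M=\langle S,A,R,T,\gamma\rangle$ with $A\neq\emptyset$, initial state $s_0\in S$ and $\gamma\in[0,1]$, let $\Pi_M$ be the set of all maps $\pi\colon S\to A$ and let $V^\pi(s_0)$ be the expected discounted sum of rewards from $s_0$ under $\pi$. Assume that $\gamma<1$, or that $M$ is episodic: under every policy and from every state, a terminal state (absorbing, with reward $0$) is reached with probability $1$. For $\tau\in\mathbb R$ put $$\mathrm{BPD}_\tau(M)=\frac1{|\Pi_M|}\sum_{\pi\in\Pi_M}\mathbf 1\{V^\pi(s_0)\le\tau\},\qquad \mathrm{GPD}_\tau(M)=1-\mathrm{BPD}_\tau(M).$$ **Proposition.** For every $d\in\mathbb N$ there is a randomized algorithm (one program for a random-access machine that can draw uniform elements of $\{0,\dots,m\}$) which, given $M$, $\tau$ and a constant $\varepsilon>0$, computes a value $\widehat{\mathrm{GPD}}_\tau(M)$ with $$\Pr\big[\,|\widehat{\mathrm{GPD}}_\tau(M)-\mathrm{GPD}_\tau(M)|\le\varepsilon\,\big]\ \ge\ 1-\frac1{n^d},$$ where $n$ is the size of $M$. The output has exactly the law of the fraction of policies with $V^\pi(s_0)>\tau$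 among $k$ independent, uniformly random policies from $\Pi_M$, where $k=k(n)=\Theta\!\left(\frac{\log n}{\varepsilon}\right)$, with positive hidden constants that depend only on $d$ and $\varepsilon$. For every fixed $\varepsilon$ the algorithm runs in polynomial time on all its random outcomes, in both of the following senses, each with its own constants: 1. for real $M,\tau,\varepsilon$, where $n$ is the number of real numbers that describe $M$: at most $C n^{C}$ steps, where arithmetic operations on and comparisons of real numbers are exact and cost one step each, and operations on natural numbers are charged by bit length; 2. for rational $M,\tau,\varepsilon$, where $n$ is the bit length of $M$: at most $C(n+\mathrm{size}(\tau))^{C}$ steps, where all operations are charged by the bit lengths of the numbers involved. Here $C$ depends only on $d$ and $\varepsilon$. -/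

import Mathlib

open scoped BigOperators

noncomputable section

namespace PolicyDensity

/-! ### Finite Markov decision processes -/

/-- A finite MDP with states `Fin nS`, actions `Fin nA` and data in an ordered field `K`. -/
structure MDP (K : Type) [Field K] [LinearOrder K] (nS nA : ℕ) where
  /-- `trans s a s'` is the probability `T(s' | s, a)`. -/
  trans : Fin nS → Fin nA → Fin nS → K
  trans_nonneg : ∀ s a s', 0 ≤ trans s a s'
  trans_sum : ∀ s a, ∑ s', trans s a s' = 1
  /-- `reward s a` is `R(s, a)`. -/
  reward : Fin nS → Fin nA → K
  /-- The discount factor. -/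
  gamma : K
  gamma_nonneg : 0 ≤ gamma
  gamma_le_one : gamma ≤ 1
  /-- The initial state `s₀`. -/
  start : Fin nS

/-- Deterministic stationary policies. -/
abbrev Policy (nS nA : ℕ) : Type := Fin nS → Fin nA

namespace MDP

/-- An MDP with rational data, seen as one with real data. -/
def toReal {nS nA : ℕ} (M : MDP ℚ nS nA) : MDP ℝ nS nA where
  trans s a s' := (M.trans s a s' : ℝ)
  trans_nonneg s a s' := by exact_mod_cast M.trans_nonneg s a s'
  trans_sum s a := by exact_mod_cast M.trans_sum s a
  reward s a := (M.reward s a : ℝ)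
  gamma := (M.gamma : ℝ)
  gamma_nonneg := by exact_mod_cast M.gamma_nonneg
  gamma_le_one := by exact_mod_cast M.gamma_le_one
  start := M.start

section Value

variable {nS nA : ℕ} (M : MDP ℝ nS nA)

/-- The transition matrix of the Markov chain that a policy induces. -/
def chain (π : Policy nS nA) : Matrix (Fin nS) (Fin nS) ℝ :=
  Matrix.of fun s s' => M.trans s (π s) s'

/-- The value `V^π(s)`: the expected discounted sum of the rewards collected from `s` under `π`.
The inner sum is the expected reward of step `t`. -/
def value (π : Policy nS nA) (s : Fin nS) : ℝ :=
  ∑' t : ℕ, M.gamma ^ t * ∑ s', (M.chain π ^ t) s s' * M.reward s' (π s')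

/-- Terminal states: absorbing and without reward, whatever the action. -/
def IsTerminal (s : Fin nS) : Prop :=
  ∀ a, M.trans s a s = 1 ∧ M.reward s a = 0

open Classical in
/-- The process is episodic: under every policy and from every state, the probability of having
reached a terminal state by time `t` tends to `1`. -/
def IsEpisodic : Prop :=
  ∀ (π : Policy nS nA) (s : Fin nS),
    Filter.Tendsto (fun t : ℕ => ∑ s' with M.IsTerminal s', (M.chain π ^ t) s s')
      Filter.atTop (nhds 1)

/-- The usual conditions under which all values are defined: discounting, or termination. -/
def ValuesDefined : Prop := M.gamma < 1 ∨ M.IsEpisodic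

open Classical in
/-- The bad-policy density: the fraction of the policies with `V^π(s₀) ≤ τ`. -/
def BPD (τ : ℝ) : ℝ :=
  1 / (Fintype.card (Policy nS nA) : ℝ) *
    ∑ π : Policy nS nA, if M.value π M.start ≤ τ then 1 else 0

/-- The good-policy density. -/
def GPD (τ : ℝ) : ℝ := 1 - M.BPD τ

open Classical in
/-- The fraction of the policies in a list of `k` policies whose start value exceeds `τ`. -/
def goodFraction (τ : ℝ) {k : ℕ} (πs : Fin k → Policy nS nA) : ℚ :=
  (Finset.card {j : Fin k | τ < M.value (πs j) M.start} : ℚ) / (k : ℚ)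

end Value

end MDP

/-! ### Randomized random-access programs

Programs are finite texts. The memory consists of arrays of natural numbers and arrays of elements
of an ordered field `K`; every array has a fixed name (a number) and unbounded length.
The running time is counted with respect to a size function `sz : K → ℕ` : each operation
costs `1` plus the size of its result, where natural numbers always count with their bit length.
* `sz = realSize` : each operation on the numbers of type `ℝ` costs one step (real RAM).
* `sz = bitSize` : operations on rational numbers are charged by bit length
  (logarithmic cost). -/

/-- The size of a number on the real RAM: no charge beyond the unit cost of each operation. -/
def realSize (_ : ℝ) : ℕ := 0

/-- The bit length of a rational number, as a reduced fraction. -/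
def bitSize (q : ℚ) : ℕ := Nat.size q.num.natAbs + Nat.size q.den

/-- The memory, together with the number of steps made so far. -/
structure State (K : Type) where
  nat : ℕ → ℕ → ℕ
  num : ℕ → ℕ → K
  time : ℕ

/-- Expressions for natural numbers; `get a i` is the `i`-th entry of the array `a`, and `sub` is
truncated subtraction. -/
inductive NatExp where
  | lit (n : ℕ)
  | get (a : ℕ) (i : NatExp)
  | add (e f : NatExp)
  | sub (e f : NatExp)
  | mul (e f : NatExp)

/-- Expressions for numbers in the field; `x / 0 = 0`. -/
inductive NumExp where
  | ofNat (e : NatExp)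
  | get (a : ℕ) (i : NatExp)
  | add (e f : NumExp)
  | sub (e f : NumExp)
  | mul (e f : NumExp)
  | div (e f : NumExp)

/-- Tests. -/
inductive Test where
  | ltNat (e f : NatExp)
  | ltNum (e f : NumExp)
  | not (b : Test)
  | and (b c : Test)

/-- Commands. `setNat a i e` and `setNum a i e` store the value of `e` at place `i` of the array
`a`; `rand a i e` stores there a fresh uniformly random element of `{0, …, m}`, where `m` is the
value of `e`. -/
inductive Program where
  | skip
  | setNat (a : ℕ) (i e : NatExp)
  | setNum (a : ℕ) (i : NatExp) (e : NumExp)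
  | rand (a : ℕ) (i e : NatExp)
  | seq (p q : Program)
  | ite (b : Test) (p q : Program)
  | loop (b : Test) (p : Program)

section Semantics

variable {K : Type} [Field K] [LinearOrder K] (sz : K → ℕ)

namespace State

/-- Charge `c` steps. -/
def tick (σ : State K) (c : ℕ) : State K := { σ with time := σ.time + c }

/-- Store a natural number. -/
def putNat (σ : State K) (a i v : ℕ) : State K :=
  { σ with nat := Function.update σ.nat a (Function.update (σ.nat a) i v) }

/-- Store a field element. -/
def putNum (σ : State K) (a i : ℕ) (v : K) : State K :=
  { σ with num := Function.update σ.num a (Function.update (σ.num a) i v) }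

end State

/-- The value of an expression. -/
def NatExp.eval (σ : State K) : NatExp → ℕ
  | lit n => n
  | get a i => σ.nat a (i.eval σ)
  | add e f => e.eval σ + f.eval σ
  | sub e f => e.eval σ - f.eval σ
  | mul e f => e.eval σ * f.eval σ

/-- The cost of evaluating an expression: each operation costs `1` plus the bit length of its
result (so that the operands have been charged as well). -/
def NatExp.cost (σ : State K) : NatExp → ℕ
  | lit n => 1 + Nat.size n
  | get a i => i.cost σ + 1 + Nat.size (σ.nat a (i.eval σ))
  | add e f => e.cost σ + f.cost σ + 1 + Nat.size (e.eval σ + f.eval σ)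
  | sub e f => e.cost σ + f.cost σ + 1 + Nat.size (e.eval σ - f.eval σ)
  | mul e f => e.cost σ + f.cost σ + 1 + Nat.size (e.eval σ * f.eval σ)

/-- The value of an expression. -/
def NumExp.eval (σ : State K) : NumExp → K
  | ofNat e => (e.eval σ : K)
  | get a i => σ.num a (i.eval σ)
  | add e f => e.eval σ + f.eval σ
  | sub e f => e.eval σ - f.eval σ
  | mul e f => e.eval σ * f.eval σ
  | div e f => e.eval σ / f.eval σ

/-- The cost of evaluating an expression. -/
def NumExp.cost (σ : State K) : NumExp → ℕ
  | ofNat e => e.cost σ + 1 + sz (e.eval σ : K)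
  | get a i => i.cost σ + 1 + sz (σ.num a (i.eval σ))
  | add e f => e.cost σ + f.cost σ + 1 + sz (e.eval σ + f.eval σ)
  | sub e f => e.cost σ + f.cost σ + 1 + sz (e.eval σ - f.eval σ)
  | mul e f => e.cost σ + f.cost σ + 1 + sz (e.eval σ * f.eval σ)
  | div e f => e.cost σ + f.cost σ + 1 + sz (e.eval σ / f.eval σ)

/-- The outcome of a test. -/
def Test.eval (σ : State K) : Test → Bool
  | ltNat e f => decide (e.eval σ < f.eval σ)
  | ltNum e f => decide (e.eval σ < f.eval σ)
  | not b => !b.eval σ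
  | and b c => b.eval σ && c.eval σ

/-- The cost of a test. -/
def Test.cost (σ : State K) : Test → ℕ
  | ltNat e f => e.cost σ + f.cost σ + 1
  | ltNum e f => e.cost sz σ + f.cost sz σ + 1
  | not b => b.cost σ + 1
  | and b c => b.cost σ + c.cost σ + 1

/-- Repeat `body` while `b` holds, but at most a given number of times. -/
def loopUpTo (b : Test) (body : State K → PMF (State K)) : ℕ → State K → PMF (State K)
  | 0, σ => PMF.pure σ
  | n + 1, σ =>
    if b.eval σ then (body (σ.tick (b.cost sz σ))).bind (loopUpTo b body n)
    else PMF.pure (σ.tick (b.cost sz σ))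

/-- The law of the final state of a program, where each execution of a loop is cut off after
`fuel` rounds. Every round costs at least one step, so a run in which a loop was
cut off has `time ≥ fuel`; runs with `time < fuel` are complete runs. -/
def Program.run (fuel : ℕ) : Program → State K → PMF (State K)
  | skip, σ => PMF.pure (σ.tick 1)
  | setNat a i e, σ =>
    PMF.pure ((σ.putNat a (i.eval σ) (e.eval σ)).tick (i.cost σ + e.cost σ + 1))
  | setNum a i e, σ =>
    PMF.pure ((σ.putNum a (i.eval σ) (e.eval σ)).tick (i.cost σ + e.cost sz σ + 1))
  | rand a i e, σ =>
    (PMF.uniformOfFintype (Fin (e.eval σ + 1))).map fun v : Fin (e.eval σ + 1) =>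
      (σ.putNat a (i.eval σ) (v : ℕ)).tick (i.cost σ + e.cost σ + 1)
  | seq p q, σ => (p.run fuel σ).bind (q.run fuel)
  | ite b p q, σ =>
    if b.eval σ then p.run fuel (σ.tick (b.cost sz σ)) else q.run fuel (σ.tick (b.cost sz σ))
  | loop b p, σ => loopUpTo sz b (p.run fuel) fuel σ

end Semantics

/-! ### Inputs -/

section Input

variable {K : Type} [Field K] [LinearOrder K] (sz : K → ℕ) {nS nA : ℕ}

/-- The size `n` of an MDP: each number in its description contributes `1` plus its size. On the
real RAM this is the number of these numbers; for rational data it is the length in bits, up to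
a constant factor. -/
def MDP.size (M : MDP K nS nA) : ℕ :=
  (sz M.gamma + 1) + (∑ s, ∑ a, (sz (M.reward s a) + 1)) +
    ∑ s, ∑ a, ∑ s', (sz (M.trans s a s') + 1)

/-- The memory at the start. The array `0` of natural numbers holds `|S|`, `|A|`, `s₀` and the
size of the MDP; the array `0` of field elements holds `γ`, `τ` and `ε`, the array `1` holds
`R(s, a)` at place `s |A| + a`, and the array `2` holds `T(s' | s, a)` at place
`(s |A| + a) |S| + s'`. All other entries are zero. -/
def MDP.input (M : MDP K nS nA) (τ ε : K) : State K where
  nat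
    | 0, 0 => nS
    | 0, 1 => nA
    | 0, 2 => M.start
    | 0, 3 => M.size sz
    | _, _ => 0
  num
    | 0, 0 => M.gamma
    | 0, 1 => τ
    | 0, 2 => ε
    | 1, i =>
      if h : i < nS * nA then
        M.reward (Fin.divNat (⟨i, h⟩ : Fin (nS * nA))) (Fin.modNat (⟨i, h⟩ : Fin (nS * nA)))
      else 0
    | 2, i =>
      if h : i < nS * nA * nS then
        M.trans (Fin.divNat (Fin.divNat (⟨i, h⟩ : Fin (nS * nA * nS))))
          (Fin.modNat (Fin.divNat (⟨i, h⟩ : Fin (nS * nA * nS))))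
          (Fin.modNat (⟨i, h⟩ : Fin (nS * nA * nS)))
      else 0
    | _, _ => 0
  time := 0

/-- The output of a run: the entry at place `0` of the array `3` of field elements. -/
def State.output (σ : State K) : K := σ.num 3 0

end Input

end PolicyDensity

end

open PolicyDensity

/-! Under a fixed policy the value is `(1 - Q)⁻¹ r`, where `Q` is the discounted transition matrix.
When `γ = 1` the absorbing states make `1 - γP` singular, so the rows of states that the policy
never leaves and that give no reward are erased. This changes no expected reward
(`MDP.chain_pow_mulVec`). The powers of the erased kernel tend to `0`, so `1 - Q` is invertible and
the Neumann series gives the value (`MDP.value_eq`). With `D = det (1 - Q)` and `Y = (adj (1 - Q)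
r)(s₀)`, a policy is good iff `τ D² < Y D` (`MDP.good_iff`), a test that needs neither division nor
the sign of `D`.

The Faddeev–LeVerrier recursion computes `D` and `Y` (`leVerrierSeq`). It has no pivots and divides
only by `1, …, N`, where `N` is the number of states. A step multiplies growing numbers only by
kernel entries, so bit lengths stay polynomial. This growth is abstracted into `Grading`: a rational
of level `i` has denominator dividing `E ^ i` and absolute value at most `U ^ i`. Over `ℝ` the
grading is trivial, so one analysis serves both cost models.

The algorithm draws `k = 8 (d + 1) m² · size n` policies, `m` being the least natural number with `m
ε ≥ 1`, and returns the fraction of good ones. An exponential moment bound gives failure probability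
at most `2 exp (-k ε² / 4) ≤ n ^ (-d)`.

The program is analysed twice. A Hoare logic on supports (`Grading.Sat`) gives memory contents,
number bounds and cost for every outcome; the law of the drawn action table is found separately
(`map_run_fill`). Outside the sampling loop the relevant memory is a function of that table, so the
output is the image of a uniform table, that is, of a uniform tuple of policies
(`Admissible.map_output_eq`). The loop cut-off `T` is a polynomial that exceeds every loop length
and the total cost, so no loop is cut off and `time < T`. -/

namespace PolicyDensity

/-! ### Determinant and adjugate of `1 - A` by the Faddeev–LeVerrier recursion. -/

section FaddeevLeVerrier

variable {ι K : Type*} [Fintype ι] [DecidableEq ι]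

open Polynomial

theorem derivative_det {R : Type*} [CommRing R] (M : Matrix ι ι R[X]) :
    derivative M.det =
      ∑ i, (M.updateCol i (fun j => derivative (M j i))).det := by
  simp only [Matrix.det_apply, derivative_sum]
  rw [Finset.sum_comm]
  refine Finset.sum_congr rfl fun σ _ => ?_
  rw [Units.smul_def, derivative_smul, derivative_prod_finset, Finset.smul_sum]
  refine Finset.sum_congr rfl fun i _ => ?_
  rw [Units.smul_def]
  congr 1
  rw [← Finset.mul_prod_erase _ _ (Finset.mem_univ i), mul_comm]
  simp only [Matrix.updateCol_self]
  congr 1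
  refine Finset.prod_congr rfl fun j hj => ?_
  rw [Matrix.updateCol_ne (Finset.ne_of_mem_erase hj)]

/-- A special case of Jacobi's formula: column `i` of `X - A` differentiates to the unit vector
`eᵢ`, and the determinant with that column is the diagonal entry `i` of the adjugate. -/
theorem derivative_charpoly {R : Type*} [CommRing R] (A : Matrix ι ι R) :
    derivative A.charpoly = A.charmatrix.adjugate.trace := by
  rw [Matrix.charpoly, derivative_det, Matrix.trace]
  refine Finset.sum_congr rfl fun i _ => ?_
  rw [Matrix.diag_apply, ← Matrix.transpose_apply A.charmatrix.adjugate,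
    Matrix.adjugate_transpose, Matrix.adjugate_apply, Matrix.updateRow_transpose,
    Matrix.det_transpose]
  have h : (fun j => derivative (A.charmatrix j i)) = Pi.single i 1 := by
    funext j
    by_cases hj : j = i
    · subst hj; simp
    · simp [hj]
  rw [h]

variable [Field K]

noncomputable section

/-- Coefficients and matrices of the Faddeev–LeVerrier recursion. -/
def leVerrier (A : Matrix ι ι K) : ℕ → K × Matrix ι ι K
  | 0 => (1, 0)
  | t + 1 =>
    let B := (leVerrier A t).1 • A + A * (leVerrier A t).2
    (-B.trace / ((t : K) + 1), B)

/-- The matrix coefficients of the adjugate of the characteristic matrix. -/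
def adjCoeff (A : Matrix ι ι K) (j : ℕ) : Matrix ι ι K :=
  Matrix.of fun i l => (A.charmatrix.adjugate i l).coeff j

/-- This is `(X - A) · adj (X - A) = χ · 1`, solved for the term with `X`. Comparing coefficients
yields the recursion between the matrices `adjCoeff`. -/
theorem X_mul_adjugate_charmatrix (A : Matrix ι ι K) (i l : ι) :
    X * A.charmatrix.adjugate i l =
      ∑ h, C (A i h) * A.charmatrix.adjugate h l + A.charpoly * C ((1 : Matrix ι ι K) i l) := by
  have h := congrFun (congrFun (Matrix.mul_adjugate A.charmatrix) i) l
  have h1 : (C.mapMatrix A * A.charmatrix.adjugate) i l =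
      ∑ h, C (A i h) * A.charmatrix.adjugate h l := by
    simp [Matrix.mul_apply]
  have h2 : ((Matrix.scalar ι) (X : K[X]) * A.charmatrix.adjugate) i l =
      X * A.charmatrix.adjugate i l := by
    simp
  have h3 : (A.charmatrix.det • (1 : Matrix ι ι K[X])) i l =
      A.charpoly * C ((1 : Matrix ι ι K) i l) := by
    rw [Matrix.smul_apply, smul_eq_mul, Matrix.charpoly]
    congr 1
    by_cases hil : i = l
    · subst hil; simp
    · simp [hil]
  have h4 : A.charmatrix * A.charmatrix.adjugate =
      (Matrix.scalar ι) (X : K[X]) * A.charmatrix.adjugate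
        - C.mapMatrix A * A.charmatrix.adjugate := by
    rw [← sub_mul]; rfl
  rw [h4, Matrix.sub_apply, h1, h2, h3] at h
  linear_combination h

theorem adjCoeff_succ (A : Matrix ι ι K) (j : ℕ) :
    adjCoeff A j = A * adjCoeff A (j + 1) + A.charpoly.coeff (j + 1) • 1 := by
  ext i l
  have h := congrArg (fun p : K[X] => p.coeff (j + 1)) (X_mul_adjugate_charmatrix A i l)
  simp only [coeff_X_mul, coeff_add, finsetSum_coeff, coeff_C_mul, coeff_mul_C] at h
  simp only [adjCoeff, Matrix.add_apply, Matrix.mul_apply, Matrix.smul_apply, Matrix.of_apply,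
    smul_eq_mul, h]

theorem mul_adjCoeff_zero (A : Matrix ι ι K) :
    A * adjCoeff A 0 + A.charpoly.coeff 0 • 1 = 0 := by
  ext i l
  have h := congrArg (fun p : K[X] => p.coeff 0) (X_mul_adjugate_charmatrix A i l)
  simp only [coeff_X_mul_zero, coeff_add, finsetSum_coeff, coeff_C_mul, coeff_mul_C] at h
  simp only [adjCoeff, Matrix.add_apply, Matrix.mul_apply, Matrix.smul_apply, Matrix.of_apply,
    smul_eq_mul, ← h, Matrix.zero_apply]

/-- All coefficients vanish beyond some degree `D`. Since `χ` has no coefficients above the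
dimension, `adjCoeff_succ` carries the vanishing down from `D` to the dimension. -/
theorem adjCoeff_eq_zero (A : Matrix ι ι K) {j : ℕ} (hj : Fintype.card ι ≤ j) :
    adjCoeff A j = 0 := by
  obtain ⟨D, hD⟩ : ∃ D, ∀ j, D ≤ j → adjCoeff A j = 0 := by
    refine ⟨∑ i, ∑ l, ((A.charmatrix.adjugate i l).natDegree + 1), fun j hj => ?_⟩
    ext i l
    refine coeff_eq_zero_of_natDegree_lt (lt_of_lt_of_le ?_ hj)
    have h1 := Finset.single_le_sum (f := fun l => (A.charmatrix.adjugate i l).natDegree + 1)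
      (fun _ _ => Nat.zero_le _) (Finset.mem_univ l)
    have h2 := Finset.single_le_sum
      (f := fun i => ∑ l, ((A.charmatrix.adjugate i l).natDegree + 1))
      (fun _ _ => Nat.zero_le _) (Finset.mem_univ i)
    exact (Nat.lt_of_succ_le (h1.trans h2))
  suffices H : ∀ m j, Fintype.card ι ≤ j → D ≤ j + m → adjCoeff A j = 0 from
    H D j hj (by omega)
  intro m
  induction m with
  | zero => intro j _ h; exact hD j h
  | succ m ih =>
    intro j hj h
    rw [adjCoeff_succ, ih (j + 1) (by omega) (by omega), coeff_eq_zero_of_natDegree_lt]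
    · simp
    · rw [Matrix.charpoly_natDegree_eq_dim]; omega

theorem trace_adjCoeff (A : Matrix ι ι K) (j : ℕ) :
    (adjCoeff A j).trace = ((j : K) + 1) * A.charpoly.coeff (j + 1) := by
  have h := congrArg (fun p : K[X] => p.coeff j) (derivative_charpoly A)
  simp only [coeff_derivative, Matrix.trace, Matrix.diag_apply, finsetSum_coeff] at h
  simp [Matrix.trace, adjCoeff, ← h, mul_comm]

/-- With `n` the dimension, traces in `adjCoeff_succ` together with `trace_adjCoeff` give `tr (A *
adjCoeff A j) = (j - n) c_j`. For `j = n - (t + 1)` the factor is `-(t + 1)`, so the division in the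
recursion returns `c_j`; this needs characteristic zero. -/
theorem leVerrier_eq [CharZero K] (A : Matrix ι ι K) {t : ℕ} (ht : t ≤ Fintype.card ι) :
    leVerrier A t = (A.charpoly.coeff (Fintype.card ι - t),
      A * adjCoeff A (Fintype.card ι - t)) := by
  induction t with
  | zero =>
    have h1 := A.charpoly_monic.coeff_natDegree
    rw [Matrix.charpoly_natDegree_eq_dim] at h1
    simp [leVerrier, h1, adjCoeff_eq_zero A le_rfl]
  | succ t ih =>
    obtain ⟨j, hj⟩ := Nat.exists_eq_add_of_lt (Nat.lt_of_succ_le ht)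
    have e1 : Fintype.card ι - t = j + 1 := by omega
    have e2 : Fintype.card ι - (t + 1) = j := by omega
    have hB : (leVerrier A t).1 • A + A * (leVerrier A t).2 = A * adjCoeff A j := by
      rw [ih (by omega), e1, adjCoeff_succ A j]
      simp [mul_add, add_comm]
    have htr : (A * adjCoeff A j).trace = - ((t : K) + 1) * A.charpoly.coeff j := by
      have hc : (Fintype.card ι : K) = t + j + 1 := by rw [hj]; push_cast; ring
      cases j with
      | zero =>
        have h := congrArg Matrix.trace (mul_adjCoeff_zero A)
        rw [Matrix.trace_add, Matrix.trace_smul, Matrix.trace_one] at h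
        simp only [smul_eq_mul, Matrix.trace_zero, hc] at h
        push_cast at h
        linear_combination h
      | succ j =>
        have h := congrArg Matrix.trace (adjCoeff_succ A j)
        rw [trace_adjCoeff, Matrix.trace_add, Matrix.trace_smul, Matrix.trace_one] at h
        simp only [smul_eq_mul, hc] at h
        push_cast at h
        linear_combination -h
    have h0 : (t : K) + 1 ≠ 0 := by exact_mod_cast Nat.succ_ne_zero t
    rw [leVerrier, e2]
    simp only [hB, htr]
    congr 1
    field_simp

theorem sum_leVerrier_fst [CharZero K] (A : Matrix ι ι K) :
    ∑ t ∈ Finset.range (Fintype.card ι + 1), (leVerrier A t).1 = (1 - A).det := by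
  have h := Matrix.eval_charpoly A 1
  rw [eval_eq_sum_range' (n := Fintype.card ι + 1)
    (by rw [Matrix.charpoly_natDegree_eq_dim]; omega), ← Finset.sum_range_reflect] at h
  simp only [map_one] at h
  rw [← h]
  refine Finset.sum_congr rfl fun t ht => ?_
  rw [leVerrier_eq A (by simpa [Nat.lt_succ_iff] using ht)]
  simp

/-- The adjugate of `X - A` is evaluated at `X = 1`, that is, its coefficient matrices are added up.
The recursion stores `A * adjCoeff`, and adding the current coefficient times the identity turns
this into the next lower coefficient matrix. -/
theorem sum_leVerrier_snd [CharZero K] (A : Matrix ι ι K) :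
    ∑ t ∈ Finset.range (Fintype.card ι), ((leVerrier A t).2 + (leVerrier A t).1 • 1) =
      (1 - A).adjugate := by
  have h := (evalRingHom (1 : K)).map_adjugate A.charmatrix
  have h2 : (evalRingHom (1 : K)).mapMatrix A.charmatrix = 1 - A := by
    ext i j
    by_cases hij : i = j
    · subst hij; simp
    · simp [hij]
  rw [h2] at h
  rw [← h, ← Finset.sum_range_reflect]
  ext i l
  rw [Matrix.sum_apply]
  rw [RingHom.mapMatrix_apply, Matrix.map_apply, coe_evalRingHom]
  -- Were the degree at least the dimension, the leading coefficient would be an entry of a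
  -- vanishing `adjCoeff`.
  have hdeg : (A.charmatrix.adjugate i l).natDegree < Fintype.card ι := by
    have hpos : 0 < Fintype.card ι := Fintype.card_pos_iff.2 ⟨i⟩
    by_contra hlt
    have h0 := congrFun (congrFun (adjCoeff_eq_zero A (not_lt.1 hlt)) i) l
    have h1 : A.charmatrix.adjugate i l = 0 := leadingCoeff_eq_zero.1 h0
    rw [h1, natDegree_zero] at hlt
    exact hlt hpos
  rw [eval_eq_sum_range' hdeg]
  refine Finset.sum_congr rfl fun t ht => ?_
  have ht' : t < Fintype.card ι := by simpa using ht
  rw [leVerrier_eq A (by omega)]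
  have e : Fintype.card ι - (Fintype.card ι - 1 - t) = t + 1 := by omega
  simp only [e]
  rw [← adjCoeff_succ]
  simp [adjCoeff]

end

end FaddeevLeVerrier
end PolicyDensity

noncomputable section

namespace PolicyDensity

/-! ### The value of a policy as the solution of a nonsingular linear system. -/

section PolicyEvaluation

open Filter Topology

section Generic

variable {K : Type} [Field K] [LinearOrder K] {nS nA : ℕ}

/-- A state that its chosen action never leaves, without reward. -/
def MDP.Stops (M : MDP K nS nA) (π : Policy nS nA) (s : Fin nS) : Prop :=
  ¬ M.trans s (π s) s < 1 ∧ ¬ 0 < M.reward s (π s) * M.reward s (π s)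

open Classical in
/-- The discounted transition matrix of a policy, with the rows of stopped states erased. -/
def MDP.kernel (M : MDP K nS nA) (π : Policy nS nA) : Matrix (Fin nS) (Fin nS) K :=
  Matrix.of fun i l => (if M.Stops π i then 0 else M.gamma) * M.trans i (π i) l

/-- The rewards of a policy. -/
def MDP.gain (M : MDP K nS nA) (π : Policy nS nA) (s : Fin nS) : K := M.reward s (π s)

/-- The test by which the algorithm recognizes good policies. -/
def MDP.Good (M : MDP K nS nA) (τ : K) (π : Policy nS nA) : Prop :=
  τ * (1 - M.kernel π).det * (1 - M.kernel π).det <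
    ((1 - M.kernel π).adjugate.mulVec (M.gain π)) M.start * (1 - M.kernel π).det

end Generic

variable {nS nA : ℕ} (M : MDP ℝ nS nA) (π : Policy nS nA)

/-- Programs can only compare by `<`, so `r = 0` is tested as the failure of `0 < r * r`. -/
theorem MDP.Stops.reward_eq {M : MDP ℝ nS nA} {π : Policy nS nA} {s : Fin nS}
    (h : M.Stops π s) : M.reward s (π s) = 0 := by
  by_contra h0
  exact h.2 (mul_self_pos.2 h0)

theorem MDP.trans_le_one (s : Fin nS) (a : Fin nA) (s' : Fin nS) : M.trans s a s' ≤ 1 := by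
  rw [← M.trans_sum s a]
  exact Finset.single_le_sum (f := fun x => M.trans s a x) (fun x _ => M.trans_nonneg s a x)
    (Finset.mem_univ s')

theorem MDP.Stops.trans_self {M : MDP ℝ nS nA} {π : Policy nS nA} {s : Fin nS}
    (h : M.Stops π s) : M.trans s (π s) s = 1 :=
  le_antisymm (M.trans_le_one s _ s) (not_lt.1 h.1)

theorem MDP.Stops.trans_ne {M : MDP ℝ nS nA} {π : Policy nS nA} {s s' : Fin nS}
    (h : M.Stops π s) (hs : s' ≠ s) : M.trans s (π s) s' = 0 := by
  have h1 := M.trans_sum s (π s)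
  rw [← Finset.add_sum_erase _ _ (Finset.mem_univ s), h.trans_self] at h1
  have h2 : ∑ x ∈ Finset.univ.erase s, M.trans s (π s) x = 0 := by linarith
  exact (Finset.sum_eq_zero_iff_of_nonneg (fun x _ => M.trans_nonneg s _ x)).1 h2 s'
    (Finset.mem_erase.2 ⟨hs, Finset.mem_univ _⟩)

/-- `Stops` looks only at the chosen action and may hold in nonterminal states too. Erasing those
rows is harmless; that all terminal rows are erased is what makes the kernel transient. -/
theorem MDP.IsTerminal.stops {M : MDP ℝ nS nA} {s : Fin nS} (h : M.IsTerminal s) :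
    M.Stops π s := by
  simp [MDP.Stops, h (π s)]

theorem MDP.kernel_nonneg (i l : Fin nS) : 0 ≤ M.kernel π i l := by
  rw [MDP.kernel, Matrix.of_apply]
  split_ifs
  · simp
  · exact mul_nonneg M.gamma_nonneg (M.trans_nonneg _ _ _)

theorem MDP.kernel_le (i l : Fin nS) : M.kernel π i l ≤ M.gamma * M.chain π i l := by
  rw [MDP.kernel, Matrix.of_apply, MDP.chain, Matrix.of_apply]
  have := mul_nonneg M.gamma_nonneg (M.trans_nonneg i (π i) l)
  split_ifs
  · simpa using this
  · exact le_rfl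

theorem MDP.kernel_of_stops {i : Fin nS} (h : M.Stops π i) (l : Fin nS) :
    M.kernel π i l = 0 := by
  simp [MDP.kernel, h]

theorem MDP.kernel_of_not_stops {i : Fin nS} (h : ¬ M.Stops π i) (l : Fin nS) :
    M.kernel π i l = M.gamma * M.chain π i l := by
  simp [MDP.kernel, h, MDP.chain]

/-- The two claims need a joint induction: the expected reward vector vanishes at stopped states, so
erasing their rows does not change the next vector. -/
theorem MDP.chain_pow_mulVec (t : ℕ) :
    M.gamma ^ t • (M.chain π ^ t).mulVec (M.gain π) = (M.kernel π ^ t).mulVec (M.gain π) ∧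
      ∀ s, M.Stops π s → (M.kernel π ^ t).mulVec (M.gain π) s = 0 := by
  induction t with
  | zero => exact ⟨by simp, fun s hs => by
    rw [pow_zero, Matrix.one_mulVec]; exact hs.reward_eq⟩
  | succ t ih =>
    have e : (M.kernel π ^ (t + 1)).mulVec (M.gain π) =
        (M.kernel π).mulVec ((M.kernel π ^ t).mulVec (M.gain π)) := by
      rw [pow_succ', Matrix.mulVec_mulVec]
    have hz : ∀ s, M.Stops π s → (M.kernel π ^ (t + 1)).mulVec (M.gain π) s = 0 := by
      intro s hs
      rw [e, Matrix.mulVec, dotProduct]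
      exact Finset.sum_eq_zero fun l _ => by rw [M.kernel_of_stops π hs, zero_mul]
    refine ⟨?_, hz⟩
    have e2 : M.gamma ^ (t + 1) • (M.chain π ^ (t + 1)).mulVec (M.gain π) =
        M.gamma • (M.chain π).mulVec ((M.kernel π ^ t).mulVec (M.gain π)) := by
      rw [← ih.1, Matrix.mulVec_smul, Matrix.mulVec_mulVec, ← pow_succ', smul_smul, ← pow_succ']
    rw [e2]
    funext s
    by_cases hs : M.Stops π s
    -- The true row of a stopped state is concentrated on that state, where the previous vector is
    -- zero.
    · rw [hz s hs, Pi.smul_apply, Matrix.mulVec, dotProduct, Finset.sum_eq_zero, smul_zero]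
      intro l _
      by_cases hl : l = s
      · subst hl; rw [ih.2 l hs, mul_zero]
      · rw [MDP.chain, Matrix.of_apply, hs.trans_ne hl, zero_mul]
    · rw [e, Pi.smul_apply, Matrix.mulVec, Matrix.mulVec, dotProduct, dotProduct, Finset.smul_sum]
      refine Finset.sum_congr rfl fun l _ => ?_
      rw [M.kernel_of_not_stops π hs, smul_eq_mul, mul_assoc]

theorem MDP.kernel_pow_nonneg (t : ℕ) (i l : Fin nS) : 0 ≤ (M.kernel π ^ t) i l := by
  induction t generalizing i l with
  | zero => rw [pow_zero, Matrix.one_apply]; split_ifs <;> norm_num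
  | succ t ih =>
    rw [pow_succ', Matrix.mul_apply]
    exact Finset.sum_nonneg fun h _ => mul_nonneg (M.kernel_nonneg π i h) (ih h l)

theorem MDP.sum_chain (i : Fin nS) : ∑ l, M.chain π i l = 1 := M.trans_sum i (π i)

theorem MDP.sum_kernel_pow_le_gamma_pow (t : ℕ) (i : Fin nS) :
    ∑ l, (M.kernel π ^ t) i l ≤ M.gamma ^ t := by
  induction t generalizing i with
  | zero => simp [Matrix.one_apply]
  | succ t ih =>
    simp only [pow_succ' (M.kernel π), Matrix.mul_apply]
    rw [Finset.sum_comm]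
    simp only [← Finset.mul_sum]
    calc ∑ h, M.kernel π i h * ∑ l, (M.kernel π ^ t) h l
        ≤ ∑ h, (M.gamma * M.chain π i h) * M.gamma ^ t :=
          Finset.sum_le_sum fun h _ => mul_le_mul (M.kernel_le π i h) (ih h)
            (Finset.sum_nonneg fun l _ => M.kernel_pow_nonneg π t h l)
            (mul_nonneg M.gamma_nonneg (M.trans_nonneg _ _ _))
      _ = M.gamma ^ (t + 1) := by
          rw [← Finset.sum_mul, ← Finset.mul_sum, M.sum_chain, mul_one, pow_succ']

theorem MDP.sum_chain_pow (t : ℕ) (i : Fin nS) : ∑ l, (M.chain π ^ t) i l = 1 := by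
  induction t generalizing i with
  | zero => simp [Matrix.one_apply]
  | succ t ih =>
    simp only [pow_succ', Matrix.mul_apply]
    rw [Finset.sum_comm]
    simp only [← Finset.mul_sum, ih, mul_one, M.sum_chain]

theorem MDP.chain_pow_nonneg (t : ℕ) (i l : Fin nS) : 0 ≤ (M.chain π ^ t) i l := by
  induction t generalizing i l with
  | zero => rw [pow_zero, Matrix.one_apply]; split_ifs <;> norm_num
  | succ t ih =>
    rw [pow_succ', Matrix.mul_apply]
    exact Finset.sum_nonneg fun h _ => mul_nonneg (M.trans_nonneg _ _ _) (ih h l)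

open Classical in
-- Mass that is in a terminal state at time `t` is erased by the following step. Hence the exponent
-- `t + 1` on the left.
theorem MDP.sum_kernel_pow_succ_le (t : ℕ) (i : Fin nS) :
    ∑ l, (M.kernel π ^ (t + 1)) i l ≤ ∑ l with ¬ M.IsTerminal l, (M.chain π ^ t) i l := by
  have hle : ∀ i l, M.kernel π i l ≤ M.chain π i l := fun i l =>
    (M.kernel_le π i l).trans (mul_le_of_le_one_left (M.trans_nonneg _ _ _) M.gamma_le_one)
  induction t generalizing i with
  | zero =>
    by_cases hi : M.IsTerminal i
    · refine le_trans (le_of_eq ?_) (Finset.sum_nonneg fun l _ => M.chain_pow_nonneg π 0 i l)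
      exact Finset.sum_eq_zero fun l _ => by rw [zero_add, pow_one, M.kernel_of_stops π (hi.stops π)]
    · calc ∑ l, (M.kernel π ^ (0 + 1)) i l ≤ ∑ l, M.chain π i l :=
            Finset.sum_le_sum fun l _ => by rw [zero_add, pow_one]; exact hle i l
        _ = 1 := M.sum_chain π i
        _ = (M.chain π ^ 0) i i := by simp
        _ ≤ _ := Finset.single_le_sum (f := fun l => (M.chain π ^ 0) i l)
            (fun l _ => M.chain_pow_nonneg π 0 i l) (by simp [hi])
  | succ t ih =>
    rw [pow_succ' (M.kernel π), pow_succ' (M.chain π)]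
    simp only [Matrix.mul_apply]
    rw [Finset.sum_comm, Finset.sum_comm (s := Finset.univ.filter _)]
    simp only [← Finset.mul_sum]
    exact Finset.sum_le_sum fun h _ => mul_le_mul (hle i h) (ih h)
      (Finset.sum_nonneg fun l _ => M.kernel_pow_nonneg π _ h l) (M.trans_nonneg _ _ _)

/-- Row sums decay like `γ ^ t` under discounting, and otherwise are bounded by the probability of
not having terminated yet. -/
theorem MDP.tendsto_kernel_pow (hM : M.ValuesDefined) (i l : Fin nS) :
    Tendsto (fun t => (M.kernel π ^ t) i l) atTop (𝓝 0) := by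
  classical
  have hle : ∀ t, (M.kernel π ^ t) i l ≤ ∑ x, (M.kernel π ^ t) i x := fun t =>
    Finset.single_le_sum (f := fun x => (M.kernel π ^ t) i x)
      (fun x _ => M.kernel_pow_nonneg π t i x) (Finset.mem_univ l)
  rcases hM with hg | he
  · exact squeeze_zero (fun t => M.kernel_pow_nonneg π t i l)
      (fun t => (hle t).trans (M.sum_kernel_pow_le_gamma_pow π t i))
      (tendsto_pow_atTop_nhds_zero_of_lt_one M.gamma_nonneg hg)
  · rw [← tendsto_add_atTop_iff_nat 1]
    refine squeeze_zero (fun t => M.kernel_pow_nonneg π _ i l)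
      (fun t => (hle _).trans (M.sum_kernel_pow_succ_le π t i)) ?_
    have h1 := (he π i).const_sub 1
    rw [sub_self] at h1
    refine h1.congr fun t => ?_
    rw [← M.sum_chain_pow π t i, ← Finset.sum_filter_add_sum_filter_not Finset.univ
      (fun l => M.IsTerminal l)]
    ring

/-- A vector in the kernel of `1 - Q` is fixed by every `Q ^ t`, and these tend to `0`. -/
theorem MDP.det_one_sub_kernel_ne_zero (hM : M.ValuesDefined) : (1 - M.kernel π).det ≠ 0 := by
  intro h0
  obtain ⟨v, hv0, hv⟩ := Matrix.exists_mulVec_eq_zero_iff.2 h0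
  have h1 : (M.kernel π).mulVec v = v := by
    rw [Matrix.sub_mulVec, Matrix.one_mulVec, sub_eq_zero] at hv
    exact hv.symm
  have h2 : ∀ t, (M.kernel π ^ t).mulVec v = v := by
    intro t
    induction t with
    | zero => simp
    | succ t ih => rw [pow_succ, ← Matrix.mulVec_mulVec, h1, ih]
  refine hv0 (funext fun i => ?_)
  have h3 : Tendsto (fun t => (M.kernel π ^ t).mulVec v i) atTop (𝓝 (∑ l, 0 * v l)) :=
    tendsto_finsetSum _ fun l _ => (M.tendsto_kernel_pow π hM i l).mul_const _
  simp only [h2, zero_mul, Finset.sum_const_zero] at h3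
  exact tendsto_nhds_unique tendsto_const_nhds h3

theorem MDP.hasSum_kernel_pow (hM : M.ValuesDefined) (i l : Fin nS) :
    HasSum (fun t => (M.kernel π ^ t) i l) ((1 - M.kernel π)⁻¹ i l) := by
  have hu : IsUnit (1 - M.kernel π).det := (M.det_one_sub_kernel_ne_zero π hM).isUnit
  -- The entries are nonnegative, so convergence of the partial geometric sums is already
  -- summability.
  rw [hasSum_iff_tendsto_nat_of_nonneg fun t => M.kernel_pow_nonneg π t i l]
  have h1 : ∀ n, ∑ t ∈ Finset.range n, (M.kernel π ^ t) =
      (1 - M.kernel π)⁻¹ * (1 - M.kernel π ^ n) := fun n => by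
    rw [← mul_neg_geom_sum, ← mul_assoc, Matrix.nonsing_inv_mul _ hu, one_mul]
  have h2 : ∀ n, ∑ t ∈ Finset.range n, (M.kernel π ^ t) i l =
      (1 - M.kernel π)⁻¹ i l - ∑ x, (1 - M.kernel π)⁻¹ i x * (M.kernel π ^ n) x l := fun n => by
    rw [← Matrix.sum_apply, h1, mul_sub, mul_one, Matrix.sub_apply, Matrix.mul_apply]
  simp only [h2]
  have h3 : Tendsto (fun n => ∑ x, (1 - M.kernel π)⁻¹ i x * (M.kernel π ^ n) x l) atTop
      (𝓝 (∑ x, (1 - M.kernel π)⁻¹ i x * 0)) :=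
    tendsto_finsetSum _ fun x _ => (M.tendsto_kernel_pow π hM x l).const_mul _
  simpa using h3.const_sub ((1 - M.kernel π)⁻¹ i l)

theorem MDP.value_eq (hM : M.ValuesDefined) (s : Fin nS) :
    M.value π s = (1 - M.kernel π)⁻¹.mulVec (M.gain π) s := by
  have h1 : HasSum (fun t => (M.kernel π ^ t).mulVec (M.gain π) s)
      ((1 - M.kernel π)⁻¹.mulVec (M.gain π) s) := by
    simp only [Matrix.mulVec, dotProduct]
    exact hasSum_sum fun l _ => (M.hasSum_kernel_pow π hM s l).mul_right (M.gain π l)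
  rw [← h1.tsum_eq, MDP.value]
  refine tsum_congr fun t => ?_
  rw [← (M.chain_pow_mulVec π t).1]
  rfl

/-- By Cramer's rule the value is `Y / D`. Multiplying by `D² > 0` preserves the inequality whatever
the sign of `D`. -/
theorem MDP.good_iff (hM : M.ValuesDefined) (τ : ℝ) :
    M.Good τ π ↔ τ < M.value π M.start := by
  have h0 := M.det_one_sub_kernel_ne_zero π hM
  rw [M.value_eq π hM, Matrix.inv_def, MDP.Good, Matrix.smul_mulVec, Pi.smul_apply, smul_eq_mul,
    Ring.inverse_eq_inv']
  generalize (1 - M.kernel π).det = D at *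
  generalize (1 - M.kernel π).adjugate.mulVec (M.gain π) M.start = Y
  have hD : 0 < D * D := mul_self_pos.2 h0
  have h1 : D⁻¹ * Y * (D * D) = Y * D := by field_simp
  rw [← mul_lt_mul_iff_left₀ (b := τ) hD, h1, mul_assoc]

/-- Determinant, adjugate and order commute with the embedding of `ℚ` into `ℝ`, so exact rational
arithmetic decides the comparison of real values. -/
theorem MDP.good_toReal (M : MDP ℚ nS nA) (π : Policy nS nA) (τ : ℚ) :
    M.toReal.Good τ π ↔ M.Good τ π := by
  have hk : M.toReal.kernel π = (Rat.castHom ℝ).mapMatrix (M.kernel π) := by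
    ext i l
    have hs : M.toReal.Stops π i ↔ M.Stops π i := by
      simp only [MDP.Stops, MDP.toReal]
      norm_cast
    simp only [MDP.kernel, Matrix.of_apply, RingHom.mapMatrix_apply, Matrix.map_apply]
    by_cases h : M.Stops π i
    · simp [h, hs.2 h]
    · rw [if_neg h, if_neg (mt hs.1 h)]
      simp [MDP.toReal]
  have h1 : 1 - M.toReal.kernel π = (Rat.castHom ℝ).mapMatrix (1 - M.kernel π) := by
    rw [hk, map_sub, map_one]
  have h2 : (1 - M.toReal.kernel π).det = ((1 - M.kernel π).det : ℚ) := by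
    rw [h1, ← RingHom.map_det]; rfl
  have h3 : ((1 - M.toReal.kernel π).adjugate.mulVec (M.toReal.gain π)) M.toReal.start =
      (((1 - M.kernel π).adjugate.mulVec (M.gain π)) M.start : ℚ) := by
    rw [h1, ← RingHom.map_adjugate]
    simp only [Matrix.mulVec, dotProduct, Rat.cast_sum, Rat.cast_mul]
    rfl
  rw [MDP.Good, MDP.Good, h2, h3]
  norm_cast

end PolicyEvaluation
-- A Chernoff bound for the fraction of good policies.
section Concentration

variable {α : Type*} [Fintype α]

open Classical in
-- Markov's inequality for `exp (t ∑ Y)`, in counting form. Since `exp y ≤ 1 + y + y²` for `|y| ≤ 1`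
-- and `Y` has mean zero, each sample contributes a factor of at most `exp (t²)`.
theorem card_sum_gt_le (Y : α → ℝ) (hY : ∀ a, |Y a| ≤ 1) (h0 : ∑ a, Y a = 0)
    {ε : ℝ} (hε : 0 ≤ ε) (hε1 : ε ≤ 1) (k : ℕ) :
    (Finset.card {w : Fin k → α | k * ε < ∑ j, Y (w j)} : ℝ) ≤
      Fintype.card (Fin k → α) * Real.exp (-(k * ε ^ 2 / 4)) := by
  -- This minimizes `t² - t ε`, with value `-ε² / 4`; `ε ≤ 1` keeps `|t Y| ≤ 1`.
  set t := ε / 2 with ht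
  have h1 : ∑ a, Real.exp (t * Y a) ≤ Fintype.card α * Real.exp (t ^ 2) := by
    calc ∑ a, Real.exp (t * Y a) ≤ ∑ a, (1 + t * Y a + t ^ 2) := by
          refine Finset.sum_le_sum fun a _ => ?_
          have hb : |t * Y a| ≤ 1 := by
            rw [abs_mul, abs_of_nonneg (by positivity)]
            exact mul_le_one₀ (by linarith) (abs_nonneg _) (hY a)
          have hc := (abs_le.1 (Real.abs_exp_sub_one_sub_id_le hb)).2
          have hd : (t * Y a) ^ 2 ≤ t ^ 2 := by
            rw [mul_pow]
            exact mul_le_of_le_one_right (sq_nonneg _) ((sq_le_one_iff_abs_le_one _).2 (hY a))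
          linarith
      _ = Fintype.card α * (1 + t ^ 2) := by
          rw [Finset.sum_add_distrib, Finset.sum_add_distrib, ← Finset.mul_sum, h0]
          simp [Finset.card_univ]; ring
      _ ≤ _ := by
          refine mul_le_mul_of_nonneg_left ?_ (Nat.cast_nonneg _)
          have := Real.add_one_le_exp (t ^ 2)
          linarith
  have h2 : ∑ w : Fin k → α, Real.exp (t * ∑ j, Y (w j)) = (∑ a, Real.exp (t * Y a)) ^ k := by
    simp only [Finset.mul_sum, Real.exp_sum]
    have := Finset.prod_univ_sum (fun _ : Fin k => (Finset.univ : Finset α))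
      (fun _ a => Real.exp (t * Y a))
    rw [Finset.prod_const, Finset.card_univ, Fintype.card_fin, Fintype.piFinset_univ] at this
    exact this.symm
  have h3 : (Finset.card {w : Fin k → α | k * ε < ∑ j, Y (w j)} : ℝ) * Real.exp (t * (k * ε)) ≤
      ∑ w : Fin k → α, Real.exp (t * ∑ j, Y (w j)) := by
    rw [← nsmul_eq_mul, ← Finset.sum_const]
    refine (Finset.sum_le_sum fun w hw => ?_).trans
      (Finset.sum_le_sum_of_subset_of_nonneg (Finset.subset_univ _)
        fun w _ _ => (Real.exp_pos _).le)
    rw [Finset.mem_filter] at hw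
    exact Real.exp_le_exp.2 (mul_le_mul_of_nonneg_left hw.2.le (by positivity))
  rw [h2] at h3
  have h4 := h3.trans (pow_le_pow_left₀ (Finset.sum_nonneg fun a _ => (Real.exp_pos _).le) h1 k)
  rw [mul_pow, ← Real.exp_nat_mul] at h4
  rw [Fintype.card_fun, Fintype.card_fin]
  push_cast
  rw [← le_div_iff₀ (Real.exp_pos _), mul_div_assoc, ← Real.exp_sub] at h4
  refine h4.trans (le_of_eq ?_)
  congr 2
  rw [ht]; ring

variable {nS nA : ℕ}

open Classical in
theorem MDP.GPD_eq [NeZero nA] (M : MDP ℝ nS nA) (τ : ℝ) :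
    M.GPD τ * Fintype.card (Policy nS nA) =
      ∑ π : Policy nS nA, if τ < M.value π M.start then (1 : ℝ) else 0 := by
  have hc : (Fintype.card (Policy nS nA) : ℝ) ≠ 0 := by
    exact_mod_cast Fintype.card_ne_zero
  rw [MDP.GPD, MDP.BPD, sub_mul, one_mul, one_div, mul_comm, ← mul_assoc, mul_inv_cancel₀ hc,
    one_mul, sub_eq_iff_eq_add, ← Finset.sum_add_distrib]
  have : ∀ π : Policy nS nA, ((if τ < M.value π M.start then (1 : ℝ) else 0) +
      if M.value π M.start ≤ τ then 1 else 0) = 1 := fun π => by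
    by_cases h : τ < M.value π M.start
    · simp [h, not_le.2 h]
    · simp [h, not_lt.1 h]
  simp [this]

theorem MDP.one_sub_le_measure_goodFraction [NeZero nA] (M : MDP ℝ nS nA) (τ : ℝ) {ε : ℝ}
    (hε : 0 < ε) {k : ℕ} (hk : 0 < k) :
    1 - 2 * Real.exp (-(k * ε ^ 2 / 4)) ≤
      ((PMF.uniformOfFintype (Fin k → Policy nS nA)).toOuterMeasure
        {πs | |(M.goodFraction τ πs : ℝ) - M.GPD τ| ≤ ε}).toReal := by
  classical
  have hk0 : (0 : ℝ) < k := by exact_mod_cast hk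
  have hcp : (0 : ℝ) < Fintype.card (Policy nS nA) := by exact_mod_cast Fintype.card_pos
  have hc : (0 : ℝ) < Fintype.card (Fin k → Policy nS nA) := by exact_mod_cast Fintype.card_pos
  set f : Policy nS nA → ℝ := fun π => if τ < M.value π M.start then 1 else 0 with hf
  have hf0 : ∀ π, 0 ≤ f π := fun π => by simp only [hf]; split_ifs <;> norm_num
  have hf1 : ∀ π, f π ≤ 1 := fun π => by simp only [hf]; split_ifs <;> norm_num
  have hG := M.GPD_eq τ
  have hG0 : 0 ≤ M.GPD τ := by
    refine nonneg_of_mul_nonneg_left ?_ hcp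
    rw [hG]; exact Finset.sum_nonneg fun π _ => hf0 π
  have hG1 : M.GPD τ ≤ 1 := by
    refine le_of_mul_le_mul_right ?_ hcp
    rw [hG, one_mul]
    refine (Finset.sum_le_sum fun π _ => hf1 π).trans ?_
    simp
  have hfrac : ∀ πs : Fin k → Policy nS nA, (M.goodFraction τ πs : ℝ) * k = ∑ j, f (πs j) := by
    intro πs
    rw [MDP.goodFraction]
    push_cast
    rw [div_mul_cancel₀ _ hk0.ne', hf, Finset.sum_boole]
  have hsum : ∀ πs : Fin k → Policy nS nA,
      ∑ j, (f (πs j) - M.GPD τ) = k * ((M.goodFraction τ πs : ℝ) - M.GPD τ) := by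
    intro πs
    rw [Finset.sum_sub_distrib, ← hfrac]
    simp; ring
  have key : (Finset.card {πs : Fin k → Policy nS nA |
      ¬ |(M.goodFraction τ πs : ℝ) - M.GPD τ| ≤ ε} : ℝ) ≤
      2 * (Fintype.card (Fin k → Policy nS nA) * Real.exp (-(k * ε ^ 2 / 4))) := by
    by_cases hε1 : ε ≤ 1
    · have h1 := card_sum_gt_le (fun π => f π - M.GPD τ)
        (fun π => abs_le.2 ⟨by linarith [hf0 π], by linarith [hf1 π]⟩)
        (by rw [Finset.sum_sub_distrib, ← hG]; simp; ring) hε.le hε1 k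
      have h2 := card_sum_gt_le (fun π => - (f π - M.GPD τ))
        (fun π => by rw [abs_neg]; exact abs_le.2 ⟨by linarith [hf0 π], by linarith [hf1 π]⟩)
        (by rw [Finset.sum_neg_distrib, Finset.sum_sub_distrib, ← hG]; simp; ring) hε.le hε1 k
      rw [two_mul]
      refine le_trans ?_ (add_le_add h1 h2)
      rw [← Nat.cast_add, Nat.cast_le]
      refine (Finset.card_le_card ?_).trans (Finset.card_union_le _ _)
      intro πs hπ
      simp only [Finset.mem_filter, Finset.mem_univ, true_and, Finset.mem_union,
        Finset.sum_neg_distrib, hsum] at hπ ⊢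
      rcases lt_abs.1 (not_le.1 hπ) with h | h
      · exact Or.inl (mul_lt_mul_of_pos_left h hk0)
      · right; rw [← mul_neg]; exact mul_lt_mul_of_pos_left h hk0
    -- For `ε > 1` the tail bound is not available, but no sample is bad, as both densities lie in
    -- `[0, 1]`.
    · rw [Finset.filter_false_of_mem]
      · simp; positivity
      · intro πs _
        rw [not_not]
        have h1 : (M.goodFraction τ πs : ℝ) * k ≤ 1 * k := by
          rw [hfrac]
          refine (Finset.sum_le_sum fun j _ => hf1 _).trans ?_
          simp
        have h2 : 0 ≤ (M.goodFraction τ πs : ℝ) * k := by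
          rw [hfrac]; exact Finset.sum_nonneg fun j _ => hf0 _
        have h3 := le_of_mul_le_mul_right h1 hk0
        have h4 := nonneg_of_mul_nonneg_left h2 hk0
        rw [abs_le]; constructor <;> linarith
  rw [PMF.toOuterMeasure_uniformOfFintype_apply, ENNReal.toReal_div, ENNReal.toReal_natCast,
    ENNReal.toReal_natCast, le_div_iff₀ hc, Fintype.card_subtype]
  have h5 := Finset.card_filter_add_card_filter_not (s := (Finset.univ : Finset (Fin k → Policy nS nA)))
    (fun πs => |(M.goodFraction τ πs : ℝ) - M.GPD τ| ≤ ε)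
  rw [Finset.card_univ] at h5
  have h6 : ((Finset.card {πs : Fin k → Policy nS nA |
      |(M.goodFraction τ πs : ℝ) - M.GPD τ| ≤ ε} : ℕ) : ℝ) + (Finset.card {πs : Fin k → Policy nS nA |
      ¬ |(M.goodFraction τ πs : ℝ) - M.GPD τ| ≤ ε} : ℕ) = Fintype.card (Fin k → Policy nS nA) := by
    exact_mod_cast h5
  simp only [Set.mem_ofPred_eq]
  linarith

/-- In `exp ((d + 1) L)` one factor `exp L ≥ 2` absorbs the `2` of the two-sided bound, and the
other `d` factors dominate `n ^ d`. -/
theorem one_sub_inv_pow_le {n d L k : ℕ} {ε : ℝ} (hn : n < 2 ^ L) (hn0 : 0 < n) (hL : 0 < L)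
    (hk : 8 * (d + 1) * L ≤ k * ε ^ 2) :
    1 - 1 / (n : ℝ) ^ d ≤ 1 - 2 * Real.exp (-(k * ε ^ 2 / 4)) := by
  have hn0' : (0 : ℝ) < (n : ℝ) ^ d := by positivity
  have h2 : (2 : ℝ) ^ L ≤ Real.exp L := by
    rw [← Real.exp_one_pow]
    exact pow_le_pow_left₀ (by norm_num) (by linarith [Real.add_one_le_exp (1 : ℝ)]) L
  have h3 : (n : ℝ) ≤ Real.exp L := by
    refine le_trans ?_ h2
    exact_mod_cast hn.le
  have h4 : (2 : ℝ) ≤ Real.exp L := by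
    refine le_trans ?_ h2
    simpa using pow_le_pow_right₀ (one_le_two (α := ℝ)) hL
  have h5 : 2 * (n : ℝ) ^ d ≤ Real.exp (k * ε ^ 2 / 4) := by
    calc 2 * (n : ℝ) ^ d ≤ Real.exp L * Real.exp L ^ d := by gcongr
      _ = Real.exp ((d + 1) * L) := by
          rw [← pow_succ', ← Real.exp_nat_mul]; push_cast; ring_nf
      _ ≤ _ := by
          apply Real.exp_le_exp.2
          have : (0 : ℝ) ≤ (d + 1) * L := by positivity
          linarith
  have h6 : 2 * Real.exp (-(k * ε ^ 2 / 4)) ≤ 1 / (n : ℝ) ^ d := by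
    rw [Real.exp_neg, le_div_iff₀ hn0', mul_right_comm, ← div_eq_mul_inv,
      div_le_one (Real.exp_pos _)]
    exact h5
  linarith

end Concentration
/-! ### Values, sizes and costs of expressions -/

/-- The value of an expression, as a function of the memory. -/
def NatExp.val (nat : ℕ → ℕ → ℕ) : NatExp → ℕ
  | lit n => n
  | get a i => nat a (i.val nat)
  | add e f => e.val nat + f.val nat
  | sub e f => e.val nat - f.val nat
  | mul e f => e.val nat * f.val nat

/-- The number of nodes of an expression. -/
def NatExp.nodes : NatExp → ℕ
  | lit _ => 1
  | get _ i => i.nodes + 1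
  | add e f => e.nodes + f.nodes + 1
  | sub e f => e.nodes + f.nodes + 1
  | mul e f => e.nodes + f.nodes + 1

/-- The greatest literal of an expression. -/
def NatExp.maxLit : NatExp → ℕ
  | lit n => n
  | get _ i => i.maxLit
  | add e f => max e.maxLit f.maxLit
  | sub e f => max e.maxLit f.maxLit
  | mul e f => max e.maxLit f.maxLit

/-- The number of nodes of an expression. -/
def NumExp.nodes : NumExp → ℕ
  | ofNat e => e.nodes + 1
  | get _ i => i.nodes + 1
  | add e f => e.nodes + f.nodes + 1
  | sub e f => e.nodes + f.nodes + 1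
  | mul e f => e.nodes + f.nodes + 1
  | div e f => e.nodes + f.nodes + 1

/-- The greatest literal of an expression. -/
def NumExp.maxLit : NumExp → ℕ
  | ofNat e => e.maxLit
  | get _ i => i.maxLit
  | add e f => max e.maxLit f.maxLit
  | sub e f => max e.maxLit f.maxLit
  | mul e f => max e.maxLit f.maxLit
  | div e f => max e.maxLit f.maxLit

/-- An expression without division. -/
def NumExp.noDiv : NumExp → Bool
  | ofNat _ => true
  | get _ _ => true
  | add e f => e.noDiv && f.noDiv
  | sub e f => e.noDiv && f.noDiv
  | mul e f => e.noDiv && f.noDiv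
  | div _ _ => false

/-- An expression without division, except at its root. -/
def NumExp.simple : NumExp → Bool
  | div e f => e.noDiv && f.noDiv
  | e => e.noDiv

/-- The number of nodes of a test. -/
def Test.nodes : Test → ℕ
  | ltNat e f => e.nodes + f.nodes + 1
  | ltNum e f => e.nodes + f.nodes + 1
  | not b => b.nodes + 1
  | and b c => b.nodes + c.nodes + 1

/-- The greatest literal of a test. -/
def Test.maxLit : Test → ℕ
  | ltNat e f => max e.maxLit f.maxLit
  | ltNum e f => max e.maxLit f.maxLit
  | not b => b.maxLit
  | and b c => max b.maxLit c.maxLit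

/-- A test without division. -/
def Test.noDiv : Test → Bool
  | ltNat _ _ => true
  | ltNum e f => e.noDiv && f.noDiv
  | not b => b.noDiv
  | and b c => b.noDiv && c.noDiv

/-- All expressions have fewer than `80` nodes and literals of at most `R`, and divide at most
at the root. -/
def Program.Small (R : ℕ) : Program → Prop
  | skip => True
  | setNat _ i e => i.nodes + e.nodes < 80 ∧ max i.maxLit e.maxLit ≤ R
  | setNum _ i e => i.nodes + e.nodes < 80 ∧ max i.maxLit e.maxLit ≤ R ∧ e.simple
  | rand _ i e => i.nodes + e.nodes < 80 ∧ max i.maxLit e.maxLit ≤ R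
  | seq p q => p.Small R ∧ q.Small R
  | ite b p q => (b.nodes < 80 ∧ b.maxLit ≤ R ∧ b.noDiv) ∧ p.Small R ∧ q.Small R
  | loop b p => (b.nodes < 80 ∧ b.maxLit ≤ R ∧ b.noDiv) ∧ p.Small R

/-- Store a value in a memory. -/
def upd {α : Type} (f : ℕ → ℕ → α) (a i : ℕ) (v : α) : ℕ → ℕ → α :=
  Function.update f a (Function.update (f a) i v)

theorem upd_apply {α : Type} (f : ℕ → ℕ → α) (a i : ℕ) (v : α) (a' i' : ℕ) :
    upd f a i v a' i' = if a' = a ∧ i' = i then v else f a' i' := by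
  by_cases h : a' = a
  · subst h
    by_cases h' : i' = i
    · subst h'; simp [upd]
    · simp [upd, h']
  · simp [upd, h]

section Field

set_option linter.unusedSectionVars false

variable {K : Type} [Field K] [LinearOrder K]

/-- The value of an expression, as a function of the memory. -/
def NumExp.val (nat : ℕ → ℕ → ℕ) (num : ℕ → ℕ → K) : NumExp → K
  | ofNat e => (e.val nat : K)
  | get a i => num a (i.val nat)
  | add e f => e.val nat num + f.val nat num
  | sub e f => e.val nat num - f.val nat num
  | mul e f => e.val nat num * f.val nat num
  | div e f => e.val nat num / f.val nat num

/-- The outcome of a test, as a function of the memory. -/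
def Test.Holds (nat : ℕ → ℕ → ℕ) (num : ℕ → ℕ → K) : Test → Prop
  | ltNat e f => e.val nat < f.val nat
  | ltNum e f => e.val nat num < f.val nat num
  | not b => ¬ b.Holds nat num
  | and b c => b.Holds nat num ∧ c.Holds nat num

theorem NatExp.eval_eq (σ : State K) (e : NatExp) : e.eval σ = e.val σ.nat := by
  induction e <;> simp_all [NatExp.eval, NatExp.val]

theorem NumExp.eval_eq (σ : State K) (e : NumExp) : e.eval σ = e.val σ.nat σ.num := by
  induction e <;> simp_all [NumExp.eval, NumExp.val, NatExp.eval_eq]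

theorem Test.eval_eq (σ : State K) (b : Test) : b.eval σ = true ↔ b.Holds σ.nat σ.num := by
  induction b with
  | ltNat e f => simp [Test.eval, Test.Holds, NatExp.eval_eq]
  | ltNum e f => simp [Test.eval, Test.Holds, NumExp.eval_eq]
  | not b ih => simp [Test.eval, Test.Holds, ← ih]
  | and b c hb hc => simp [Test.eval, Test.Holds, hb, hc]

/-- A family of sets of field elements that controls the growth of numbers along a computation:
natural numbers are bounded in terms of `R`, the level of a product is the sum of the levels, and
an addition increases the level by `1`. -/
structure Grading (sz : K → ℕ) where
  R : ℕ
  two_le : 2 ≤ R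
  b : ℕ
  Q : ℕ → K → Prop
  mono : ∀ {i j x}, i ≤ j → Q i x → Q j x
  add : ∀ {i x y}, Q i x → Q i y → Q (i + 1) (x + y)
  sub : ∀ {i x y}, Q i x → Q i y → Q (i + 1) (x - y)
  mul : ∀ {i j x y}, Q i x → Q j y → Q (i + j) (x * y)
  natCast : ∀ {i m : ℕ}, m ≤ R ^ i → Q i (m : K)
  div : ∀ {i x} {m : ℕ}, 1 ≤ m → m ≤ R → Q i x → Q (i + 1) (x / (m : K))
  size : ∀ {i x}, Q i x → sz x ≤ b * (i + 1)

namespace Grading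

variable {sz : K → ℕ} (G : Grading sz)

/-- The highest level of stored numbers. -/
def top : ℕ := 40 * G.R ^ 2

/-- A bound for the cost of one operation. -/
def unit : ℕ := 1 + 80 * Nat.size G.R + G.b * (80 * G.top + 1)

/-- A bound for the cost of one command. -/
def W : ℕ := 80 * G.unit

/-- All numbers in the memory are small. -/
def Tame (nat : ℕ → ℕ → ℕ) (num : ℕ → ℕ → K) : Prop :=
  (∀ a i, nat a i ≤ G.R) ∧ ∀ a i, G.Q G.top (num a i)

theorem one_le_top : 1 ≤ G.top := by
  have := G.two_le
  rw [top]
  exact Nat.mul_pos (by norm_num) (Nat.pow_pos (by omega))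

theorem one_le_unit : 1 ≤ G.unit := by rw [unit]; omega

theorem zero {i : ℕ} : G.Q i 0 := by
  simpa using G.natCast (i := i) (m := 0) (Nat.zero_le _)

theorem one {i : ℕ} : G.Q i 1 := by
  simpa using G.natCast (i := i) (m := 1) (Nat.one_le_pow _ _ (by have := G.two_le; omega))

/-- Accumulating term by term costs one level per term, so long sums stay at a level linear in their
length. -/
theorem sum_range {i n : ℕ} {f : ℕ → K} (hf : ∀ h < n, G.Q i (f h)) :
    G.Q (i + n) (∑ h ∈ Finset.range n, f h) := by
  induction n with
  | zero => simpa using G.zero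
  | succ n ih =>
    rw [Finset.sum_range_succ, ← add_assoc]
    exact G.add (ih fun h hh => hf h (by omega)) (G.mono (by omega) (hf n (by omega)))

variable {G} {nat : ℕ → ℕ → ℕ} {num : ℕ → ℕ → K}

theorem Tame.updNat (h : G.Tame nat num) {a i v : ℕ} (hv : v ≤ G.R) :
    G.Tame (upd nat a i v) num := by
  refine ⟨fun a' i' => ?_, h.2⟩
  rw [upd_apply]
  split_ifs
  exacts [hv, h.1 _ _]

theorem Tame.updNum (h : G.Tame nat num) {a i : ℕ} {v : K} (hv : G.Q G.top v) :
    G.Tame nat (upd num a i v) := by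
  refine ⟨h.1, fun a' i' => ?_⟩
  rw [upd_apply]
  split_ifs
  exacts [hv, h.2 _ _]

end Grading

variable {sz : K → ℕ} {G : Grading sz} {nat : ℕ → ℕ → ℕ} {num : ℕ → ℕ → K}

theorem NatExp.one_le_nodes (e : NatExp) : 1 ≤ e.nodes := by
  cases e <;> simp [NatExp.nodes]

theorem NatExp.val_le (h : G.Tame nat num) (e : NatExp) (he : e.maxLit ≤ G.R) :
    e.val nat ≤ G.R ^ e.nodes := by
  have hR := G.two_le
  have hp : ∀ m, 1 ≤ m → G.R ≤ G.R ^ m := fun m hm => Nat.le_self_pow (by omega) _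
  induction e with
  | lit n => simpa [NatExp.val, NatExp.nodes, NatExp.maxLit] using he
  | get a i ih => exact (h.1 _ _).trans (hp _ (by simp [NatExp.nodes]))
  | add e f he' hf' =>
    simp only [NatExp.maxLit, max_le_iff] at he
    have h1 := he' he.1
    have h2 := hf' he.2
    have h3 : 2 ≤ G.R ^ e.nodes := hR.trans (hp _ e.one_le_nodes)
    have h4 : 2 ≤ G.R ^ f.nodes := hR.trans (hp _ f.one_le_nodes)
    simp only [NatExp.val, NatExp.nodes]
    -- Both powers are at least `2`, so their sum is at most their product.
    calc e.val nat + f.val nat ≤ G.R ^ e.nodes * G.R ^ f.nodes := by nlinarith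
      _ ≤ G.R ^ (e.nodes + f.nodes + 1) := by
        rw [← pow_add]; exact Nat.pow_le_pow_right (by omega) (by omega)
  | sub e f he' hf' =>
    simp only [NatExp.maxLit, max_le_iff] at he
    simp only [NatExp.val, NatExp.nodes]
    exact (Nat.sub_le _ _).trans ((he' he.1).trans (Nat.pow_le_pow_right (by omega) (by omega)))
  | mul e f he' hf' =>
    simp only [NatExp.maxLit, max_le_iff] at he
    simp only [NatExp.val, NatExp.nodes]
    calc e.val nat * f.val nat ≤ G.R ^ e.nodes * G.R ^ f.nodes :=
          Nat.mul_le_mul (he' he.1) (hf' he.2)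
      _ ≤ G.R ^ (e.nodes + f.nodes + 1) := by
        rw [← pow_add]; exact Nat.pow_le_pow_right (by omega) (by omega)

theorem NatExp.size_val_le (h : G.Tame nat num) (e : NatExp) (he : e.maxLit ≤ G.R)
    (hn : e.nodes ≤ 80) : 1 + Nat.size (e.val nat) ≤ G.unit := by
  have h1 : Nat.size (e.val nat) ≤ e.nodes * Nat.size G.R := by
    rw [Nat.size_le]
    refine (e.val_le h he).trans_lt ?_
    rw [mul_comm, pow_mul]
    exact Nat.pow_lt_pow_left (Nat.lt_size_self _) (by have := e.one_le_nodes; omega)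
  have h2 := Nat.mul_le_mul_right (Nat.size G.R) hn
  rw [Grading.unit]
  omega

theorem NatExp.cost_le {σ : State K} (h : G.Tame σ.nat σ.num) (e : NatExp) (he : e.maxLit ≤ G.R)
    (hn : e.nodes ≤ 80) : e.cost σ ≤ e.nodes * G.unit := by
  have key := fun (he : e.maxLit ≤ G.R) (hn : e.nodes ≤ 80) => e.size_val_le h he hn
  induction e with
  | lit n => simpa [NatExp.cost, NatExp.nodes, NatExp.val] using key he hn
  | get a i ih =>
    have hi : i.nodes ≤ 80 := by simp only [NatExp.nodes] at hn; omega
    have h1 := ih he hi (fun a b => i.size_val_le h a b)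
    have h2 := key he hn
    simp only [NatExp.cost, NatExp.nodes, NatExp.eval_eq, add_mul, one_mul, NatExp.val] at *
    omega
  | add e f ih1 ih2 | sub e f ih1 ih2 | mul e f ih1 ih2 =>
    have h0 := key he hn
    simp only [NatExp.maxLit, max_le_iff] at he
    simp only [NatExp.nodes] at hn
    have h1 := ih1 he.1 (by omega) (fun a b => e.size_val_le h a b)
    have h2 := ih2 he.2 (by omega) (fun a b => f.size_val_le h a b)
    simp only [NatExp.cost, NatExp.nodes, NatExp.eval_eq, add_mul, one_mul, NatExp.val] at *
    omega

/-- Memory entries have level at most `top`, and an inner node adds at most one to the sum of the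
levels of its children. A division by an arbitrary number has no level, so it is excluded. -/
theorem NumExp.val_mem (h : G.Tame nat num) (e : NumExp) (he : e.maxLit ≤ G.R)
    (hd : e.noDiv) : G.Q (e.nodes * G.top) (e.val nat num) := by
  have ht := G.one_le_top
  induction e with
  | ofNat e =>
    refine G.mono ?_ (G.natCast (e.val_le h he))
    simp only [NumExp.nodes]
    nlinarith
  | get a i =>
    refine G.mono ?_ (h.2 a _)
    simp only [NumExp.nodes]
    nlinarith
  | add e f ih1 ih2 =>
    simp only [NumExp.maxLit, max_le_iff] at he
    simp only [NumExp.noDiv, Bool.and_eq_true] at hd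
    simp only [NumExp.nodes, NumExp.val, add_mul, one_mul]
    exact G.mono (by omega) (G.add (i := e.nodes * G.top + f.nodes * G.top)
      (G.mono (by omega) (ih1 he.1 hd.1)) (G.mono (by omega) (ih2 he.2 hd.2)))
  | sub e f ih1 ih2 =>
    simp only [NumExp.maxLit, max_le_iff] at he
    simp only [NumExp.noDiv, Bool.and_eq_true] at hd
    simp only [NumExp.nodes, NumExp.val, add_mul, one_mul]
    exact G.mono (by omega) (G.sub (i := e.nodes * G.top + f.nodes * G.top)
      (G.mono (by omega) (ih1 he.1 hd.1)) (G.mono (by omega) (ih2 he.2 hd.2)))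
  | mul e f ih1 ih2 =>
    simp only [NumExp.maxLit, max_le_iff] at he
    simp only [NumExp.noDiv, Bool.and_eq_true] at hd
    simp only [NumExp.nodes, NumExp.val, add_mul, one_mul]
    exact G.mono (by omega) (G.mul (ih1 he.1 hd.1) (ih2 he.2 hd.2))
  | div e f => simp [NumExp.noDiv] at hd

theorem Grading.one_add_size_le {x : K} {m : ℕ} (hm : m ≤ 80) (hx : G.Q (m * G.top) x) :
    1 + sz x ≤ G.unit := by
  have h1 := G.size hx
  have h2 := Nat.mul_le_mul_left G.b (Nat.add_le_add_right (Nat.mul_le_mul_right G.top hm) 1)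
  rw [Grading.unit]
  omega

theorem NumExp.cost_le {σ : State K} (h : G.Tame σ.nat σ.num) (e : NumExp) (he : e.maxLit ≤ G.R)
    (hd : e.noDiv) (hn : e.nodes ≤ 80) : e.cost sz σ ≤ e.nodes * G.unit := by
  have key := fun (he : e.maxLit ≤ G.R) (hd : e.noDiv) (hn : e.nodes ≤ 80) =>
    Grading.one_add_size_le hn (e.val_mem h he hd)
  induction e with
  | ofNat e =>
    have h0 := key he hd hn
    simp only [NumExp.nodes] at hn
    have h1 := e.cost_le h he (by omega)
    simp only [NumExp.cost, NumExp.nodes, NatExp.eval_eq, add_mul, one_mul, NumExp.val] at *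
    omega
  | get a i =>
    have h0 := key he hd hn
    simp only [NumExp.nodes] at hn
    have h1 := i.cost_le h he (by omega)
    simp only [NumExp.cost, NumExp.nodes, NatExp.eval_eq, add_mul, one_mul, NumExp.val] at *
    omega
  | add e f ih1 ih2 | sub e f ih1 ih2 | mul e f ih1 ih2 =>
    have h0 := key he hd hn
    simp only [NumExp.maxLit, max_le_iff] at he
    simp only [NumExp.noDiv, Bool.and_eq_true] at hd
    simp only [NumExp.nodes] at hn
    have h1 := ih1 he.1 hd.1 (by omega)
      (fun a b c => Grading.one_add_size_le c (e.val_mem h a b))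
    have h2 := ih2 he.2 hd.2 (by omega)
      (fun a b c => Grading.one_add_size_le c (f.val_mem h a b))
    simp only [NumExp.cost, NumExp.nodes, NumExp.eval_eq, add_mul, one_mul, NumExp.val] at *
    omega
  | div e f => simp [NumExp.noDiv] at hd

/-- The grading cannot predict the size of a quotient. A division is therefore allowed only at the
root, where the correctness proof knows the stored value and supplies `hQ`. -/
theorem NumExp.cost_le_of_simple {σ : State K} (h : G.Tame σ.nat σ.num) (e : NumExp)
    (he : e.maxLit ≤ G.R) (hd : e.simple) (hn : e.nodes ≤ 80)
    (hQ : G.Q G.top (e.val σ.nat σ.num)) : e.cost sz σ ≤ e.nodes * G.unit := by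
  cases e with
  | div e f =>
    simp only [NumExp.maxLit, max_le_iff] at he
    simp only [NumExp.simple, Bool.and_eq_true] at hd
    simp only [NumExp.nodes] at hn
    have h0 := Grading.one_add_size_le (m := 1) (by norm_num) (by rwa [one_mul])
    have h1 := e.cost_le h he.1 hd.1 (by omega)
    have h2 := f.cost_le h he.2 hd.2 (by omega)
    simp only [NumExp.cost, NumExp.nodes, NumExp.eval_eq, add_mul, one_mul, NumExp.val] at *
    omega
  | _ => exact NumExp.cost_le h _ he hd hn

theorem Test.cost_le {σ : State K} (h : G.Tame σ.nat σ.num) (b : Test) (hb : b.maxLit ≤ G.R)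
    (hd : b.noDiv) (hn : b.nodes ≤ 80) : b.cost sz σ ≤ b.nodes * G.unit := by
  have hu := G.one_le_unit
  induction b with
  | ltNat e f =>
    simp only [Test.maxLit, max_le_iff] at hb
    simp only [Test.nodes] at hn
    have h1 := e.cost_le h hb.1 (by omega)
    have h2 := f.cost_le h hb.2 (by omega)
    simp only [Test.cost, Test.nodes, add_mul, one_mul]
    omega
  | ltNum e f =>
    simp only [Test.maxLit, max_le_iff] at hb
    simp only [Test.noDiv, Bool.and_eq_true] at hd
    simp only [Test.nodes] at hn
    have h1 := e.cost_le h hb.1 hd.1 (by omega)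
    have h2 := f.cost_le h hb.2 hd.2 (by omega)
    simp only [Test.cost, Test.nodes, add_mul, one_mul]
    omega
  | not b ih =>
    simp only [Test.nodes] at hn
    have h1 := ih hb hd (by omega)
    simp only [Test.cost, Test.nodes, add_mul, one_mul]
    omega
  | and b c ih1 ih2 =>
    simp only [Test.maxLit, max_le_iff] at hb
    simp only [Test.noDiv, Bool.and_eq_true] at hd
    simp only [Test.nodes] at hn
    have h1 := ih1 hb.1 hd.1 (by omega)
    have h2 := ih2 hb.2 hd.2 (by omega)
    simp only [Test.cost, Test.nodes, add_mul, one_mul]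
    omega

/-! ### Hoare logic with costs -/

/-- A condition on memories. -/
abbrev Cond (K : Type) : Type := (ℕ → ℕ → ℕ) → (ℕ → ℕ → K) → Prop

/-- From a given tame memory, the program ends in tame memories with the property `post`, at the
cost of `m` commands. -/
def Grading.Sat (G : Grading sz) (fuel : ℕ) (p : Program) (nat : ℕ → ℕ → ℕ) (num : ℕ → ℕ → K)
    (m : ℕ) (post : Cond K) : Prop :=
  p.Small G.R → G.Tame nat num → ∀ t, ∀ σ ∈ (p.run sz fuel ⟨nat, num, t⟩).support,
    G.Tame σ.nat σ.num ∧ post σ.nat σ.num ∧ σ.time ≤ t + m * G.W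

variable {fuel m m' : ℕ} {post mid : Cond K}

theorem Grading.Sat.mono {p : Program} (h : G.Sat fuel p nat num m post) (hm : m ≤ m')
    (hp : ∀ nat num, post nat num → mid nat num) : G.Sat fuel p nat num m' mid := by
  intro hs ht t σ hσ
  obtain ⟨h1, h2, h3⟩ := h hs ht t σ hσ
  exact ⟨h1, hp _ _ h2, h3.trans (Nat.add_le_add_left (Nat.mul_le_mul_right _ hm) _)⟩

theorem Grading.sat_skip (h : post nat num) : G.Sat fuel .skip nat num 1 post := by
  intro _ ht t σ hσ
  rw [Program.run, PMF.mem_support_pure_iff] at hσ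
  subst hσ
  refine ⟨ht, h, ?_⟩
  have := G.one_le_unit
  simp only [State.tick, Grading.W]
  omega

theorem Grading.sat_setNat {a : ℕ} {i e : NatExp} (hv : e.val nat ≤ G.R)
    (h : post (upd nat a (i.val nat) (e.val nat)) num) :
    G.Sat fuel (.setNat a i e) nat num 1 post := by
  intro hs ht t σ hσ
  rw [Program.run, PMF.mem_support_pure_iff] at hσ
  subst hσ
  obtain ⟨h1, h2⟩ := hs
  rw [max_le_iff] at h2
  have c1 := NatExp.cost_le (σ := ⟨nat, num, t⟩) ht i h2.1 (by omega)
  have c2 := NatExp.cost_le (σ := ⟨nat, num, t⟩) ht e h2.2 (by omega)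
  have c3 := Nat.mul_le_mul_right G.unit (Nat.succ_le_of_lt h1)
  have := G.one_le_unit
  simp only [NatExp.eval_eq]
  refine ⟨ht.updNat hv, h, ?_⟩
  simp only [State.tick, Grading.W, State.putNat]
  rw [Nat.succ_mul, add_mul] at c3
  omega

theorem Grading.sat_setNum {a : ℕ} {i : NatExp} {e : NumExp} (hv : G.Q G.top (e.val nat num))
    (h : post nat (upd num a (i.val nat) (e.val nat num))) :
    G.Sat fuel (.setNum a i e) nat num 1 post := by
  intro hs ht t σ hσ
  rw [Program.run, PMF.mem_support_pure_iff] at hσ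
  subst hσ
  obtain ⟨h1, h2, h3⟩ := hs
  rw [max_le_iff] at h2
  have c1 := NatExp.cost_le (σ := ⟨nat, num, t⟩) ht i h2.1 (by omega)
  have c2 := NumExp.cost_le_of_simple (σ := ⟨nat, num, t⟩) ht e h2.2 h3 (by omega) hv
  have c3 := Nat.mul_le_mul_right G.unit (Nat.succ_le_of_lt h1)
  have := G.one_le_unit
  simp only [NatExp.eval_eq, NumExp.eval_eq]
  refine ⟨ht.updNum hv, h, ?_⟩
  simp only [State.tick, Grading.W, State.putNum]
  rw [Nat.succ_mul, add_mul] at c3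
  omega

/-- `Sat` quantifies over the support only. The distribution of the drawn numbers is treated in
`map_run_draw`. -/
theorem Grading.sat_rand {a : ℕ} {i e : NatExp} (hv : e.val nat ≤ G.R)
    (h : ∀ v ≤ e.val nat, post (upd nat a (i.val nat) v) num) :
    G.Sat fuel (.rand a i e) nat num 1 post := by
  intro hs ht t σ hσ
  rw [Program.run, PMF.mem_support_map_iff] at hσ
  obtain ⟨v, -, rfl⟩ := hσ
  obtain ⟨h1, h2⟩ := hs
  rw [max_le_iff] at h2
  have c1 := NatExp.cost_le (σ := ⟨nat, num, t⟩) ht i h2.1 (by omega)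
  have c2 := NatExp.cost_le (σ := ⟨nat, num, t⟩) ht e h2.2 (by omega)
  have c3 := Nat.mul_le_mul_right G.unit (Nat.succ_le_of_lt h1)
  have := G.one_le_unit
  have hv2 : (v : ℕ) ≤ e.val nat := by
    have := v.2
    have e0 := NatExp.eval_eq (⟨nat, num, t⟩ : State K) e
    exact (Nat.lt_succ_iff.1 this).trans e0.le
  rw [NatExp.eval_eq]
  refine ⟨ht.updNat (hv2.trans hv), h v hv2, ?_⟩
  simp only [State.tick, Grading.W, State.putNat]
  rw [Nat.succ_mul, add_mul] at c3
  omega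

theorem Grading.sat_seq {p q : Program} (hp : G.Sat fuel p nat num m mid)
    (hq : ∀ nat num, mid nat num → G.Sat fuel q nat num m' post) :
    G.Sat fuel (.seq p q) nat num (m + m') post := by
  intro hs ht t σ hσ
  rw [Program.run, PMF.mem_support_bind_iff] at hσ
  obtain ⟨σ', h1, h2⟩ := hσ
  obtain ⟨a1, a2, a3⟩ := hp hs.1 ht t σ' h1
  obtain ⟨b1, b2, b3⟩ := hq _ _ a2 hs.2 a1 σ'.time σ h2
  refine ⟨b1, b2, ?_⟩
  rw [add_mul]
  omega

theorem Grading.test_cost_le {b : Test} (hb : b.nodes < 80 ∧ b.maxLit ≤ G.R ∧ b.noDiv)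
    {σ : State K} (ht : G.Tame σ.nat σ.num) : b.cost sz σ ≤ G.W := by
  refine (Test.cost_le ht b hb.2.1 hb.2.2 hb.1.le).trans ?_
  exact Nat.mul_le_mul_right _ hb.1.le

theorem Grading.sat_ite {b : Test} {p q : Program}
    (hp : b.Holds nat num → G.Sat fuel p nat num m post)
    (hq : ¬ b.Holds nat num → G.Sat fuel q nat num m post) :
    G.Sat fuel (.ite b p q) nat num (m + 1) post := by
  intro hs ht t σ hσ
  have hc := Grading.test_cost_le hs.1 (σ := ⟨nat, num, t⟩) ht
  rw [Program.run] at hσ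
  have key : G.Tame σ.nat σ.num ∧ post σ.nat σ.num ∧
      σ.time ≤ (t + b.cost sz ⟨nat, num, t⟩) + m * G.W := by
    split_ifs at hσ with hb
    · exact hp ((Test.eval_eq ⟨nat, num, t⟩ b).1 hb) hs.2.1 ht _ σ hσ
    · exact hq (mt (Test.eval_eq ⟨nat, num, t⟩ b).2 hb) hs.2.2 ht _ σ hσ
  refine ⟨key.1, key.2.1, ?_⟩
  rw [add_mul, one_mul]
  omega

/-- The cost is that of `n` rounds of test and body, plus the final failing test, for which `n <
fuel` leaves one round of fuel. -/
theorem Grading.sat_loop {b : Test} {p : Program} {n : ℕ} (hn : n < fuel) (I : ℕ → Cond K)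
    (hI : ∀ j < n, ∀ nat num, I j nat num →
      b.Holds nat num ∧ G.Sat fuel p nat num m (I (j + 1)))
    (hend : ∀ nat num, I n nat num → ¬ b.Holds nat num) (h0 : I 0 nat num) :
    G.Sat fuel (.loop b p) nat num (n * (m + 1) + 1) (I n) := by
  intro hs ht
  -- The induction is on the remaining rounds `r`, with the remaining fuel `f` kept general because
  -- `loopUpTo` decreases it.
  suffices H : ∀ r j nat num t f, j + r = n → r < f → I j nat num → G.Tame nat num →
      ∀ σ ∈ (loopUpTo sz b (p.run sz fuel) f ⟨nat, num, t⟩).support,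
        G.Tame σ.nat σ.num ∧ I n σ.nat σ.num ∧ σ.time ≤ t + (r * (m + 1) + 1) * G.W by
    intro t σ hσ
    exact H n 0 nat num t fuel (by omega) hn h0 ht σ hσ
  intro r
  induction r with
  | zero =>
    intro j nat num t f hj hf h ht σ hσ
    obtain ⟨f, rfl⟩ := Nat.exists_eq_succ_of_ne_zero (by omega : f ≠ 0)
    obtain rfl : j = n := by omega
    have hc := Grading.test_cost_le hs.1 (σ := ⟨nat, num, t⟩) ht
    rw [loopUpTo, if_neg (mt (Test.eval_eq _ b).1 (hend _ _ h)), PMF.mem_support_pure_iff] at hσ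
    subst hσ
    refine ⟨ht, h, ?_⟩
    simp only [State.tick]
    omega
  | succ r ih =>
    intro j nat num t f hj hf h ht σ hσ
    obtain ⟨f, rfl⟩ := Nat.exists_eq_succ_of_ne_zero (by omega : f ≠ 0)
    have hc := Grading.test_cost_le hs.1 (σ := ⟨nat, num, t⟩) ht
    obtain ⟨hb, hp⟩ := hI j (by omega) nat num h
    rw [loopUpTo, if_pos ((Test.eval_eq _ b).2 hb), PMF.mem_support_bind_iff] at hσ
    obtain ⟨σ', h1, h2⟩ := hσ
    obtain ⟨a1, a2, a3⟩ := hp hs.2 ht (t + b.cost sz ⟨nat, num, t⟩) σ' h1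
    obtain ⟨b1, b2, b3⟩ := ih (j + 1) _ _ σ'.time f (by omega) (by omega) a2 a1 σ h2
    refine ⟨b1, b2, ?_⟩
    have e : ((r + 1) * (m + 1) + 1) * G.W = (r * (m + 1) + 1) * G.W + m * G.W + G.W := by ring
    rw [e]
    omega

/-- A scalar variable of type `ℕ`. -/
def nv (x : ℕ) : NatExp := .get x (.lit 0)

/-- Let the variable `x` run through the natural numbers below `e`. -/
def forLoop (x : ℕ) (e : NatExp) (p : Program) : Program :=
  .seq (.setNat x (.lit 0) (.lit 0))
    (.loop (.ltNat (nv x) e) (.seq p (.setNat x (.lit 0) (.add (nv x) (.lit 1)))))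

/-- The body must establish the invariant for the memory in which the counter has already advanced.
The bound `e` is evaluated anew in each round, so `he` asks that the invariant fix its value. Each
round adds a test and an increment; initialization and the last test give the final `2`. -/
theorem Grading.sat_forLoop {x : ℕ} {e : NatExp} {p : Program} {n : ℕ} (hn : n < fuel)
    (hR : n ≤ G.R) (I : ℕ → Cond K)
    (hI : ∀ j < n, ∀ nat num, nat x 0 = j → I j nat num →
      G.Sat fuel p nat num m fun nat num => nat x 0 = j ∧ I (j + 1) (upd nat x 0 (j + 1)) num)
    (he : ∀ j ≤ n, ∀ nat num, nat x 0 = j → I j nat num → e.val nat = n)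
    (h0 : I 0 (upd nat x 0 0) num) :
    G.Sat fuel (forLoop x e p) nat num (n * (m + 2) + 2) (I n) := by
  have hl := Grading.sat_loop (G := G) (b := .ltNat (nv x) e) (m := m + 1)
    (p := .seq p (.setNat x (.lit 0) (.add (nv x) (.lit 1)))) hn
    (I := fun j nat num => j ≤ n ∧ nat x 0 = j ∧ I j nat num)
    (nat := upd nat x 0 0) (num := num) ?_ ?_ ⟨Nat.zero_le _, by simp [upd_apply], h0⟩
  · refine (Grading.sat_seq (mid := fun a b => a = upd nat x 0 0 ∧ b = num)
      (Grading.sat_setNat (Nat.zero_le _) ⟨rfl, rfl⟩) ?_).mono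
      (show 1 + (n * (m + 2) + 1) ≤ n * (m + 2) + 2 by omega) fun _ _ h => h
    rintro _ _ ⟨rfl, rfl⟩
    exact hl.mono (by simp [add_assoc]) fun _ _ h => h.2.2
  · rintro j hj nat num ⟨-, h1, h2⟩
    refine ⟨?_, Grading.sat_seq (hI j hj nat num h1 h2) ?_⟩
    · simp only [Test.Holds, he j hj.le nat num h1 h2, nv, NatExp.val, h1]
      exact hj
    · rintro nat num ⟨h1, h2⟩
      refine Grading.sat_setNat ?_ ?_
      · simp only [NatExp.val, nv, h1]; omega
      · simp only [NatExp.val, nv, h1]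
        exact ⟨hj, by simp [upd_apply], h2⟩
  · rintro nat num ⟨-, h1, h2⟩
    simp only [Test.Holds, he n le_rfl nat num h1 h2, nv, NatExp.val, h1]
    omega

end Field

/-! ### The program

Arrays of natural numbers: `0` input, `1` sampled actions, `2` number of samples, `3`, `4` power of
two and its exponent, `5` a bound for `1 / ε`, `6` position in the sampling loop, `7` sample,
`8` count, `9`–`12` loop variables. Arrays of field elements: `0`–`2` input, `3` output, `4` kernel,
`5` matrices and `6` coefficients of the Faddeev–LeVerrier recursion, `7` accumulator, `8`
numerator and `9` denominator of the value. -/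

namespace Code

/-- The number of states. -/
def nS : NatExp := .get 0 (.lit 0)

/-- The number of actions. -/
def nA : NatExp := .get 0 (.lit 1)

/-- The initial state. -/
def start : NatExp := .get 0 (.lit 2)

/-- The size of the input. -/
def size : NatExp := .get 0 (.lit 3)

/-- A scalar variable with values in the field. -/
def rv (x : ℕ) : NumExp := .get x (.lit 0)

/-- The pair of the state `i` and its action in the current sample. -/
def row (i : NatExp) : NatExp := .add (.mul i nA) (.get 1 (.add (.mul (nv 7) nS) i))

/-- A transition probability under the current sample. -/
def trans (i l : NatExp) : NumExp := .get 2 (.add (.mul (row i) nS) l)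

/-- A reward under the current sample. -/
def gain (i : NatExp) : NumExp := .get 1 (row i)

/-- The position of an entry of a matrix. -/
def cell (i l : NatExp) : NatExp := .add (.mul i nS) l

/-- Compute the number of samples. -/
def prelude (d : ℕ) : Program :=
  .seq (.setNat 3 (.lit 0) (.lit 1)) <|
  .seq (.loop (.ltNat (nv 3) (.add size (.lit 1)))
    (.seq (.setNat 3 (.lit 0) (.add (nv 3) (nv 3)))
      (.setNat 4 (.lit 0) (.add (nv 4) (.lit 1))))) <|
  .seq (.loop (.ltNum (.mul (.ofNat (nv 5)) (.get 0 (.lit 2))) (.ofNat (.lit 1)))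
    (.setNat 5 (.lit 0) (.add (nv 5) (.lit 1)))) <|
  .setNat 2 (.lit 0) (.mul (.mul (.lit (8 * (d + 1))) (.mul (nv 5) (nv 5))) (nv 4))

/-- Draw all actions of all samples. -/
def fill : Program :=
  forLoop 6 (.mul (nv 2) nS) (.rand 1 (nv 6) (.sub nA (.lit 1)))

/-- Compute the kernel of the current sample. -/
def kernel : Program :=
  forLoop 10 nS <|
    .seq (.ite (.and (.not (.ltNum (trans (nv 10) (nv 10)) (.ofNat (.lit 1))))
        (.not (.ltNum (.ofNat (.lit 0)) (.mul (gain (nv 10)) (gain (nv 10))))))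
      (.setNum 7 (.lit 0) (.ofNat (.lit 0)))
      (.setNum 7 (.lit 0) (rv 0))) <|
    forLoop 11 nS
      (.setNum 4 (cell (nv 10) (nv 11)) (.mul (rv 7) (trans (nv 10) (nv 11))))

/-- Add the contribution of the current matrix to the numerator. -/
def numerator : Program :=
  .seq (.setNum 8 (.lit 0) (.add (rv 8) (.mul (.get 6 (nv 9)) (gain start)))) <|
  forLoop 11 nS
    (.setNum 8 (.lit 0)
      (.add (rv 8) (.mul (.get 5 (cell (cell (nv 9) start) (nv 11))) (gain (nv 11)))))

/-- Compute one entry of the next matrix. -/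
def entry : Program :=
  .seq (.setNum 7 (.lit 0) (.mul (.get 6 (nv 9)) (.get 4 (cell (nv 10) (nv 11))))) <|
  .seq (forLoop 12 nS
    (.setNum 7 (.lit 0) (.add (rv 7) (.mul (.get 4 (cell (nv 10) (nv 12)))
      (.get 5 (cell (cell (nv 9) (nv 12)) (nv 11))))))) <|
  .setNum 5 (cell (cell (.add (nv 9) (.lit 1)) (nv 10)) (nv 11)) (rv 7)

/-- Compute the next matrix. -/
def matrix : Program := forLoop 10 nS (forLoop 11 nS entry)

/-- Compute the next coefficient. -/
def coefficient : Program :=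
  .seq (.setNum 7 (.lit 0) (.ofNat (.lit 0))) <|
  .seq (forLoop 10 nS (.setNum 7 (.lit 0) (.add (rv 7)
    (.get 5 (cell (cell (.add (nv 9) (.lit 1)) (nv 10)) (nv 10)))))) <|
  .seq (.setNum 6 (.add (nv 9) (.lit 1))
    (.div (.sub (.ofNat (.lit 0)) (rv 7)) (.ofNat (.add (nv 9) (.lit 1))))) <|
  .setNum 9 (.lit 0) (.add (rv 9) (.get 6 (.add (nv 9) (.lit 1))))

/-- Compute numerator and denominator of the value of the current sample. -/
def evaluate : Program :=
  .seq kernel <|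
  .seq (.setNum 6 (.lit 0) (.ofNat (.lit 1))) <|
  .seq (.setNum 8 (.lit 0) (.ofNat (.lit 0))) <|
  .seq (.setNum 9 (.lit 0) (.ofNat (.lit 1))) <|
  forLoop 9 nS (.seq numerator (.seq matrix coefficient))

/-- Count the current sample if it is good. -/
def sample : Program :=
  .seq evaluate <|
  .ite (.ltNum (.mul (.mul (.get 0 (.lit 1)) (rv 9)) (rv 9)) (.mul (rv 8) (rv 9)))
    (.setNat 8 (.lit 0) (.add (nv 8) (.lit 1))) .skip

/-- Compute the fraction of good samples. -/
def count : Program :=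
  .seq (.setNat 8 (.lit 0) (.lit 0)) <|
  .seq (forLoop 7 (nv 2) sample) <|
  .setNum 3 (.lit 0) (.div (.ofNat (nv 8)) (.ofNat (nv 2)))

/-- The algorithm. -/
def main (d : ℕ) : Program := .seq (prelude d) (.seq fill count)

theorem small_main (d : ℕ) {R : ℕ} (hR : 8 * (d + 1) ≤ R) : (main d).Small R := by
  simp [main, prelude, fill, count, sample, evaluate, coefficient, matrix, entry, numerator, kernel,
    forLoop, Program.Small, NatExp.nodes, NumExp.nodes, Test.nodes, NatExp.maxLit, NumExp.maxLit,
    Test.maxLit, NumExp.noDiv, NumExp.simple, Test.noDiv, nv, rv, row, trans, gain, cell, nS, nA,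
    start, size]
  omega

end Code

/-! ### What the program computes -/

/-- The recursion of Faddeev and LeVerrier, in terms of functions on the natural numbers. -/
def leVerrierSeq {K : Type} [Field K] (a : ℕ → ℕ → K) (N : ℕ) : ℕ → K × (ℕ → ℕ → K)
  | 0 => (1, fun _ _ => 0)
  | t + 1 =>
    let c := (leVerrierSeq a N t).1
    let B := (leVerrierSeq a N t).2
    let B' := fun i l => c * a i l + ∑ h ∈ Finset.range N, a i h * B h l
    ((0 - ∑ i ∈ Finset.range N, B' i i) / ((t + 1 : ℕ) : K), B')

/-- The numerator of the value of a policy. -/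
def numeratorSeq {K : Type} [Field K] (a : ℕ → ℕ → K) (r : ℕ → K) (N s t : ℕ) : K :=
  ∑ u ∈ Finset.range t, ((leVerrierSeq a N u).1 * r s +
    ∑ l ∈ Finset.range N, (leVerrierSeq a N u).2 s l * r l)

/-- The denominator of the value of a policy. -/
def denominatorSeq {K : Type} [Field K] (a : ℕ → ℕ → K) (N t : ℕ) : K :=
  ∑ u ∈ Finset.range (t + 1), (leVerrierSeq a N u).1

theorem leVerrierSeq_eq {K : Type} [Field K] {N : ℕ} (A : Matrix (Fin N) (Fin N) K)
    (a : ℕ → ℕ → K) (ha : ∀ i l : Fin N, a i l = A i l) (t : ℕ) :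
    (leVerrierSeq a N t).1 = (leVerrier A t).1 ∧
      ∀ i l : Fin N, (leVerrierSeq a N t).2 i l = (leVerrier A t).2 i l := by
  induction t with
  | zero => simp [leVerrierSeq, leVerrier]
  | succ t ih =>
    have hB : ∀ i l : Fin N, (leVerrierSeq a N (t + 1)).2 i l = (leVerrier A (t + 1)).2 i l := by
      intro i l
      simp only [leVerrierSeq, leVerrier, Matrix.add_apply, Matrix.smul_apply, Matrix.mul_apply,
        smul_eq_mul, Finset.sum_range, ih.1, ih.2, ha]
    refine ⟨?_, hB⟩
    have h1 : (leVerrierSeq a N (t + 1)).1 =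
        (0 - ∑ i ∈ Finset.range N, (leVerrierSeq a N (t + 1)).2 i i) / ((t + 1 : ℕ) : K) := rfl
    have h2 : (leVerrier A (t + 1)).1 = -(leVerrier A (t + 1)).2.trace / ((t : K) + 1) := rfl
    rw [h1, h2, Finset.sum_range, zero_sub, Matrix.trace]
    simp [hB]

theorem numeratorSeq_eq {K : Type} [Field K] [CharZero K] {N : ℕ} (A : Matrix (Fin N) (Fin N) K)
    (a : ℕ → ℕ → K) (ha : ∀ i l : Fin N, a i l = A i l) (r : ℕ → K) (r' : Fin N → K)
    (hr : ∀ i : Fin N, r i = r' i) (s : Fin N) :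
    numeratorSeq a r N s N = ((1 - A).adjugate.mulVec r') s := by
  have h := sum_leVerrier_snd A
  rw [Fintype.card_fin] at h
  rw [← h, Matrix.sum_mulVec, Finset.sum_apply]
  refine Finset.sum_congr rfl fun t _ => ?_
  rw [Matrix.add_mulVec, Matrix.smul_mulVec, Matrix.one_mulVec, Pi.add_apply, Pi.smul_apply,
    (leVerrierSeq_eq A a ha t).1, Finset.sum_range, add_comm]
  simp only [Matrix.mulVec, dotProduct, (leVerrierSeq_eq A a ha t).2, hr, smul_eq_mul]

theorem denominatorSeq_eq {K : Type} [Field K] [CharZero K] {N : ℕ}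
    (A : Matrix (Fin N) (Fin N) K) (a : ℕ → ℕ → K) (ha : ∀ i l : Fin N, a i l = A i l) :
    denominatorSeq a N N = (1 - A).det := by
  have h := sum_leVerrier_fst A
  rw [Fintype.card_fin] at h
  rw [← h]
  exact Finset.sum_congr rfl fun t _ => (leVerrierSeq_eq A a ha t).1

/-- The level of the numbers in step `t` of the recursion. -/
def stepLevel (N t : ℕ) : ℕ := 1 + t * (2 * N + 5)

theorem stepLevel_mono {N t t' : ℕ} (h : t ≤ t') : stepLevel N t ≤ stepLevel N t' :=
  Nat.add_le_add_left (Nat.mul_le_mul_right _ h) _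

/-! ### Growth of the numbers in the recursion. -/

section Levels

set_option linter.unusedSectionVars false

variable {K : Type} [Field K] [LinearOrder K] {sz : K → ℕ} (G : Grading sz) {N : ℕ}
  {a : ℕ → ℕ → K} {r : ℕ → K}

theorem Grading.stepLevel_le_top (hN : N ≤ G.R) : stepLevel N N + 2 * N + 10 ≤ G.top := by
  have := G.two_le
  rw [stepLevel, Grading.top]
  nlinarith

/-- A matrix entry adds `N + 3` levels: `2` for the factor from the kernel and `N + 1` for
additions. Trace, negation and division add `N + 2` more, in total `2 N + 5` per step. Two growing
numbers are never multiplied, so the level is linear in `t`. -/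
theorem Grading.leVerrierSeq_mem (hN : N ≤ G.R) (ha : ∀ i l, G.Q 2 (a i l)) {t : ℕ} (ht : t ≤ N) :
    G.Q (stepLevel N t) (leVerrierSeq a N t).1 ∧
      ∀ i l, G.Q (stepLevel N t) ((leVerrierSeq a N t).2 i l) := by
  induction t with
  | zero => exact ⟨G.one, fun _ _ => G.zero⟩
  | succ t ih =>
    obtain ⟨h1, h2⟩ := ih (by omega)
    have hB : ∀ i l, G.Q (stepLevel N t + N + 3) ((leVerrierSeq a N (t + 1)).2 i l) := by
      intro i l
      refine G.mono (by omega) (G.add (i := stepLevel N t + 2 + N)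
        (G.mono (by omega) (G.mul h1 (ha i l))) (G.sum_range fun h _ => ?_))
      exact G.mono (by omega) (G.mul (ha i h) (h2 h l))
    have e : stepLevel N (t + 1) = stepLevel N t + 2 * N + 5 := by rw [stepLevel, stepLevel]; ring
    refine ⟨?_, fun i l => G.mono (by omega) (hB i l)⟩
    refine G.mono (i := stepLevel N t + N + 3 + N + 1 + 1) (by omega)
      (G.div (by omega) (by omega) (G.sub G.zero (G.sum_range fun i _ => hB i i)))

/-- Partial sums up to `H` are included because the accumulator stores each of them, and every
stored number has to be tame. -/
theorem Grading.entry_mem (hN : N ≤ G.R) (ha : ∀ i l, G.Q 2 (a i l)) {t H : ℕ} (ht : t < N)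
    (hH : H ≤ N) (i l : ℕ) :
    G.Q G.top ((leVerrierSeq a N t).1 * a i l +
      ∑ h ∈ Finset.range H, a i h * (leVerrierSeq a N t).2 h l) := by
  obtain ⟨h1, h2⟩ := G.leVerrierSeq_mem hN ha ht.le
  have h3 := G.stepLevel_le_top hN
  have h4 := stepLevel_mono (N := N) ht.le
  refine G.mono (by omega) (G.add (i := stepLevel N t + 2 + H)
    (G.mono (by omega) (G.mul h1 (ha i l))) (G.sum_range fun h _ => ?_))
  exact G.mono (by omega) (G.mul (ha i h) (h2 h l))

theorem Grading.trace_mem (hN : N ≤ G.R) (ha : ∀ i l, G.Q 2 (a i l)) {t H : ℕ} (ht : t ≤ N)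
    (hH : H ≤ N) :
    G.Q G.top (∑ i ∈ Finset.range H, (leVerrierSeq a N t).2 i i) := by
  obtain ⟨h1, h2⟩ := G.leVerrierSeq_mem hN ha ht
  have h3 := G.stepLevel_le_top hN
  have h4 := stepLevel_mono (N := N) ht
  exact G.mono (by omega) (G.sum_range fun h _ => h2 h h)

theorem Grading.numerator_mem (hN : N ≤ G.R) (ha : ∀ i l, G.Q 2 (a i l)) (hr : ∀ i, G.Q 1 (r i))
    {t H : ℕ} (ht : t < N) (hH : H ≤ N) (s : ℕ) :
    G.Q G.top (numeratorSeq a r N s t + ((leVerrierSeq a N t).1 * r s +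
      ∑ l ∈ Finset.range H, (leVerrierSeq a N t).2 s l * r l)) := by
  have h3 := G.stepLevel_le_top hN
  have key : ∀ u H, u ≤ N → H ≤ N → G.Q (stepLevel N N + N + 2)
      ((leVerrierSeq a N u).1 * r s +
        ∑ l ∈ Finset.range H, (leVerrierSeq a N u).2 s l * r l) := by
    intro u H hu hH
    obtain ⟨h1, h2⟩ := G.leVerrierSeq_mem hN ha hu
    have h4 := stepLevel_mono (N := N) hu
    refine G.mono (by omega) (G.add (i := stepLevel N N + 1 + H)
      (G.mono (by omega) (G.mul h1 (hr s))) (G.sum_range fun h _ => ?_))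
    exact G.mono (by omega) (G.mul (h2 s h) (hr h))
  refine G.mono (by omega) (G.add (i := stepLevel N N + N + 2 + t)
    (G.sum_range fun u hu => key u N (by omega) le_rfl) (G.mono (by omega) (key t H ht.le hH)))

theorem Grading.denominator_mem (hN : N ≤ G.R) (ha : ∀ i l, G.Q 2 (a i l)) {t : ℕ} (ht : t ≤ N) :
    G.Q G.top (denominatorSeq a N t) := by
  have h3 := G.stepLevel_le_top hN
  refine G.mono (i := stepLevel N N + (t + 1)) (by omega) (G.sum_range fun u hu => ?_)
  exact G.mono (stepLevel_mono (by omega)) (G.leVerrierSeq_mem hN ha (by omega)).1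

end Levels

theorem flat_div {N l : ℕ} (hl : l < N) (i : ℕ) : (i * N + l) / N = i := by
  rw [mul_comm, Nat.mul_add_div (by omega), Nat.div_eq_of_lt hl, add_zero]

theorem flat_mod {N l : ℕ} (hl : l < N) (i : ℕ) : (i * N + l) % N = l := by
  rw [mul_comm, Nat.mul_add_mod, Nat.mod_eq_of_lt hl]

theorem flat_lt {N M i l : ℕ} (hi : i < M) (hl : l < N) : i * N + l < M * N := by
  have := Nat.mul_le_mul_right N (Nat.succ_le_of_lt hi)
  rw [Nat.succ_mul] at this
  omega

theorem upd_fill {α : Type} {f : ℕ → ℕ → α} {a p : ℕ} {v : α} {g : ℕ → α}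
    (h : ∀ x < p, f a x = g x) (hv : v = g p) : ∀ x < p + 1, upd f a p v a x = g x := by
  intro x hx
  rw [upd_apply]
  split_ifs with h'
  · rw [hv, h'.2]
  · exact h x (by omega)

theorem upd_self {α : Type} (f : ℕ → ℕ → α) (a i : ℕ) (v : α) : upd f a i v a i = v := by
  simp [upd_apply]

theorem upd_ne {α : Type} (f : ℕ → ℕ → α) {a a' : ℕ} (i : ℕ) (v : α) (i' : ℕ) (h : a' ≠ a) :
    upd f a i v a' i' = f a' i' := by
  simp [upd_apply, h]

/-! ### Correctness and cost of the evaluation of the samples. -/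

section Evaluation

set_option linter.unusedSectionVars false

variable {K : Type} [Field K] [LinearOrder K]

/-- The constants of the deterministic part of the program: the input and the sampled actions. -/
structure Params (K : Type) where
  N : ℕ
  nA : ℕ
  s : ℕ
  k : ℕ
  w : ℕ → ℕ
  γ : K
  τ : K
  R : ℕ → K
  T : ℕ → K

namespace Params

variable (D : Params K)

/-- The pair of the state `i` and its action in sample `j`. -/
def row (j i : ℕ) : ℕ := i * D.nA + D.w (j * D.N + i)

open Classical in
/-- The discount factor, or `0` if sample `j` stops in state `i`. -/
def discount (j i : ℕ) : K :=
  if ¬ D.T (D.row j i * D.N + i) < 1 ∧ ¬ 0 < D.R (D.row j i) * D.R (D.row j i) then 0 else D.γ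

/-- The kernel of sample `j`. -/
def a (j i l : ℕ) : K := D.discount j i * D.T (D.row j i * D.N + l)

/-- The rewards of sample `j`. -/
def r (j i : ℕ) : K := D.R (D.row j i)

/-- The test on sample `j`. -/
def IsGood (j : ℕ) : Prop :=
  D.τ * denominatorSeq (D.a j) D.N D.N * denominatorSeq (D.a j) D.N D.N <
    numeratorSeq (D.a j) (D.r j) D.N D.s D.N * denominatorSeq (D.a j) D.N D.N

open Classical in
/-- The number of good samples among the first `j`. -/
def cnt (j : ℕ) : ℕ := ∑ i ∈ Finset.range j, if D.IsGood i then 1 else 0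

/-- The memory holds the constants. -/
structure Env (nat : ℕ → ℕ → ℕ) (num : ℕ → ℕ → K) : Prop where
  N : nat 0 0 = D.N
  nA : nat 0 1 = D.nA
  s : nat 0 2 = D.s
  w : ∀ x < D.k * D.N, nat 1 x = D.w x
  k : nat 2 0 = D.k
  γ : num 0 0 = D.γ
  τ : num 0 1 = D.τ
  R : ∀ x, num 1 x = D.R x
  T : ∀ x, num 2 x = D.T x

/-- The memory holds the constants, while sample `j` is evaluated. -/
structure Frame (j : ℕ) (nat : ℕ → ℕ → ℕ) (num : ℕ → ℕ → K) : Prop extends D.Env nat num where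
  idx : nat 7 0 = j
  lt : j < D.k
  cnt : nat 8 0 = D.cnt j

/-- The bounds of the grading hold for the constants. -/
structure Ok {sz : K → ℕ} (G : Grading sz) (fuel : ℕ) : Prop where
  N_le : D.N ≤ G.R
  k_le : D.k ≤ G.R
  lt : G.R < fuel
  s_lt : D.s < D.N
  γ : G.Q 1 D.γ
  R : ∀ x, G.Q 1 (D.R x)
  T : ∀ x, G.Q 1 (D.T x)

variable {D} {nat : ℕ → ℕ → ℕ} {num : ℕ → ℕ → K} {j : ℕ}

theorem Env.updNat (h : D.Env nat num) {a : ℕ} (ha : 3 ≤ a) (i v : ℕ) :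
    D.Env (upd nat a i v) num := by
  constructor
  · rw [upd_ne _ _ _ _ (by omega), h.N]
  · rw [upd_ne _ _ _ _ (by omega), h.nA]
  · rw [upd_ne _ _ _ _ (by omega), h.s]
  · intro x hx; rw [upd_ne _ _ _ _ (by omega), h.w x hx]
  · rw [upd_ne _ _ _ _ (by omega), h.k]
  · exact h.γ
  · exact h.τ
  · exact h.R
  · exact h.T

theorem Env.updNum (h : D.Env nat num) {a : ℕ} (ha : 3 ≤ a) (i : ℕ) (v : K) :
    D.Env nat (upd num a i v) := by
  constructor
  · exact h.N
  · exact h.nA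
  · exact h.s
  · exact h.w
  · exact h.k
  · rw [upd_ne _ _ _ _ (by omega), h.γ]
  · rw [upd_ne _ _ _ _ (by omega), h.τ]
  · intro x; rw [upd_ne _ _ _ _ (by omega), h.R]
  · intro x; rw [upd_ne _ _ _ _ (by omega), h.T]

/-- Arrays `7` and `8` of natural numbers hold the sample index and the count, so only the loop
variables from `9` on are free. -/
theorem Frame.updNat (h : D.Frame j nat num) {a : ℕ} (ha : 9 ≤ a) (i v : ℕ) :
    D.Frame j (upd nat a i v) num :=
  ⟨h.toEnv.updNat (by omega) i v, by rw [upd_ne _ _ _ _ (by omega), h.idx], h.lt,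
    by rw [upd_ne _ _ _ _ (by omega), h.cnt]⟩

theorem Frame.updNum (h : D.Frame j nat num) {a : ℕ} (ha : 3 ≤ a) (i : ℕ) (v : K) :
    D.Frame j nat (upd num a i v) :=
  ⟨h.toEnv.updNum ha i v, h.idx, h.lt, h.cnt⟩

theorem Env.val_nS (h : D.Env nat num) : Code.nS.val nat = D.N := h.N

theorem val_nv (x : ℕ) : (nv x).val nat = nat x 0 := rfl

theorem val_rv (x : ℕ) : (Code.rv x).val nat num = num x 0 := rfl

theorem Env.val_cell (h : D.Env nat num) (e f : NatExp) :
    (Code.cell e f).val nat = e.val nat * D.N + f.val nat := by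
  simp [Code.cell, NatExp.val, h.val_nS]

theorem Frame.val_row (h : D.Frame j nat num) {e : NatExp} {i : ℕ} (he : e.val nat = i)
    (hi : i < D.N) : (Code.row e).val nat = D.row j i := by
  simp only [Code.row, NatExp.val, val_nv, h.val_nS, h.idx, he, Code.nA, h.nA, row]
  rw [h.w _ (flat_lt h.lt hi)]

theorem Frame.val_gain (h : D.Frame j nat num) {e : NatExp} {i : ℕ} (he : e.val nat = i)
    (hi : i < D.N) : (Code.gain e).val nat num = D.r j i := by
  simp only [Code.gain, NumExp.val, h.val_row he hi, h.R, r]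

theorem Frame.val_trans (h : D.Frame j nat num) {e : NatExp} {i : ℕ} (he : e.val nat = i)
    (hi : i < D.N) (f : NatExp) :
    (Code.trans e f).val nat num = D.T (D.row j i * D.N + f.val nat) := by
  simp only [Code.trans, NumExp.val, NatExp.val, h.val_row he hi, h.T, h.val_nS]

variable {sz : K → ℕ} {G : Grading sz} {fuel : ℕ}

theorem Ok.discount (hD : D.Ok G fuel) (j i : ℕ) : G.Q 1 (D.discount j i) := by
  rw [Params.discount]
  split_ifs
  exacts [G.zero, hD.γ]

theorem Ok.a (hD : D.Ok G fuel) (j i l : ℕ) : G.Q 2 (D.a j i l) := by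
  exact G.mul (hD.discount j i) (hD.T _)

theorem Ok.r (hD : D.Ok G fuel) (j i : ℕ) : G.Q 1 (D.r j i) := hD.R _

/-- The entry of the kernel of sample `j` at place `x`. -/
def flatKernel (D : Params K) (j x : ℕ) : K := D.a j (x / D.N) (x % D.N)

/-- The entry at place `x` of the matrices of the recursion for sample `j`. -/
def flatMatrix (D : Params K) (j x : ℕ) : K :=
  (leVerrierSeq (D.a j) D.N (x / D.N / D.N)).2 (x / D.N % D.N) (x % D.N)

theorem flatKernel_eq {i l : ℕ} (hl : l < D.N) : D.flatKernel j (i * D.N + l) = D.a j i l := by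
  rw [flatKernel, flat_div hl, flat_mod hl]

theorem flatMatrix_eq {t i l : ℕ} (hi : i < D.N) (hl : l < D.N) :
    D.flatMatrix j ((t * D.N + i) * D.N + l) = (leVerrierSeq (D.a j) D.N t).2 i l := by
  rw [flatMatrix, flat_div hl, flat_mod hl, flat_div hi, flat_mod hi]

theorem flatMatrix_of_lt {x : ℕ} (hx : x < D.N * D.N) : D.flatMatrix j x = 0 := by
  rw [flatMatrix, Nat.div_eq_of_lt (Nat.div_lt_of_lt_mul hx)]
  rfl

/-- The zero block of array `5` is carried along because it is the initial matrix of the recursion.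
The cost is left unsimplified so that it matches the Hoare rules. -/
theorem sat_kernel (hD : D.Ok G fuel) (h : D.Frame j nat num)
    (h0 : ∀ x < D.N * D.N, num 5 x = 0) :
    G.Sat fuel Code.kernel nat num (D.N * ((2 + (D.N * (1 + 2) + 2)) + 2) + 2)
      fun nat num => D.Frame j nat num ∧ (∀ x < D.N * D.N, num 5 x = 0) ∧
        ∀ x < D.N * D.N, num 4 x = D.flatKernel j x := by
  refine Grading.sat_forLoop (hD.N_le.trans_lt hD.lt) hD.N_le
    (fun i nat num => D.Frame j nat num ∧ (∀ x < D.N * D.N, num 5 x = 0) ∧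
        ∀ x < i * D.N, num 4 x = D.flatKernel j x) ?_
    (fun _ _ _ _ _ h => h.1.val_nS) ⟨h.updNat (by omega) _ _, h0, by simp⟩
  rintro i hi nat num hni ⟨hF, hB, hA⟩
  have e10 : (nv 10).val nat = i := hni
  refine Grading.sat_seq (mid := fun nat num => nat 10 0 = i ∧ num 7 0 = D.discount j i ∧
    D.Frame j nat num ∧ (∀ x < D.N * D.N, num 5 x = 0) ∧
      ∀ x < i * D.N, num 4 x = D.flatKernel j x) (m := 2) (Grading.sat_ite ?_ ?_) ?_
  · intro hb
    have hd : D.discount j i = 0 := by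
      rw [Params.discount, if_pos]
      simpa [Test.Holds, hF.val_trans e10 hi, hF.val_gain e10 hi, val_nv, hni, NumExp.val,
        NatExp.val, Params.r] using hb
    refine Grading.sat_setNum ?_ ?_
    · simpa [NumExp.val, NatExp.val] using G.zero
    · exact ⟨hni, by simp [NumExp.val, NatExp.val, hd, upd_apply], hF.updNum (by omega) _ _,
        fun x hx => by rw [upd_ne _ _ _ _ (by omega), hB x hx],
        fun x hx => by rw [upd_ne _ _ _ _ (by omega), hA x hx]⟩
  · intro hb
    have hd : D.discount j i = D.γ := by
      rw [Params.discount, if_neg]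
      simpa [Test.Holds, hF.val_trans e10 hi, hF.val_gain e10 hi, val_nv, hni, NumExp.val,
        NatExp.val, Params.r] using hb
    refine Grading.sat_setNum ?_ ?_
    · rw [val_rv, hF.γ]; exact G.mono G.one_le_top hD.γ
    · exact ⟨hni, by simp [val_rv, NatExp.val, hd, upd_apply, hF.γ], hF.updNum (by omega) _ _,
        fun x hx => by rw [upd_ne _ _ _ _ (by omega), hB x hx],
        fun x hx => by rw [upd_ne _ _ _ _ (by omega), hA x hx]⟩
  · rintro nat num ⟨hni, hd, hF, hB, hA⟩
    refine (Grading.sat_forLoop (m := 1) (hD.N_le.trans_lt hD.lt) hD.N_le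
      (fun l nat num => nat 10 0 = i ∧ num 7 0 = D.discount j i ∧
        D.Frame j nat num ∧ (∀ x < D.N * D.N, num 5 x = 0) ∧
        ∀ x < i * D.N + l, num 4 x = D.flatKernel j x) ?_
      (fun _ _ _ _ _ h => h.2.2.1.val_nS)
      ⟨by rw [upd_ne _ _ _ _ (by omega), hni], hd, hF.updNat (by omega) _ _, hB, hA⟩).mono le_rfl ?_
    · rintro l hl nat num hnl ⟨hni, hd, hF, hB, hA⟩
      have e10 : (nv 10).val nat = i := hni
      have ev : (NumExp.mul (Code.rv 7) (Code.trans (nv 10) (nv 11))).val nat num = D.a j i l := by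
        simp only [NumExp.val, val_rv, hd, hF.val_trans e10 hi, val_nv, hnl, Params.a]
      have ec : (Code.cell (nv 10) (nv 11)).val nat = i * D.N + l := by
        rw [hF.val_cell, val_nv, val_nv, hni, hnl]
      refine Grading.sat_setNum ?_ ?_
      · rw [ev]; exact G.mono (by have := G.stepLevel_le_top hD.N_le; omega) (hD.a j i l)
      · rw [ev, ec]
        exact ⟨hnl, by rw [upd_ne _ _ _ _ (by omega), hni], by rw [upd_ne _ _ _ _ (by omega), hd],
          (hF.updNum (by omega) _ _).updNat (by omega) _ _,
          fun x hx => by rw [upd_ne _ _ _ _ (by omega), hB x hx],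
          upd_fill hA (flatKernel_eq hl).symm⟩
    · rintro nat num ⟨hni, hd, hF, hB, hA⟩
      refine ⟨hni, hF.updNat (by omega) _ _, hB, ?_⟩
      rwa [Nat.succ_mul]

/-- The memory during step `t` of the recursion for sample `j`, when the matrices have been
computed up to place `p`. -/
structure Step (D : Params K) (j t p : ℕ) (nat : ℕ → ℕ → ℕ) (num : ℕ → ℕ → K) : Prop
    extends D.Frame j nat num where
  time : nat 9 0 = t
  t_lt : t < D.N
  A : ∀ x < D.N * D.N, num 4 x = D.flatKernel j x
  B : ∀ x < p, num 5 x = D.flatMatrix j x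
  c : num 6 t = (leVerrierSeq (D.a j) D.N t).1
  X : num 9 0 = denominatorSeq (D.a j) D.N t

theorem Step.updNat {t p : ℕ} (h : D.Step j t p nat num) {a : ℕ} (ha : 10 ≤ a) (i v : ℕ) :
    D.Step j t p (upd nat a i v) num :=
  ⟨h.toFrame.updNat (by omega) i v, by rw [upd_ne _ _ _ _ (by omega), h.time], h.t_lt, h.A, h.B, h.c,
    h.X⟩

theorem Step.updNum {t p : ℕ} (h : D.Step j t p nat num) {a : ℕ} (ha : a = 7 ∨ a = 8) (i : ℕ)
    (v : K) : D.Step j t p nat (upd num a i v) :=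
  ⟨h.toFrame.updNum (by omega) i v, h.time, h.t_lt,
    fun x hx => by rw [upd_ne _ _ _ _ (by omega), h.A x hx],
    fun x hx => by rw [upd_ne _ _ _ _ (by omega), h.B x hx],
    by rw [upd_ne _ _ _ _ (by omega), h.c], by rw [upd_ne _ _ _ _ (by omega), h.X]⟩

theorem Step.get_kernel {t p : ℕ} (h : D.Step j t p nat num) {i l : ℕ} (hi : i < D.N)
    (hl : l < D.N) : num 4 (i * D.N + l) = D.a j i l := by
  rw [h.A _ (flat_lt hi hl), flatKernel_eq hl]

theorem Step.get_matrix {t p : ℕ} (h : D.Step j t p nat num) {u i l : ℕ}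
    (hp : u * D.N * D.N + D.N * D.N ≤ p) (hi : i < D.N) (hl : l < D.N) :
    num 5 ((u * D.N + i) * D.N + l) = (leVerrierSeq (D.a j) D.N u).2 i l := by
  rw [h.B, flatMatrix_eq hi hl]
  have := flat_lt (M := D.N) hi hl
  rw [add_mul, add_assoc]
  omega

/-- The added term is the entry at `s` of the `t`-th summand in `sum_leVerrier_snd`, applied to the
rewards. Only row `s` of the adjugate is ever needed. -/
theorem sat_numerator (hD : D.Ok G fuel) {t : ℕ}
    (h : D.Step j t ((t + 1) * D.N * D.N) nat num)
    (hY : num 8 0 = numeratorSeq (D.a j) (D.r j) D.N D.s t) :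
    G.Sat fuel Code.numerator nat num (1 + (D.N * (1 + 2) + 2))
      fun nat num => D.Step j t ((t + 1) * D.N * D.N) nat num ∧
        num 8 0 = numeratorSeq (D.a j) (D.r j) D.N D.s (t + 1) := by
  have es : ∀ {nat num}, D.Step j t ((t + 1) * D.N * D.N) nat num →
      Code.start.val nat = D.s := fun h => h.s
  have ev : (NumExp.add (Code.rv 8) (.mul (.get 6 (nv 9)) (Code.gain Code.start))).val nat num =
      numeratorSeq (D.a j) (D.r j) D.N D.s t + ((leVerrierSeq (D.a j) D.N t).1 * D.r j D.s +
      ∑ l ∈ Finset.range 0, (leVerrierSeq (D.a j) D.N t).2 D.s l * D.r j l) := by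
    simp only [NumExp.val, val_rv, hY, val_nv, h.time, h.c, h.val_gain (es h) hD.s_lt,
      Finset.range_zero, Finset.sum_empty, add_zero]
  refine Grading.sat_seq (mid := fun nat num => D.Step j t ((t + 1) * D.N * D.N) nat num ∧
    num 8 0 = numeratorSeq (D.a j) (D.r j) D.N D.s t +
      ((leVerrierSeq (D.a j) D.N t).1 * D.r j D.s +
      ∑ l ∈ Finset.range 0, (leVerrierSeq (D.a j) D.N t).2 D.s l * D.r j l))
    (Grading.sat_setNum ?_ ?_) ?_
  · rw [ev]; exact G.numerator_mem hD.N_le (hD.a j) (hD.r j) h.t_lt (Nat.zero_le _) _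
  · rw [ev]; exact ⟨h.updNum (by omega) _ _, upd_self _ _ _ _⟩
  rintro nat num ⟨h, hY⟩
  refine (Grading.sat_forLoop (m := 1) (hD.N_le.trans_lt hD.lt) hD.N_le
    (fun H nat num => D.Step j t ((t + 1) * D.N * D.N) nat num ∧
      num 8 0 = numeratorSeq (D.a j) (D.r j) D.N D.s t +
      ((leVerrierSeq (D.a j) D.N t).1 * D.r j D.s +
      ∑ l ∈ Finset.range H, (leVerrierSeq (D.a j) D.N t).2 D.s l * D.r j l)) ?_
    (fun _ _ _ _ _ h => h.1.val_nS) ⟨h.updNat (by omega) _ _, hY⟩).mono le_rfl ?_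
  · rintro l hl nat num hnl ⟨h, hY⟩
    have e11 : (nv 11).val nat = l := hnl
    have ev : (NumExp.add (Code.rv 8) (.mul (.get 5 (Code.cell (Code.cell (nv 9) Code.start)
        (nv 11))) (Code.gain (nv 11)))).val nat num =
        numeratorSeq (D.a j) (D.r j) D.N D.s t + ((leVerrierSeq (D.a j) D.N t).1 * D.r j D.s +
        ∑ l ∈ Finset.range (l + 1), (leVerrierSeq (D.a j) D.N t).2 D.s l * D.r j l) := by
      simp only [NumExp.val, val_rv, hY, h.val_gain e11 hl, h.val_cell, es h, val_nv, h.time, hnl]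
      rw [h.get_matrix (by rw [add_mul, add_mul, one_mul]) hD.s_lt hl, Finset.sum_range_succ]
      ring
    refine Grading.sat_setNum ?_ ?_
    · rw [ev]; exact G.numerator_mem hD.N_le (hD.a j) (hD.r j) h.t_lt (by omega) _
    · rw [ev]
      exact ⟨hnl, (h.updNum (by omega) _ _).updNat (by omega) _ _, upd_self _ _ _ _⟩
  · rintro nat num ⟨h, hY⟩
    refine ⟨h, ?_⟩
    rw [hY, numeratorSeq, numeratorSeq, Finset.sum_range_succ]

/-- Each matrix has its own block in array `5`: the new entry goes to block `t + 1`, while block `t`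
stays intact for reading. -/
theorem sat_entry (hD : D.Ok G fuel) {t i l : ℕ} (hi : i < D.N) (hl : l < D.N)
    (hni : nat 10 0 = i) (hnl : nat 11 0 = l)
    (h : D.Step j t (((t + 1) * D.N + i) * D.N + l) nat num) {y : K} (hY : num 8 0 = y) :
    G.Sat fuel Code.entry nat num (1 + ((D.N * (1 + 2) + 2) + 1))
      fun nat num => nat 10 0 = i ∧ nat 11 0 = l ∧
        D.Step j t (((t + 1) * D.N + i) * D.N + l + 1) nat num ∧ num 8 0 = y := by
  -- Block `t` ends before the current place, so all its entries are available.
  have hp : t * D.N * D.N + D.N * D.N ≤ ((t + 1) * D.N + i) * D.N + l := by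
    have : ((t + 1) * D.N + i) * D.N + l = t * D.N * D.N + D.N * D.N + i * D.N + l := by ring
    omega
  set p := ((t + 1) * D.N + i) * D.N + l with hpdef
  set F : ℕ → K := fun H => (leVerrierSeq (D.a j) D.N t).1 * D.a j i l +
    ∑ h ∈ Finset.range H, D.a j i h * (leVerrierSeq (D.a j) D.N t).2 h l with hF
  have ev : (NumExp.mul (.get 6 (nv 9)) (.get 4 (Code.cell (nv 10) (nv 11)))).val nat num = F 0 := by
    simp only [NumExp.val, val_nv, h.val_cell, hni, hnl, h.time, h.c, h.get_kernel hi hl, hF,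
      Finset.range_zero, Finset.sum_empty, add_zero]
  refine Grading.sat_seq (mid := fun nat num => nat 10 0 = i ∧ nat 11 0 = l ∧
    D.Step j t p nat num ∧ num 8 0 = y ∧ num 7 0 = F 0) (Grading.sat_setNum ?_ ?_) ?_
  · rw [ev]; exact G.entry_mem hD.N_le (hD.a j) h.t_lt (Nat.zero_le _) _ _
  · rw [ev]
    exact ⟨hni, hnl, h.updNum (by omega) _ _, by rw [upd_ne _ _ _ _ (by omega), hY],
      upd_self _ _ _ _⟩
  rintro nat num ⟨hni, hnl, h, hY, hv⟩
  refine Grading.sat_seq (mid := fun nat num => nat 10 0 = i ∧ nat 11 0 = l ∧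
    D.Step j t p nat num ∧ num 8 0 = y ∧ num 7 0 = F D.N) (Grading.sat_forLoop (m := 1)
    (hD.N_le.trans_lt hD.lt) hD.N_le
    (fun H nat num => nat 10 0 = i ∧ nat 11 0 = l ∧
      D.Step j t p nat num ∧ num 8 0 = y ∧ num 7 0 = F H) ?_ (fun _ _ _ _ _ h => h.2.2.1.val_nS)
    ⟨by rw [upd_ne _ _ _ _ (by omega), hni], by rw [upd_ne _ _ _ _ (by omega), hnl],
      h.updNat (by omega) _ _, hY, hv⟩) ?_
  · rintro H hH nat num hnh ⟨hni, hnl, h, hY, hv⟩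
    have ev : (NumExp.add (Code.rv 7) (.mul (.get 4 (Code.cell (nv 10) (nv 12)))
        (.get 5 (Code.cell (Code.cell (nv 9) (nv 12)) (nv 11))))).val nat num = F (H + 1) := by
      simp only [NumExp.val, val_rv, hv, h.val_cell, val_nv, hni, hnl, hnh, h.time,
        h.get_kernel hi hH, h.get_matrix hp hH hl, hF, Finset.sum_range_succ]
      ring
    refine Grading.sat_setNum ?_ ?_
    · rw [ev]; exact G.entry_mem hD.N_le (hD.a j) h.t_lt (by omega) _ _
    · rw [ev]
      exact ⟨hnh, by rw [upd_ne _ _ _ _ (by omega), hni], by rw [upd_ne _ _ _ _ (by omega), hnl],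
        (h.updNum (by omega) _ _).updNat (by omega) _ _, by rw [upd_ne _ _ _ _ (by omega), hY],
        upd_self _ _ _ _⟩
  · rintro nat num ⟨hni, hnl, h, hY, hv⟩
    have ec : (Code.cell (Code.cell (.add (nv 9) (.lit 1)) (nv 10)) (nv 11)).val nat = p := by
      simp only [h.val_cell, NatExp.val, val_nv, hni, hnl, h.time, hpdef]
    refine Grading.sat_setNum ?_ ?_
    · rw [val_rv, hv]; exact G.entry_mem hD.N_le (hD.a j) h.t_lt le_rfl _ _
    · rw [val_rv, hv, ec]
      refine ⟨hni, hnl, ⟨h.toFrame.updNum (by omega) _ _, h.time, h.t_lt,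
        fun x hx => by rw [upd_ne _ _ _ _ (by omega), h.A x hx],
        upd_fill h.B ?_, by rw [upd_ne _ _ _ _ (by omega), h.c],
        by rw [upd_ne _ _ _ _ (by omega), h.X]⟩, by rw [upd_ne _ _ _ _ (by omega), hY]⟩
      rw [hpdef, flatMatrix_eq hi hl]
      rfl

theorem sat_matrix (hD : D.Ok G fuel) {t : ℕ}
    (h : D.Step j t ((t + 1) * D.N * D.N) nat num) {y : K} (hY : num 8 0 = y) :
    G.Sat fuel Code.matrix nat num
      (D.N * ((D.N * ((1 + ((D.N * (1 + 2) + 2) + 1)) + 2) + 2) + 2) + 2)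
      fun nat num => D.Step j t ((t + 2) * D.N * D.N) nat num ∧ num 8 0 = y := by
  refine (Grading.sat_forLoop (hD.N_le.trans_lt hD.lt) hD.N_le
    (fun i nat num => D.Step j t (((t + 1) * D.N + i) * D.N) nat num ∧ num 8 0 = y) ?_
    (fun _ _ _ _ _ h => h.1.val_nS) ⟨h.updNat (by omega) _ _, hY⟩).mono le_rfl ?_
  · rintro i hi nat num hni ⟨h, hY⟩
    refine (Grading.sat_forLoop (hD.N_le.trans_lt hD.lt) hD.N_le
      (fun l nat num => nat 10 0 = i ∧
        D.Step j t (((t + 1) * D.N + i) * D.N + l) nat num ∧ num 8 0 = y) ?_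
      (fun _ _ _ _ _ h => h.2.1.val_nS)
      ⟨by rw [upd_ne _ _ _ _ (by omega), hni], h.updNat (by omega) _ _, hY⟩).mono le_rfl ?_
    · rintro l hl nat num hnl ⟨hni, h, hY⟩
      refine (sat_entry hD hi hl hni hnl h hY).mono le_rfl ?_
      rintro nat num ⟨hni, hnl, h, hY⟩
      exact ⟨hnl, by rw [upd_ne _ _ _ _ (by omega), hni], h.updNat (by omega) _ _, hY⟩
    · rintro nat num ⟨hni, h, hY⟩
      refine ⟨hni, ?_, hY⟩
      have e : ((t + 1) * D.N + i) * D.N + D.N = ((t + 1) * D.N + (i + 1)) * D.N := by ring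
      rw [e] at h
      exact h.updNat (by omega) _ _
  · rintro nat num ⟨h, hY⟩
    have e : ((t + 1) * D.N + D.N) * D.N = (t + 2) * D.N * D.N := by ring
    rw [e] at h
    exact ⟨h, hY⟩

/-- The result is not phrased with `Step` at `t + 1`: the loop variable has not advanced yet, and `t
+ 1` may equal `N`. -/
theorem sat_coefficient (hD : D.Ok G fuel) {t : ℕ}
    (h : D.Step j t ((t + 2) * D.N * D.N) nat num) {y : K} (hY : num 8 0 = y) :
    G.Sat fuel Code.coefficient nat num (1 + ((D.N * (1 + 2) + 2) + (1 + 1)))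
      fun nat num => D.Frame j nat num ∧ nat 9 0 = t ∧
        (∀ x < D.N * D.N, num 4 x = D.flatKernel j x) ∧
        (∀ x < (t + 2) * D.N * D.N, num 5 x = D.flatMatrix j x) ∧
        num 6 (t + 1) = (leVerrierSeq (D.a j) D.N (t + 1)).1 ∧
        num 9 0 = denominatorSeq (D.a j) D.N (t + 1) ∧ num 8 0 = y := by
  have ht := h.t_lt
  set F : ℕ → K := fun H => ∑ i ∈ Finset.range H, (leVerrierSeq (D.a j) D.N (t + 1)).2 i i with hF
  have ev : (NumExp.ofNat (.lit 0)).val nat num = F 0 := by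
    simp [NumExp.val, NatExp.val, hF]
  refine Grading.sat_seq (mid := fun nat num => D.Step j t ((t + 2) * D.N * D.N) nat num ∧
    num 8 0 = y ∧ num 7 0 = F 0) (Grading.sat_setNum ?_ ?_) ?_
  · rw [ev]; exact G.trace_mem hD.N_le (hD.a j) ht (Nat.zero_le _)
  · rw [ev]
    exact ⟨h.updNum (by omega) _ _, by rw [upd_ne _ _ _ _ (by omega), hY], upd_self _ _ _ _⟩
  rintro nat num ⟨h, hY, hv⟩
  refine Grading.sat_seq (mid := fun nat num => D.Step j t ((t + 2) * D.N * D.N) nat num ∧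
    num 8 0 = y ∧ num 7 0 = F D.N) (Grading.sat_forLoop (m := 1)
    (hD.N_le.trans_lt hD.lt) hD.N_le
    (fun H nat num => D.Step j t ((t + 2) * D.N * D.N) nat num ∧
    num 8 0 = y ∧ num 7 0 = F H) ?_ (fun _ _ _ _ _ h => h.1.val_nS)
    ⟨h.updNat (by omega) _ _, hY, hv⟩) ?_
  · rintro i hi nat num hni ⟨h, hY, hv⟩
    have ev : (NumExp.add (Code.rv 7) (.get 5 (Code.cell (Code.cell (.add (nv 9) (.lit 1)) (nv 10))
        (nv 10)))).val nat num = F (i + 1) := by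
      have hp : (t + 1) * D.N * D.N + D.N * D.N ≤ (t + 2) * D.N * D.N := le_of_eq (by ring)
      simp only [NumExp.val, val_rv, hv, h.val_cell, val_nv, hni, h.time, NatExp.val,
        h.get_matrix hp hi hi, hF, Finset.sum_range_succ]
    refine Grading.sat_setNum ?_ ?_
    · rw [ev]; exact G.trace_mem hD.N_le (hD.a j) ht (by omega)
    · rw [ev]
      exact ⟨hni, (h.updNum (by omega) _ _).updNat (by omega) _ _,
        by rw [upd_ne _ _ _ _ (by omega), hY], upd_self _ _ _ _⟩
  rintro nat num ⟨h, hY, hv⟩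
  have e1 : (NatExp.add (nv 9) (.lit 1)).val nat = t + 1 := by
    simp only [NatExp.val, val_nv, h.time]
  have ev : (NumExp.div (.sub (.ofNat (.lit 0)) (Code.rv 7))
      (.ofNat (.add (nv 9) (.lit 1)))).val nat num = (leVerrierSeq (D.a j) D.N (t + 1)).1 := by
    rw [NumExp.val, NumExp.val, NumExp.val, NumExp.val, e1, val_rv, hv, NatExp.val, Nat.cast_zero]
    rfl
  have hl := G.stepLevel_le_top hD.N_le
  refine Grading.sat_seq (mid := fun nat num => D.Frame j nat num ∧ nat 9 0 = t ∧
        (∀ x < D.N * D.N, num 4 x = D.flatKernel j x) ∧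
        (∀ x < (t + 2) * D.N * D.N, num 5 x = D.flatMatrix j x) ∧
        num 6 (t + 1) = (leVerrierSeq (D.a j) D.N (t + 1)).1 ∧
        num 9 0 = denominatorSeq (D.a j) D.N t ∧ num 8 0 = y) (Grading.sat_setNum ?_ ?_) ?_
  · rw [ev]
    have := stepLevel_mono (N := D.N) (Nat.succ_le_of_lt ht)
    refine G.mono (i := stepLevel D.N (t + 1)) ?_
      (G.leVerrierSeq_mem hD.N_le (hD.a j) (Nat.succ_le_of_lt ht)).1
    simp only [Nat.succ_eq_add_one] at this
    omega
  · rw [ev, e1]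
    exact ⟨h.toFrame.updNum (by omega) _ _, h.time,
      fun x hx => by rw [upd_ne _ _ _ _ (by omega), h.A x hx],
      fun x hx => by rw [upd_ne _ _ _ _ (by omega), h.B x hx],
      upd_self _ _ _ _, by rw [upd_ne _ _ _ _ (by omega), h.X],
      by rw [upd_ne _ _ _ _ (by omega), hY]⟩
  rintro nat num ⟨hFr, hnt, hA, hB, hc, hX, hY⟩
  have ev : (NumExp.add (Code.rv 9) (.get 6 (.add (nv 9) (.lit 1)))).val nat num =
      denominatorSeq (D.a j) D.N (t + 1) := by
    simp only [NumExp.val, val_rv, hX, NatExp.val, val_nv, hnt, hc]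
    rw [denominatorSeq, denominatorSeq, Finset.sum_range_succ _ (t + 1)]
  refine Grading.sat_setNum ?_ ?_
  · rw [ev]; exact G.denominator_mem hD.N_le (hD.a j) (Nat.succ_le_of_lt ht)
  · rw [ev]
    exact ⟨hFr.updNum (by omega) _ _, hnt,
      fun x hx => by rw [upd_ne _ _ _ _ (by omega), hA x hx],
      fun x hx => by rw [upd_ne _ _ _ _ (by omega), hB x hx],
      by rw [upd_ne _ _ _ _ (by omega), hc], upd_self _ _ _ _,
      by rw [upd_ne _ _ _ _ (by omega), hY]⟩

/-- The number of commands that the evaluation of a sample takes at most. -/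
def evaluateCost (N : ℕ) : ℕ :=
  (N * ((2 + (N * (1 + 2) + 2)) + 2) + 2) + (1 + (1 + (1 +
    (N * (((1 + (N * (1 + 2) + 2)) +
      ((N * ((N * ((1 + ((N * (1 + 2) + 2) + 1)) + 2) + 2) + 2) + 2) +
      (1 + ((N * (1 + 2) + 2) + (1 + 1))))) + 2) + 2))))

theorem sat_evaluate (hD : D.Ok G fuel) (h : D.Frame j nat num)
    (h0 : ∀ x < D.N * D.N, num 5 x = 0) :
    G.Sat fuel Code.evaluate nat num (evaluateCost D.N)
      fun nat num => D.Frame j nat num ∧ (∀ x < D.N * D.N, num 5 x = 0) ∧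
        num 8 0 = numeratorSeq (D.a j) (D.r j) D.N D.s D.N ∧
        num 9 0 = denominatorSeq (D.a j) D.N D.N := by
  refine Grading.sat_seq (sat_kernel hD h h0) ?_
  rintro nat num ⟨h, h0, hA⟩
  refine Grading.sat_seq (mid := fun nat num => D.Frame j nat num ∧
    (∀ x < D.N * D.N, num 5 x = 0) ∧ (∀ x < D.N * D.N, num 4 x = D.flatKernel j x) ∧
    num 6 0 = 1) (Grading.sat_setNum ?_ ?_) ?_
  · simpa [NumExp.val, NatExp.val] using G.one
  · exact ⟨h.updNum (by omega) _ _, fun x hx => by rw [upd_ne _ _ _ _ (by omega), h0 x hx],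
      fun x hx => by rw [upd_ne _ _ _ _ (by omega), hA x hx],
      by simp [NumExp.val, NatExp.val, upd_apply]⟩
  rintro nat num ⟨h, h0, hA, hc⟩
  refine Grading.sat_seq (mid := fun nat num => D.Frame j nat num ∧
    (∀ x < D.N * D.N, num 5 x = 0) ∧ (∀ x < D.N * D.N, num 4 x = D.flatKernel j x) ∧
    num 6 0 = 1 ∧ num 8 0 = 0) (Grading.sat_setNum ?_ ?_) ?_
  · simpa [NumExp.val, NatExp.val] using G.zero
  · exact ⟨h.updNum (by omega) _ _, fun x hx => by rw [upd_ne _ _ _ _ (by omega), h0 x hx],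
      fun x hx => by rw [upd_ne _ _ _ _ (by omega), hA x hx],
      by rw [upd_ne _ _ _ _ (by omega), hc], by simp [NumExp.val, NatExp.val, upd_apply]⟩
  rintro nat num ⟨h, h0, hA, hc, hY⟩
  refine Grading.sat_seq (mid := fun nat num => D.Frame j nat num ∧
    (∀ x < D.N * D.N, num 5 x = 0) ∧ (∀ x < D.N * D.N, num 4 x = D.flatKernel j x) ∧
    num 6 0 = 1 ∧ num 8 0 = 0 ∧ num 9 0 = 1) (Grading.sat_setNum ?_ ?_) ?_
  · simpa [NumExp.val, NatExp.val] using G.one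
  · exact ⟨h.updNum (by omega) _ _, fun x hx => by rw [upd_ne _ _ _ _ (by omega), h0 x hx],
      fun x hx => by rw [upd_ne _ _ _ _ (by omega), hA x hx],
      by rw [upd_ne _ _ _ _ (by omega), hc], by rw [upd_ne _ _ _ _ (by omega), hY],
      by simp [NumExp.val, NatExp.val, upd_apply]⟩
  rintro nat num ⟨h, h0, hA, hc, hY, hX⟩
  refine (Grading.sat_forLoop (hD.N_le.trans_lt hD.lt) hD.N_le
    (fun t nat num => D.Frame j nat num ∧
      (∀ x < D.N * D.N, num 4 x = D.flatKernel j x) ∧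
      (∀ x < (t + 1) * D.N * D.N, num 5 x = D.flatMatrix j x) ∧
      num 6 t = (leVerrierSeq (D.a j) D.N t).1 ∧
      num 9 0 = denominatorSeq (D.a j) D.N t ∧
      num 8 0 = numeratorSeq (D.a j) (D.r j) D.N D.s t) ?_ (fun _ _ _ _ _ h => h.1.val_nS)
    ⟨h.updNat (by omega) _ _, hA, ?_, hc, ?_, ?_⟩).mono le_rfl ?_
  · rintro t ht nat num hnt ⟨h, hA, hB, hc, hX, hY⟩
    refine Grading.sat_seq (sat_numerator hD ⟨h, hnt, ht, hA, hB, hc, hX⟩ hY) ?_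
    rintro nat num ⟨h, hY⟩
    refine Grading.sat_seq (sat_matrix hD h hY) ?_
    rintro nat num ⟨h, hY⟩
    refine (sat_coefficient hD h hY).mono le_rfl ?_
    rintro nat num ⟨h, hnt, hA, hB, hc, hX, hY⟩
    exact ⟨hnt, h.updNat (by omega) _ _, hA, hB, hc, hX, hY⟩
  -- Initially only block `0` is claimed, which is zero. Other blocks may hold leftovers of earlier
  -- samples, but are overwritten before they are read.
  · intro x hx
    rw [zero_add, one_mul] at hx
    rw [h0 x hx, flatMatrix_of_lt hx]
  · rw [hX]; simp [denominatorSeq, leVerrierSeq]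
  · rw [hY]; simp [numeratorSeq]
  -- Block `0` has kept the zero matrix, as the next sample requires.
  · rintro nat num ⟨h, hA, hB, hc, hX, hY⟩
    refine ⟨h, fun x hx => ?_, hY, hX⟩
    rw [hB, flatMatrix_of_lt hx]
    rw [add_mul, add_mul, one_mul]
    omega

theorem cnt_le (D : Params K) (j : ℕ) : D.cnt j ≤ j := by
  rw [cnt]
  refine (Finset.sum_le_card_nsmul _ _ 1 fun i _ => ?_).trans (by simp)
  split_ifs <;> norm_num

theorem sat_sample (hD : D.Ok G fuel) (h : D.Frame j nat num)
    (h0 : ∀ x < D.N * D.N, num 5 x = 0) :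
    G.Sat fuel Code.sample nat num (evaluateCost D.N + 2)
      fun nat num => D.Env nat num ∧ nat 7 0 = j ∧ nat 8 0 = D.cnt (j + 1) ∧
        (∀ x < D.N * D.N, num 5 x = 0) := by
  refine Grading.sat_seq (sat_evaluate hD h h0) ?_
  rintro nat num ⟨h, h0, hY, hX⟩
  have hb : (Test.ltNum (.mul (.mul (.get 0 (.lit 1)) (Code.rv 9)) (Code.rv 9))
      (.mul (Code.rv 8) (Code.rv 9))).Holds nat num ↔ D.IsGood j := by
    simp only [Test.Holds, NumExp.val, NatExp.val, val_rv, hX, hY, h.τ, IsGood]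
  refine Grading.sat_ite (m := 1) (fun hg => ?_) (fun hg => ?_)
  · have e : D.cnt (j + 1) = D.cnt j + 1 := by
      rw [cnt, cnt, Finset.sum_range_succ, if_pos (hb.1 hg)]
    have ev : (NatExp.add (nv 8) (.lit 1)).val nat = D.cnt (j + 1) := by
      simp only [NatExp.val, val_nv, h.cnt, e]
    refine Grading.sat_setNat ?_ ?_
    · rw [ev]
      have := D.cnt_le (j + 1)
      have := h.lt
      have := hD.k_le
      omega
    · rw [ev]
      exact ⟨h.toEnv.updNat (by omega) _ _, by rw [upd_ne _ _ _ _ (by omega), h.idx],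
        upd_self _ _ _ _, h0⟩
  · have e : D.cnt (j + 1) = D.cnt j := by
      rw [cnt, cnt, Finset.sum_range_succ, if_neg (mt hb.2 hg), add_zero]
    exact Grading.sat_skip ⟨h.toEnv, h.idx, by rw [h.cnt, e], h0⟩

theorem sat_count (hD : D.Ok G fuel) (hk : 0 < D.k) (h : D.Env nat num)
    (h0 : ∀ x < D.N * D.N, num 5 x = 0) :
    G.Sat fuel Code.count nat num
      (1 + ((D.k * ((evaluateCost D.N + 2) + 2) + 2) + 1))
      fun _ num => num 3 0 = (D.cnt D.k : K) / (D.k : K) := by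
  refine Grading.sat_seq (mid := fun nat num => D.Env nat num ∧ nat 8 0 = 0 ∧
    ∀ x < D.N * D.N, num 5 x = 0) (Grading.sat_setNat (Nat.zero_le _)
      ⟨h.updNat (by omega) _ _, by simp [NatExp.val, upd_apply], h0⟩) ?_
  rintro nat num ⟨h, hc, h0⟩
  refine Grading.sat_seq (Grading.sat_forLoop (hD.k_le.trans_lt hD.lt) hD.k_le
    (fun j nat num => D.Env nat num ∧ nat 8 0 = D.cnt j ∧ ∀ x < D.N * D.N, num 5 x = 0) ?_
    (fun _ _ _ _ _ h => by rw [val_nv, h.1.k])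
    ⟨h.updNat (by omega) _ _, by rw [upd_ne _ _ _ _ (by omega), hc]; simp [cnt], h0⟩) ?_
  · rintro j hj nat num hnj ⟨h, hc, h0⟩
    refine (sat_sample hD ⟨h, hnj, hj, hc⟩ h0).mono le_rfl ?_
    rintro nat num ⟨h, hnj, hc, h0⟩
    exact ⟨hnj, h.updNat (by omega) _ _, by rw [upd_ne _ _ _ _ (by omega), hc], h0⟩
  · rintro nat num ⟨h, hc, h0⟩
    have ev : (NumExp.div (.ofNat (nv 8)) (.ofNat (nv 2))).val nat num =
        (D.cnt D.k : K) / (D.k : K) := by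
      simp only [NumExp.val, val_nv, hc, h.k]
    refine Grading.sat_setNum ?_ ?_
    · rw [ev]
      refine G.mono (i := 1 + 1) ?_ (G.div hk hD.k_le (G.natCast ?_))
      · have := G.stepLevel_le_top hD.N_le; omega
      · rw [pow_one]; exact (D.cnt_le _).trans hD.k_le
    · rw [ev]
      exact upd_self _ _ _ _

end Params

end Evaluation

/-! ### The law of the drawn actions, and the number of samples. -/

section Sampling

/-- The bridge from Hoare triples, which hold on supports, to equalities of laws. -/
theorem PMF.bind_congr_support {α β : Type*} (p : PMF α) {f g : α → PMF β}
    (h : ∀ x ∈ p.support, f x = g x) : p.bind f = p.bind g := by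
  ext b
  rw [PMF.bind_apply, PMF.bind_apply]
  refine tsum_congr fun x => ?_
  by_cases hx : p x = 0
  · simp [hx]
  · rw [h x ((PMF.mem_support_iff p x).2 hx)]

theorem PMF.map_eq_pure {α β : Type*} (p : PMF α) {f : α → β} {b : β}
    (h : ∀ x ∈ p.support, f x = b) : p.map f = PMF.pure b := by
  rw [PMF.map, PMF.bind_congr_support p (g := fun _ => PMF.pure b)
    (fun x hx => by rw [Function.comp_apply, h x hx]), PMF.bind_const]

/-- A uniform tuple is a uniform head followed by an independent uniform tail: both laws give each
tuple mass `|α| ^ (-(r + 1))`. -/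
theorem PMF.uniformOfFintype_fin_succ {α : Type*} [Fintype α] [Nonempty α] (r : ℕ) :
    PMF.uniformOfFintype (Fin (r + 1) → α) =
      (PMF.uniformOfFintype α).bind fun v =>
        (PMF.uniformOfFintype (Fin r → α)).map fun w => (Fin.cons v w : Fin (r + 1) → α) := by
  classical
  ext u
  rw [PMF.bind_apply, tsum_eq_single (u 0), PMF.map_apply, tsum_eq_single (Fin.tail u)]
  · rw [if_pos (Fin.cons_self_tail u).symm]
    simp only [PMF.uniformOfFintype_apply, Fintype.card_fun, Fintype.card_fin]
    push_cast
    rw [pow_succ', ENNReal.mul_inv (Or.inr (ENNReal.pow_ne_top (ENNReal.natCast_ne_top _)))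
      (Or.inl (ENNReal.natCast_ne_top _))]
  · intro w hw
    rw [if_neg]
    intro h
    exact hw (by rw [h, Fin.tail_cons])
  · intro v hv
    rw [PMF.map_apply, ENNReal.tsum_eq_zero.2, mul_zero]
    intro w
    rw [if_neg]
    intro h
    exact hv (by rw [h, Fin.cons_zero])

/-- The machine draws from `Fin (m + 1)` with `m` read from memory, which equals `Fin nA` only up to
a proved equation; reading the outcomes in `ℕ` makes the two comparable. -/
theorem PMF.map_uniformOfFintype_fin {β : Type*} {m n : ℕ} [NeZero n] (h : m + 1 = n)
    (g : ℕ → β) :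
    (PMF.uniformOfFintype (Fin (m + 1))).map (fun v : Fin (m + 1) => g (v : ℕ)) =
      (PMF.uniformOfFintype (Fin n)).map (fun v : Fin n => g (v : ℕ)) := by
  subst h
  rfl

theorem PMF.map_uniformOfFintype_equiv {α β : Type*} [Fintype α] [Nonempty α] [Fintype β]
    [Nonempty β] (e : α ≃ β) :
    (PMF.uniformOfFintype α).map e = PMF.uniformOfFintype β := by
  classical
  ext b
  rw [PMF.map_apply, tsum_eq_single (e.symm b)]
  · simp [Fintype.card_congr e]
  · intro a ha
    rw [if_neg]
    rintro rfl
    simp at ha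

/-- Overwrite the places `i`, …, `i + r - 1` of an array. -/
def overwrite {nA r : ℕ} (i : ℕ) (old : ℕ → ℕ) (w : Fin r → Fin nA) : ℕ → ℕ := fun x =>
  if h : i ≤ x ∧ x < i + r then (w ⟨x - i, by omega⟩ : ℕ) else old x

theorem overwrite_cons {nA r : ℕ} (i : ℕ) (old : ℕ → ℕ) (v : Fin nA) (w : Fin r → Fin nA) :
    overwrite i old (Fin.cons v w : Fin (r + 1) → Fin nA) =
      overwrite (i + 1) (Function.update old i v) w := by
  funext x
  rw [overwrite, overwrite]
  rcases lt_trichotomy x i with h | rfl | h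
  · rw [dif_neg (by omega), dif_neg (by omega), Function.update_of_ne (by omega)]
  · rw [dif_pos (by omega), dif_neg (by omega), Function.update_self]
    have : (⟨x - x, by omega⟩ : Fin (r + 1)) = 0 := Fin.ext (by simp)
    rw [this, Fin.cons_zero]
  · by_cases h2 : x < i + (r + 1)
    · rw [dif_pos (by omega), dif_pos (by omega)]
      have : (⟨x - i, by omega⟩ : Fin (r + 1)) = Fin.succ ⟨x - (i + 1), by omega⟩ :=
        Fin.ext (by simp; omega)
      rw [this, Fin.cons_succ]
    · rw [dif_neg (by omega), dif_neg (by omega), Function.update_of_ne (by omega)]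

variable {K : Type} [Field K] [LinearOrder K] {sz : K → ℕ} {G : Grading sz} {fuel : ℕ}

/-- The body of the sampling loop. -/
def Code.draw : Program :=
  .seq (.rand 1 (nv 6) (.sub Code.nA (.lit 1))) (.setNat 6 (.lit 0) (.add (nv 6) (.lit 1)))

/-- The test of the sampling loop. -/
def Code.drawTest : Test := .ltNat (nv 6) (.mul (nv 2) Code.nS)

/-- The clock after the draw depends on the outcome but is irrelevant for the law of the table, so
it is hidden in `c`. -/
theorem map_run_draw {nA : ℕ} [NeZero nA] {β : Type} (σ : State K) (hA : σ.nat 0 1 = nA)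
    (g : State K → PMF β) :
    ∃ c : ℕ → ℕ, (Code.draw.run sz fuel σ).bind g =
      (PMF.uniformOfFintype (Fin nA)).bind fun v =>
        g ⟨upd (upd σ.nat 1 (σ.nat 6 0) v) 6 0 (σ.nat 6 0 + 1), σ.num, c v⟩ := by
  set σ' : ℕ → State K := fun v => (σ.putNat 1 (σ.nat 6 0) v).tick ((nv 6).cost σ +
    (NatExp.sub Code.nA (.lit 1)).cost σ + 1) with hσ'
  refine ⟨fun v => (σ' v).time + ((NatExp.lit 0).cost (σ' v) +
    (NatExp.add (nv 6) (.lit 1)).cost (σ' v) + 1), ?_⟩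
  have hm : (NatExp.sub Code.nA (.lit 1)).eval σ + 1 = nA := by
    have := NeZero.ne nA
    have h1 : (NatExp.sub Code.nA (.lit 1)).eval σ = σ.nat 0 1 - 1 := rfl
    rw [h1, hA]
    omega
  -- Binding with `g` is mapping into `PMF β` and then flattening, so the change of index type
  -- applies to the mapped law.
  have key := congrArg (fun p : PMF (PMF β) => p.bind id)
    (PMF.map_uniformOfFintype_fin hm (fun v => ((Program.setNat 6 (.lit 0)
      (.add (nv 6) (.lit 1))).run sz fuel (σ' v)).bind g))
  simp only [PMF.bind_map] at key
  rw [Code.draw, Program.run, PMF.bind_bind, Program.run, PMF.bind_map]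
  refine key.trans (PMF.bind_congr_support _ fun v _ => ?_)
  simp only [Function.comp_apply, id_eq, Program.run, PMF.pure_bind]
  have e7 : (NatExp.add (nv 6) (.lit 1)).eval (σ' v) = σ.nat 6 0 + 1 := by
    simp [NatExp.eval, nv, hσ', State.tick, State.putNat]
  rw [e7]
  rfl

/-- Induction on the remaining draws `r`: the first round supplies the head of the uniform tuple,
and `overwrite_cons` matches the order of writing. -/
theorem map_loopUpTo_draw {nA : ℕ} [NeZero nA] (r : ℕ) : ∀ (i f : ℕ) (σ : State K),
    r < f → σ.nat 0 1 = nA → σ.nat 6 0 = i → σ.nat 2 0 * σ.nat 0 0 = i + r →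
    (loopUpTo sz Code.drawTest (Code.draw.run sz fuel) f σ).map (fun σ => σ.nat 1) =
      (PMF.uniformOfFintype (Fin r → Fin nA)).map (overwrite i (σ.nat 1)) := by
  induction r with
  | zero =>
    intro i f σ hf hA hi hK
    obtain ⟨f, rfl⟩ := Nat.exists_eq_succ_of_ne_zero (by omega : f ≠ 0)
    rw [loopUpTo, if_neg, PMF.pure_map]
    · symm
      refine PMF.map_eq_pure _ fun w _ => ?_
      funext x
      rw [overwrite, dif_neg (by omega)]
      rfl
    · rw [Test.eval_eq]
      simp only [Code.drawTest, Test.Holds, NatExp.val, nv, Code.nS, hi, hK]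
      omega
  | succ r ih =>
    intro i f σ hf hA hi hK
    obtain ⟨f, rfl⟩ := Nat.exists_eq_succ_of_ne_zero (by omega : f ≠ 0)
    obtain ⟨c, hc⟩ := map_run_draw (sz := sz) (fuel := fuel) (nA := nA)
      (σ.tick (Code.drawTest.cost sz σ)) hA (fun σ => (loopUpTo sz Code.drawTest
        (Code.draw.run sz fuel) f σ).map (fun σ => σ.nat 1))
    rw [loopUpTo, if_pos, PMF.map_bind, hc, PMF.uniformOfFintype_fin_succ, PMF.map_bind]
    · refine PMF.bind_congr_support _ fun v _ => ?_
      rw [ih (i + 1) f _ (by omega) (by simpa [upd_apply, State.tick] using hA)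
        (by simp [upd_apply, State.tick, hi])
        (by simp only [State.tick]; rw [upd_ne _ _ _ _ (by omega), upd_ne _ _ _ _ (by omega),
              upd_ne _ _ _ _ (by omega), upd_ne _ _ _ _ (by omega), hK]; omega), PMF.map_comp]
      congr 1
      funext w
      rw [Function.comp_apply, overwrite_cons]
      congr 1
      simp [upd, State.tick, hi]
    · rw [Test.eval_eq]
      simp only [Code.drawTest, Test.Holds, NatExp.val, nv, Code.nS, hi, hK]
      omega

theorem map_run_fill {nA : ℕ} [NeZero nA] {σ : State K} (hA : σ.nat 0 1 = nA) {k N : ℕ}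
    (hk : σ.nat 2 0 = k) (hN : σ.nat 0 0 = N) (hf : k * N < fuel) :
    (Code.fill.run sz fuel σ).map (fun σ => σ.nat 1) =
      (PMF.uniformOfFintype (Fin (k * N) → Fin nA)).map (overwrite 0 (σ.nat 1)) := by
  rw [Code.fill, forLoop, Program.run, Program.run, PMF.pure_bind]
  have := map_loopUpTo_draw (sz := sz) (fuel := fuel) (nA := nA) (k * N) 0 fuel
    ((σ.putNat 6 0 0).tick ((NatExp.lit 0).cost σ + (NatExp.lit 0).cost σ + 1)) hf
    (by simpa [State.putNat, State.tick] using hA) (by simp [State.putNat, State.tick])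
    (by simp [State.putNat, State.tick, hk, hN])
  have e : ((σ.putNat 6 0 0).tick ((NatExp.lit 0).cost σ + (NatExp.lit 0).cost σ + 1)).nat 1 =
      σ.nat 1 := by
    simp [State.putNat, State.tick]
  rw [e] at this
  exact this

variable {nat : ℕ → ℕ → ℕ} {num : ℕ → ℕ → K}

theorem sat_fill {k N nA : ℕ} (hA : nat 0 1 = nA) (hAR : nA ≤ G.R) (hk : nat 2 0 = k)
    (hN : nat 0 0 = N) (hR : k * N ≤ G.R) (hf : G.R < fuel) :
    G.Sat fuel Code.fill nat num (k * N * (1 + 2) + 2)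
      fun nat' num' => (∀ x, nat' 0 x = nat 0 x) ∧ nat' 2 0 = k ∧ num' = num := by
  refine Grading.sat_forLoop (hR.trans_lt hf) hR
    (fun _ nat' num' => (∀ x, nat' 0 x = nat 0 x) ∧ nat' 2 0 = k ∧ num' = num) ?_ ?_
    ⟨fun x => upd_ne _ _ _ _ (by omega), by rw [upd_ne _ _ _ _ (by omega), hk], rfl⟩
  · rintro j hj nat' num' hnj ⟨h0, h2, rfl⟩
    refine Grading.sat_rand ?_ fun v _ => ?_
    · simp only [NatExp.val, Code.nA, h0, hA]; omega
    · refine ⟨by rw [upd_ne _ _ _ _ (by omega), hnj], fun x => ?_, ?_, rfl⟩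
      · rw [upd_ne _ _ _ _ (by omega), upd_ne _ _ _ _ (by omega), h0]
      · rw [upd_ne _ _ _ _ (by omega), upd_ne _ _ _ _ (by omega), h2]
  · rintro j hj nat' num' - ⟨h0, h2, rfl⟩
    simp only [NatExp.val, nv, Code.nS, h0, h2, hN]

/-- The number of samples, in terms of the size of the input and a bound for `1 / ε`. -/
def sampleCount (d m n : ℕ) : ℕ := 8 * (d + 1) * (m * m) * Nat.size n

/-- The first loop doubles until the power exceeds `n`, which takes `Nat.size n` rounds and reaches
at most `2 n`. The second stops at `m` by `hm` and `hm'`. -/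
theorem sat_prelude {d n m : ℕ} (hn : nat 0 3 = n) (h4 : nat 4 0 = 0) (h5 : nat 5 0 = 0)
    (hn0 : 0 < n) (hnR : 2 * n ≤ G.R) (hm : ∀ j < m, (j : K) * num 0 2 < 1)
    (hm' : ¬ (m : K) * num 0 2 < 1) (hmR : m ≤ G.R) (hkR : sampleCount d m n ≤ G.R)
    (hf : G.R < fuel) :
    G.Sat fuel (Code.prelude d) nat num
      (1 + ((Nat.size n * ((1 + 1) + 1) + 1) + ((m * (1 + 1) + 1) + 1)))
      fun nat' num' => (∀ x, nat' 0 x = nat 0 x) ∧ (∀ x, nat' 1 x = nat 1 x) ∧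
        nat' 2 0 = sampleCount d m n ∧ num' = num := by
  have hpow : ∀ j < Nat.size n, 2 ^ j ≤ n := fun j hj => Nat.lt_size.1 hj
  have hsize : Nat.size n ≤ n := Nat.size_le.2 Nat.lt_two_pow_self
  refine Grading.sat_seq (mid := fun nat' num' => (∀ x, nat' 0 x = nat 0 x) ∧
    (∀ x, nat' 1 x = nat 1 x) ∧ nat' 3 0 = 2 ^ 0 ∧ nat' 4 0 = 0 ∧ nat' 5 0 = 0 ∧ num' = num)
    (Grading.sat_setNat ?_ ?_) ?_
  · simp only [NatExp.val]; omega
  · exact ⟨fun x => upd_ne _ _ _ _ (by omega), fun x => upd_ne _ _ _ _ (by omega),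
      by simp [NatExp.val, upd_apply], by rw [upd_ne _ _ _ _ (by omega), h4],
      by rw [upd_ne _ _ _ _ (by omega), h5], rfl⟩
  rintro nat1 num1 ⟨h0, h1, h3, h4, h5, rfl⟩
  refine Grading.sat_seq (Grading.sat_loop (m := 1 + 1) (n := Nat.size n) (by omega)
    (fun j nat' num' => (∀ x, nat' 0 x = nat 0 x) ∧
    (∀ x, nat' 1 x = nat 1 x) ∧ nat' 3 0 = 2 ^ j ∧ nat' 4 0 = j ∧ nat' 5 0 = 0 ∧ num' = num1)
    ?_ ?_ ⟨h0, h1, h3, h4, h5, rfl⟩) ?_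
  · rintro j hj nat' num' ⟨h0, h1, h3, h4, h5, rfl⟩
    have hp := hpow j hj
    refine ⟨?_, Grading.sat_seq (mid := fun nat' num2 => (∀ x, nat' 0 x = nat 0 x) ∧
      (∀ x, nat' 1 x = nat 1 x) ∧ nat' 3 0 = 2 ^ (j + 1) ∧ nat' 4 0 = j ∧ nat' 5 0 = 0 ∧
      num2 = num') (Grading.sat_setNat ?_ ?_) ?_⟩
    · simp only [Test.Holds, NatExp.val, nv, Code.size, h0, hn, h3]; omega
    · simp only [NatExp.val, nv, h3]; omega
    · exact ⟨fun x => by rw [upd_ne _ _ _ _ (by omega), h0],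
        fun x => by rw [upd_ne _ _ _ _ (by omega), h1],
        by simp only [NatExp.val, nv, h3, upd_self]; ring,
        by rw [upd_ne _ _ _ _ (by omega), h4],
        by rw [upd_ne _ _ _ _ (by omega), h5], rfl⟩
    · rintro nat' num2 ⟨h0, h1, h3, h4, h5, rfl⟩
      refine Grading.sat_setNat ?_ ?_
      · simp only [NatExp.val, nv, h4]; omega
      · exact ⟨fun x => by rw [upd_ne _ _ _ _ (by omega), h0],
          fun x => by rw [upd_ne _ _ _ _ (by omega), h1],
          by rw [upd_ne _ _ _ _ (by omega), h3],
          by simp only [NatExp.val, nv, h4, upd_self],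
          by rw [upd_ne _ _ _ _ (by omega), h5], rfl⟩
  · rintro nat' num' ⟨h0, h1, h3, h4, h5, rfl⟩
    simp only [Test.Holds, NatExp.val, nv, Code.size, h0, hn, h3]
    have := Nat.lt_size_self n
    omega
  rintro nat2 num2 ⟨h0, h1, h3, h4, h5, rfl⟩
  refine Grading.sat_seq (Grading.sat_loop (m := 1) (n := m) (by omega)
    (fun j nat' num' => (∀ x, nat' 0 x = nat 0 x) ∧
    (∀ x, nat' 1 x = nat 1 x) ∧ nat' 4 0 = Nat.size n ∧ nat' 5 0 = j ∧ num' = num2)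
    ?_ ?_ ⟨h0, h1, h4, h5, rfl⟩) ?_
  · rintro j hj nat' num' ⟨h0, h1, h4, h5, rfl⟩
    refine ⟨?_, Grading.sat_setNat ?_ ?_⟩
    · simpa [Test.Holds, NumExp.val, NatExp.val, nv, h5] using hm j hj
    · simp only [NatExp.val, nv, h5]; omega
    · exact ⟨fun x => by rw [upd_ne _ _ _ _ (by omega), h0],
        fun x => by rw [upd_ne _ _ _ _ (by omega), h1],
        by rw [upd_ne _ _ _ _ (by omega), h4],
        by simp only [NatExp.val, nv, h5, upd_self], rfl⟩
  · rintro nat' num' ⟨h0, h1, h4, h5, rfl⟩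
    simpa [Test.Holds, NumExp.val, NatExp.val, nv, h5] using hm'
  rintro nat3 num3 ⟨h0, h1, h4, h5, rfl⟩
  refine Grading.sat_setNat ?_ ?_
  · simp only [NatExp.val, nv, h4, h5]; exact hkR
  · exact ⟨fun x => by rw [upd_ne _ _ _ _ (by omega), h0],
      fun x => by rw [upd_ne _ _ _ _ (by omega), h1],
      by simp only [NatExp.val, nv, h4, h5, upd_self, sampleCount], rfl⟩

end Sampling

/-! ### The law of the output and the cost of the whole program. -/

section Correctness

variable {K : Type} [Field K] [LinearOrder K] {sz : K → ℕ} {nS nA : ℕ}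

theorem MDP.input_reward (M : MDP K nS nA) (τ ε : K) (s : Fin nS) (a : Fin nA) :
    (M.input sz τ ε).num 1 (s * nA + a) = M.reward s a := by
  have h : (s : ℕ) * nA + a < nS * nA := flat_lt s.2 a.2
  simp only [MDP.input, dif_pos h]
  congr 1
  · exact Fin.ext (flat_div a.2 s)
  · exact Fin.ext (flat_mod a.2 s)

theorem MDP.input_trans (M : MDP K nS nA) (τ ε : K) (s : Fin nS) (a : Fin nA) (s' : Fin nS) :
    (M.input sz τ ε).num 2 ((s * nA + a) * nS + s') = M.trans s a s' := by
  have h0 : (s : ℕ) * nA + a < nS * nA := flat_lt s.2 a.2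
  have h : ((s : ℕ) * nA + a) * nS + s' < nS * nA * nS := flat_lt h0 s'.2
  simp only [MDP.input, dif_pos h]
  have e : Fin.divNat (⟨((s : ℕ) * nA + a) * nS + s', h⟩ : Fin (nS * nA * nS)) =
      ⟨(s : ℕ) * nA + a, h0⟩ := Fin.ext (flat_div s'.2 _)
  rw [e]
  congr 1
  · exact Fin.ext (flat_div a.2 s)
  · exact Fin.ext (flat_mod a.2 s)
  · exact Fin.ext (flat_mod s'.2 _)

/-- The conditions under which the grading controls the run of the program on an input. -/
structure Admissible (G : Grading sz) (fuel d m : ℕ) (M : MDP K nS nA) (τ ε : K) : Prop where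
  nS_le : nS ≤ G.R
  nA_le : nA ≤ G.R
  size_le : 2 * M.size sz ≤ G.R
  const_le : 8 * (d + 1) ≤ G.R
  m_le : m ≤ G.R
  count_le : sampleCount d m (M.size sz) ≤ G.R
  draws_le : sampleCount d m (M.size sz) * nS ≤ G.R
  lt_fuel : G.R < fuel
  γ : G.Q 1 M.gamma
  τ : G.Q 1 τ
  ε : G.Q 1 ε
  reward : ∀ s a, G.Q 1 (M.reward s a)
  trans : ∀ s a s', G.Q 1 (M.trans s a s')

theorem MDP.size_pos (M : MDP K nS nA) : 0 < M.size sz := by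
  rw [MDP.size]
  omega

theorem sampleCount_pos {d m n : ℕ} (hm : 0 < m) (hn : 0 < n) : 0 < sampleCount d m n := by
  have := Nat.size_pos.2 hn
  rw [sampleCount]
  positivity

variable {G : Grading sz} {fuel d m : ℕ} {M : MDP K nS nA} {τ ε : K}

theorem Admissible.input_mem (h : Admissible G fuel d m M τ ε) (a i : ℕ) :
    G.Q 1 ((M.input sz τ ε).num a i) := by
  simp only [MDP.input]
  split
  · exact h.γ
  · exact h.τ
  · exact h.ε
  · split_ifs
    exacts [h.reward _ _, G.zero]
  · split_ifs
    exacts [h.trans _ _ _, G.zero]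
  · exact G.zero

theorem Admissible.tame (h : Admissible G fuel d m M τ ε) :
    G.Tame (M.input sz τ ε).nat (M.input sz τ ε).num := by
  refine ⟨fun a i => ?_, fun a i => G.mono G.one_le_top (h.input_mem a i)⟩
  simp only [MDP.input]
  split
  · exact h.nS_le
  · exact h.nA_le
  · exact M.start.2.le.trans h.nS_le
  · have := h.size_le; omega
  · exact Nat.zero_le _

variable (M τ ε sz d m) in
/-- The constants of the deterministic part of the program. -/
def inputParams (w : ℕ → ℕ) : Params K where
  N := nS
  nA := nA
  s := M.start
  k := sampleCount d m (M.size sz)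
  w := w
  γ := M.gamma
  τ := τ
  R := (M.input sz τ ε).num 1
  T := (M.input sz τ ε).num 2

theorem inputParams_N (w : ℕ → ℕ) : (inputParams sz d m M τ ε w).N = nS := rfl

theorem inputParams_k (w : ℕ → ℕ) :
    (inputParams sz d m M τ ε w).k = sampleCount d m (M.size sz) := rfl

theorem Admissible.ok (h : Admissible G fuel d m M τ ε) (w : ℕ → ℕ) :
    (inputParams sz d m M τ ε w).Ok G fuel where
  N_le := h.nS_le
  k_le := h.count_le
  lt := h.lt_fuel
  s_lt := M.start.2
  γ := h.γ
  R := h.input_mem 1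
  T := h.input_mem 2

/-- The memory after the number of samples has been computed. -/
def Ready (sz : K → ℕ) (d m : ℕ) (M : MDP K nS nA) (τ ε : K) : Cond K := fun nat num =>
  (∀ x, nat 0 x = (M.input sz τ ε).nat 0 x) ∧ (∀ x, nat 1 x = 0) ∧
    nat 2 0 = sampleCount d m (M.size sz) ∧ num = (M.input sz τ ε).num

/-- The memory after the actions have been drawn. -/
def Drawn (sz : K → ℕ) (d m : ℕ) (M : MDP K nS nA) (τ ε : K) : Cond K := fun nat num =>
  (∀ x, nat 0 x = (M.input sz τ ε).nat 0 x) ∧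
    nat 2 0 = sampleCount d m (M.size sz) ∧ num = (M.input sz τ ε).num

/-- A bound for the number of commands that the program executes. -/
def mainCost (k m n N : ℕ) : ℕ :=
  (1 + ((Nat.size n * ((1 + 1) + 1) + 1) + ((m * (1 + 1) + 1) + 1))) +
    ((k * N * (1 + 2) + 2) +
      (1 + ((k * ((Params.evaluateCost N + 2) + 2) + 2) + 1)))

theorem Admissible.sat_prelude (h : Admissible G fuel d m M τ ε)
    (hm : ∀ j < m, (j : K) * ε < 1) (hm' : ¬ (m : K) * ε < 1) :
    G.Sat fuel (Code.prelude d) (M.input sz τ ε).nat (M.input sz τ ε).num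
      (1 + ((Nat.size (M.size sz) * ((1 + 1) + 1) + 1) + ((m * (1 + 1) + 1) + 1)))
      (Ready sz d m M τ ε) :=
  (PolicyDensity.sat_prelude rfl rfl rfl M.size_pos h.size_le hm hm' h.m_le h.count_le
    h.lt_fuel).mono le_rfl fun _ _ ⟨h0, h1, h2, h3⟩ => ⟨h0, h1, h2, h3⟩

theorem Admissible.sat_fill (h : Admissible G fuel d m M τ ε) {nat : ℕ → ℕ → ℕ}
    {num : ℕ → ℕ → K} (hr : Ready sz d m M τ ε nat num) :
    G.Sat fuel Code.fill nat num (sampleCount d m (M.size sz) * nS * (1 + 2) + 2)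
      (Drawn sz d m M τ ε) :=
  (PolicyDensity.sat_fill (hr.1 1) h.nA_le hr.2.2.1 (hr.1 0) h.draws_le h.lt_fuel).mono le_rfl
    fun _ _ ⟨h0, h2, h3⟩ => ⟨fun x => (h0 x).trans (hr.1 x), h2, h3.trans hr.2.2.2⟩

theorem Admissible.sat_count (h : Admissible G fuel d m M τ ε) (hm : 0 < m) {nat : ℕ → ℕ → ℕ}
    {num : ℕ → ℕ → K} (hr : Drawn sz d m M τ ε nat num) :
    G.Sat fuel Code.count nat num
      (1 + ((sampleCount d m (M.size sz) * ((Params.evaluateCost nS + 2) + 2) + 2) + 1))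
      fun _ num => num 3 0 = ((inputParams sz d m M τ ε (nat 1)).cnt
        (sampleCount d m (M.size sz)) : K) / (sampleCount d m (M.size sz) : K) := by
  obtain ⟨h0, h2, h3⟩ := hr
  have hE : (inputParams sz d m M τ ε (nat 1)).Env nat num := by
    subst h3
    exact ⟨h0 0, h0 1, h0 2, fun _ _ => rfl, h2, rfl, rfl, fun _ => rfl, fun _ => rfl⟩
  have h5 : ∀ x < (inputParams sz d m M τ ε (nat 1)).N * (inputParams sz d m M τ ε (nat 1)).N,
      num 5 x = 0 := by
    subst h3
    exact fun x _ => rfl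
  have := Params.sat_count (h.ok (nat 1)) (sampleCount_pos hm M.size_pos) hE h5
  rw [inputParams_N, inputParams_k] at this
  exact this

theorem Admissible.time_le (h : Admissible G fuel d m M τ ε) (hm0 : 0 < m)
    (hm : ∀ j < m, (j : K) * ε < 1) (hm' : ¬ (m : K) * ε < 1) :
    ∀ σ ∈ ((Code.main d).run sz fuel (M.input sz τ ε)).support,
      σ.time ≤ mainCost (sampleCount d m (M.size sz)) m (M.size sz) nS * G.W := by
  intro σ hσ
  have := (Grading.sat_seq (h.sat_prelude hm hm') fun _ _ hr =>
    Grading.sat_seq (h.sat_fill hr) fun _ _ hd => (h.sat_count hm0 hd).mono le_rfl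
      (mid := fun _ _ => True) fun _ _ _ => trivial)
    (Code.small_main d h.const_le) h.tame 0 σ hσ
  rw [zero_add] at this
  exact this.2.2

/-- Before and after the drawing loop, the relevant memory is determined on the support. The output
is thus a function of the drawn table alone. -/
theorem Admissible.map_output (h : Admissible G fuel d m M τ ε) [NeZero nA] (hm0 : 0 < m)
    (hm : ∀ j < m, (j : K) * ε < 1) (hm' : ¬ (m : K) * ε < 1) :
    ((Code.main d).run sz fuel (M.input sz τ ε)).map State.output =
      (PMF.uniformOfFintype (Fin (sampleCount d m (M.size sz) * nS) → Fin nA)).map fun u =>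
        ((inputParams sz d m M τ ε (overwrite 0 (fun _ => 0) u)).cnt
          (sampleCount d m (M.size sz)) : K) / (sampleCount d m (M.size sz) : K) := by
  obtain ⟨s1, s2, s3⟩ := Code.small_main d h.const_le
  rw [Code.main, Program.run, PMF.map_bind]
  -- The rest of the run has the same output law from every state that the prelude can reach, so the
  -- prelude drops out.
  refine (PMF.bind_congr_support _ (g := fun _ => _) fun σ1 h1 => ?_).trans (PMF.bind_const _ _)
  obtain ⟨t1, r1, -⟩ := h.sat_prelude hm hm' s1 h.tame 0 σ1 h1
  rw [Program.run, PMF.map_bind]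
  refine (PMF.bind_congr_support _ (g := PMF.pure ∘ fun σ2 =>
    ((inputParams sz d m M τ ε (σ2.nat 1)).cnt (sampleCount d m (M.size sz)) : K) /
      (sampleCount d m (M.size sz) : K)) fun σ2 h2 => ?_).trans ?_
  · obtain ⟨t2, r2, -⟩ := h.sat_fill r1 s2 t1 σ1.time σ2 h2
    exact PMF.map_eq_pure _ fun σ3 h3 => (h.sat_count hm0 r2 s3 t2 σ2.time σ3 h3).2.1
  · have e := map_run_fill (sz := sz) (fuel := fuel) (nA := nA) (σ := σ1) (r1.1 1) r1.2.2.1 (r1.1 0)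
      (h.draws_le.trans_lt h.lt_fuel)
    have e1 : σ1.nat 1 = fun _ => 0 := funext r1.2.1
    rw [e1] at e
    have e2 := congrArg (PMF.map fun w => ((inputParams sz d m M τ ε w).cnt
      (sampleCount d m (M.size sz)) : K) / (sampleCount d m (M.size sz) : K)) e
    rw [PMF.map_comp, PMF.map_comp] at e2
    exact e2

theorem inputParams_isGood [CharZero K] (w : ℕ → ℕ) (j : ℕ) (π : Policy nS nA)
    (hπ : ∀ s : Fin nS, w (j * nS + s) = π s) :
    (inputParams sz d m M τ ε w).IsGood j ↔ M.Good τ π := by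
  set D := inputParams sz d m M τ ε w with hD
  have hrow : ∀ i : Fin nS, D.row j i = i * nA + π i := fun i => by
    rw [Params.row, ← hπ]; rfl
  have hT : ∀ i l : Fin nS, D.T (D.row j i * D.N + l) = M.trans i (π i) l := fun i l => by
    rw [hrow]; exact M.input_trans (sz := sz) τ ε i (π i) l
  have hR : ∀ i : Fin nS, D.r j i = M.gain π i := fun i => by
    rw [Params.r, hrow]; exact M.input_reward (sz := sz) τ ε i (π i)
  have ha : ∀ i l : Fin nS, D.a j i l = M.kernel π i l := fun i l => by
    have hR' : D.R (D.row j i) = M.reward i (π i) := hR i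
    rw [Params.a, hT, MDP.kernel, Matrix.of_apply, Params.discount, hT, hR']
    by_cases hs : M.Stops π i
    · rw [if_pos hs]
      exact congrArg (· * _) (if_pos hs)
    · rw [if_neg hs]
      exact congrArg (· * _) (if_neg hs)
  have h1 := denominatorSeq_eq (M.kernel π) (D.a j) ha
  have h2 := numeratorSeq_eq (M.kernel π) (D.a j) ha (D.r j) (M.gain π) hR M.start
  rw [MDP.Good, ← h1, ← h2]
  rfl

/-- Tables of actions, seen as tuples of policies. -/
def policiesEquiv (k nS nA : ℕ) : (Fin (k * nS) → Fin nA) ≃ (Fin k → Policy nS nA) :=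
  (Equiv.arrowCongr finProdFinEquiv.symm (Equiv.refl _)).trans (Equiv.curry _ _ _)

theorem policiesEquiv_apply {k : ℕ} (u : Fin (k * nS) → Fin nA) (j : Fin k) (s : Fin nS) :
    (policiesEquiv k nS nA u j s : ℕ) = overwrite 0 (fun _ => 0) u (j * nS + s) := by
  have h : (j : ℕ) * nS + s < k * nS := flat_lt j.2 s.2
  rw [overwrite, dif_pos ⟨Nat.zero_le _, by omega⟩]
  change (u (finProdFinEquiv (j, s)) : ℕ) = _
  congr 2
  apply Fin.ext
  simp [mul_comm, add_comm]

open Classical in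
theorem Admissible.map_output_eq (h : Admissible G fuel d m M τ ε) [CharZero K] [NeZero nA]
    (hm0 : 0 < m) (hm : ∀ j < m, (j : K) * ε < 1) (hm' : ¬ (m : K) * ε < 1) :
    ((Code.main d).run sz fuel (M.input sz τ ε)).map State.output =
      (PMF.uniformOfFintype (Fin (sampleCount d m (M.size sz)) → Policy nS nA)).map fun πs =>
        (Finset.card {j | M.Good τ (πs j)} : K) / (sampleCount d m (M.size sz) : K) := by
  rw [h.map_output hm0 hm hm', ← PMF.map_uniformOfFintype_equiv
    (policiesEquiv (sampleCount d m (M.size sz)) nS nA), PMF.map_comp]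
  congr 1
  funext u
  rw [Function.comp_apply]
  congr 2
  rw [Params.cnt, Finset.sum_range, Finset.sum_boole, Nat.cast_id]
  congr 1
  ext j
  simp only [Finset.mem_filter, Finset.mem_univ, true_and]
  exact inputParams_isGood _ _ _ fun s => (policiesEquiv_apply u j s).symm

end Correctness

/-! ### Gradings of the real and the rational numbers -/

/-- On the real RAM there is nothing to control. -/
def realGrading (R : ℕ) (hR : 2 ≤ R) : Grading realSize where
  R := R
  two_le := hR
  b := 0
  Q _ _ := True
  mono _ _ := trivial
  add _ _ := trivial
  sub _ _ := trivial
  mul _ _ := trivial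
  natCast _ := trivial
  div _ _ _ := trivial
  size _ := Nat.zero_le _

/-- Reducing `z / D` to lowest terms increases neither numerator nor denominator, and `|z| ≤ B D`.
-/
theorem bitSize_le_of_mul_eq {x : ℚ} {D B s : ℕ} (hD : 0 < D) {z : ℤ} (hz : x * D = z)
    (hB : |x| ≤ B) (hs : B * D < 2 ^ s) (hs' : D < 2 ^ s) : bitSize x ≤ 2 * s := by
  have hD' : (0 : ℚ) < D := by exact_mod_cast hD
  have hx : x = Rat.divInt z D := by
    rw [Rat.divInt_eq_div, ← hz]
    push_cast
    field_simp
  have hden : x.den ∣ D := by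
    have := Rat.den_dvd z D
    rw [← hx] at this
    exact_mod_cast this
  have hnum : x.num.natAbs ≤ z.natAbs := by
    by_cases h0 : z = 0
    · have : x = 0 := by rw [hx, h0]; simp
      simp [this]
    · have h1 := Rat.num_dvd z (b := (D : ℤ)) (by exact_mod_cast hD.ne')
      rw [← hx] at h1
      exact Nat.le_of_dvd (Int.natAbs_pos.2 h0) (Int.natAbs_dvd_natAbs.2 h1)
  have hz' : z.natAbs ≤ B * D := by
    have : ((z.natAbs : ℕ) : ℚ) ≤ ((B * D : ℕ) : ℚ) := by
      rw [Nat.cast_natAbs, Int.cast_abs, ← hz, abs_mul, abs_of_pos hD', Nat.cast_mul]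
      exact mul_le_mul_of_nonneg_right hB hD'.le
    exact_mod_cast this
  have h1 : Nat.size x.num.natAbs ≤ s := Nat.size_le.2 (by omega)
  have h2 : Nat.size x.den ≤ s := Nat.size_le.2 ((Nat.le_of_dvd hD hden).trans_lt hs')
  rw [bitSize]
  omega

/-- Rational numbers are controlled by a common denominator and a bound for the absolute value. -/
def ratGrading (R U E : ℕ) (hR : 2 ≤ R) (hU : R ≤ U) (hE : 0 < E)
    (hdvd : ∀ m, 1 ≤ m → m ≤ R → m ∣ E) : Grading bitSize where
  R := R
  two_le := hR
  b := 2 * (Nat.size U + Nat.size E + 1)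
  Q i x := (∃ z : ℤ, x * (E : ℚ) ^ i = z) ∧ |x| ≤ (U : ℚ) ^ i
  mono := by
    rintro i j x hij ⟨⟨z, hz⟩, hx⟩
    refine ⟨⟨z * (E : ℤ) ^ (j - i), ?_⟩, hx.trans (pow_le_pow_right₀ ?_ hij)⟩
    · push_cast
      rw [← hz, mul_assoc, ← pow_add, Nat.add_sub_cancel' hij]
    · exact_mod_cast (by omega : 1 ≤ U)
  -- The extra level pays for the factor `2` in `2 U ^ i ≤ U ^ (i + 1)`.
  add := by
    rintro i x y ⟨⟨z, hz⟩, hx⟩ ⟨⟨w, hw⟩, hy⟩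
    have hU' : (2 : ℚ) ≤ U := by exact_mod_cast hR.trans hU
    have hp : (0 : ℚ) ≤ (U : ℚ) ^ i := by positivity
    refine ⟨⟨(z + w) * E, ?_⟩, ?_⟩
    · push_cast
      rw [← hz, ← hw, pow_succ]; ring
    · rw [pow_succ]
      refine (abs_add_le x y).trans ?_
      nlinarith
  sub := by
    rintro i x y ⟨⟨z, hz⟩, hx⟩ ⟨⟨w, hw⟩, hy⟩
    have hU' : (2 : ℚ) ≤ U := by exact_mod_cast hR.trans hU
    have hp : (0 : ℚ) ≤ (U : ℚ) ^ i := by positivity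
    refine ⟨⟨(z - w) * E, ?_⟩, ?_⟩
    · push_cast
      rw [← hz, ← hw, pow_succ]; ring
    · rw [pow_succ]
      refine (abs_sub x y).trans ?_
      nlinarith
  mul := by
    rintro i j x y ⟨⟨z, hz⟩, hx⟩ ⟨⟨w, hw⟩, hy⟩
    refine ⟨⟨z * w, ?_⟩, ?_⟩
    · push_cast
      rw [← hz, ← hw, pow_add]; ring
    · rw [abs_mul, pow_add]
      exact mul_le_mul hx hy (abs_nonneg _) (by positivity)
  natCast := by
    intro i m hm
    refine ⟨⟨m * (E : ℤ) ^ i, by push_cast; rfl⟩, ?_⟩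
    rw [Nat.abs_cast]
    exact_mod_cast hm.trans (Nat.pow_le_pow_left hU i)
  -- As `m` divides `E`, the extra factor `E` clears the new denominator.
  div := by
    rintro i x m hm hmR ⟨⟨z, hz⟩, hx⟩
    obtain ⟨e, he⟩ := hdvd m hm hmR
    have hm0 : (0 : ℚ) < m := by exact_mod_cast hm
    have hm1 : (1 : ℚ) ≤ m := by exact_mod_cast hm
    refine ⟨⟨z * e, ?_⟩, ?_⟩
    · push_cast
      rw [← hz, pow_succ]
      have : (E : ℚ) = m * e := by exact_mod_cast he
      nth_rewrite 2 [this]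
      field_simp
    · rw [abs_div, abs_of_pos hm0]
      refine (div_le_self (abs_nonneg _) hm1).trans (hx.trans (pow_le_pow_right₀ ?_ (by omega)))
      exact_mod_cast (by omega : 1 ≤ U)
  size := by
    rintro i x ⟨⟨z, hz⟩, hx⟩
    have hu := Nat.lt_size_self U
    have he := Nat.lt_size_self E
    have h1 : U ^ i * E ^ i ≤ 2 ^ (i * (Nat.size U + Nat.size E)) := by
      rw [mul_comm i, pow_mul, ← mul_pow, pow_add]
      exact Nat.pow_le_pow_left (Nat.mul_le_mul hu.le he.le) i
    have h2 : E ^ i ≤ U ^ i * E ^ i := Nat.le_mul_of_pos_left _ (Nat.pow_pos (by omega))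
    have h3 : 2 ^ (i * (Nat.size U + Nat.size E)) <
        2 ^ (i * (Nat.size U + Nat.size E) + 1) := Nat.pow_lt_pow_right (by norm_num) (by omega)
    refine (bitSize_le_of_mul_eq (D := E ^ i) (B := U ^ i)
      (s := i * (Nat.size U + Nat.size E) + 1) (Nat.pow_pos hE) (by push_cast; exact hz)
      (by push_cast; exact hx) (by omega) (by omega)).trans ?_
    rw [mul_assoc]
    refine Nat.mul_le_mul_left 2 ?_
    nlinarith [Nat.zero_le (Nat.size U), Nat.zero_le (Nat.size E)]

theorem ratGrading_mem {R U E : ℕ} {hR : 2 ≤ R} {hU : R ≤ U} {hE : 0 < E}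
    {hdvd : ∀ m, 1 ≤ m → m ≤ R → m ∣ E} {x : ℚ} (hden : x.den ∣ E) {s : ℕ}
    (hs : bitSize x ≤ s) (hsU : 2 ^ s ≤ U) : (ratGrading R U E hR hU hE hdvd).Q 1 x := by
  obtain ⟨e, he⟩ := hden
  have h0 : (x.den : ℚ) ≠ 0 := by exact_mod_cast x.den_ne_zero
  have h1 : (1 : ℚ) ≤ x.den := by exact_mod_cast x.den_pos
  refine ⟨⟨x.num * e, ?_⟩, ?_⟩
  · rw [pow_one]
    have : (E : ℚ) = x.den * e := by exact_mod_cast he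
    rw [this, ← mul_assoc, Rat.mul_den_eq_num]
    push_cast
    rfl
  · rw [pow_one]
    have h2 : x.num.natAbs ≤ U := by
      refine le_trans ?_ hsU
      refine (Nat.lt_size_self _).le.trans (Nat.pow_le_pow_right (by norm_num) ?_)
      refine le_trans ?_ hs
      rw [bitSize]; omega
    have h3 : |x| ≤ ((x.num.natAbs : ℕ) : ℚ) := by
      conv_lhs => rw [← Rat.num_div_den x]
      rw [abs_div, Nat.abs_cast, Nat.cast_natAbs, Int.cast_abs]
      exact div_le_self (abs_nonneg _) h1
    exact h3.trans (by exact_mod_cast h2)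

section Denominator

variable {nS nA : ℕ} (M : MDP ℚ nS nA)

/-- A common denominator of the numbers in the description of `M`. -/
def MDP.denom : ℕ :=
  M.gamma.den * (∏ s, ∏ a, (M.reward s a).den) * ∏ s, ∏ a, ∏ s', (M.trans s a s').den

theorem den_le_two_pow (x : ℚ) : x.den ≤ 2 ^ (bitSize x + 1) := by
  refine (Nat.lt_size_self _).le.trans (Nat.pow_le_pow_right (by norm_num) ?_)
  rw [bitSize]
  omega

/-- The product of all denominators has a bit length bounded by the sum of their bit lengths, hence
linear in the input size. -/
theorem MDP.denom_le : M.denom ≤ 2 ^ M.size bitSize := by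
  rw [MDP.denom, MDP.size, pow_add, pow_add]
  refine Nat.mul_le_mul (Nat.mul_le_mul (den_le_two_pow _) ?_) ?_
  · rw [← Finset.prod_pow_eq_pow_sum]
    refine Finset.prod_le_prod' fun s _ => ?_
    rw [← Finset.prod_pow_eq_pow_sum]
    exact Finset.prod_le_prod' fun a _ => den_le_two_pow _
  · rw [← Finset.prod_pow_eq_pow_sum]
    refine Finset.prod_le_prod' fun s _ => ?_
    rw [← Finset.prod_pow_eq_pow_sum]
    refine Finset.prod_le_prod' fun a _ => ?_
    rw [← Finset.prod_pow_eq_pow_sum]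
    exact Finset.prod_le_prod' fun s' _ => den_le_two_pow _

theorem MDP.denom_pos : 0 < M.denom :=
  Nat.mul_pos (Nat.mul_pos M.gamma.den_pos
    (Finset.prod_pos fun s _ => Finset.prod_pos fun a _ => (M.reward s a).den_pos))
    (Finset.prod_pos fun s _ => Finset.prod_pos fun a _ => Finset.prod_pos fun s' _ =>
      (M.trans s a s').den_pos)

theorem MDP.gamma_den_dvd : M.gamma.den ∣ M.denom :=
  (dvd_mul_right _ _).trans (dvd_mul_right _ _)

theorem MDP.reward_den_dvd (s : Fin nS) (a : Fin nA) : (M.reward s a).den ∣ M.denom := by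
  have h1 := Finset.dvd_prod_of_mem (fun a => (M.reward s a).den) (Finset.mem_univ a)
  have h2 := Finset.dvd_prod_of_mem (fun s => ∏ a, (M.reward s a).den) (Finset.mem_univ s)
  exact (h1.trans h2).trans ((dvd_mul_left _ _).trans (dvd_mul_right _ _))

theorem MDP.trans_den_dvd (s : Fin nS) (a : Fin nA) (s' : Fin nS) :
    (M.trans s a s').den ∣ M.denom := by
  have h1 := Finset.dvd_prod_of_mem (fun s' => (M.trans s a s').den) (Finset.mem_univ s')
  have h2 := Finset.dvd_prod_of_mem (fun a => ∏ s', (M.trans s a s').den) (Finset.mem_univ a)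
  have h3 := Finset.dvd_prod_of_mem (fun s => ∏ a, ∏ s', (M.trans s a s').den)
    (Finset.mem_univ s)
  exact ((h1.trans h2).trans h3).trans (dvd_mul_left _ _)

end Denominator

section Size

variable {K : Type} [Field K] [LinearOrder K] {sz : K → ℕ} {nS nA : ℕ} (M : MDP K nS nA)

theorem MDP.size_gamma_le : sz M.gamma ≤ M.size sz := by
  rw [MDP.size]; omega

theorem MDP.size_reward_le (s : Fin nS) (a : Fin nA) : sz (M.reward s a) ≤ M.size sz := by
  have h1 := Finset.single_le_sum (f := fun a => sz (M.reward s a) + 1)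
    (fun _ _ => Nat.zero_le _) (Finset.mem_univ a)
  have h2 := Finset.single_le_sum (f := fun s => ∑ a, (sz (M.reward s a) + 1))
    (fun _ _ => Nat.zero_le _) (Finset.mem_univ s)
  have h3 := h1.trans h2
  rw [MDP.size]
  omega

theorem MDP.size_trans_le (s : Fin nS) (a : Fin nA) (s' : Fin nS) :
    sz (M.trans s a s') ≤ M.size sz := by
  have h1 := Finset.single_le_sum (f := fun s' => sz (M.trans s a s') + 1)
    (fun _ _ => Nat.zero_le _) (Finset.mem_univ s')
  have h2 := Finset.single_le_sum (f := fun a => ∑ s', (sz (M.trans s a s') + 1))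
    (fun _ _ => Nat.zero_le _) (Finset.mem_univ a)
  have h3 := Finset.single_le_sum (f := fun s => ∑ a, ∑ s', (sz (M.trans s a s') + 1))
    (fun _ _ => Nat.zero_le _) (Finset.mem_univ s)
  have h4 := (h1.trans h2).trans h3
  rw [MDP.size]
  omega

theorem MDP.mul_le_size : nS * nA ≤ M.size sz := by
  have h : ∑ _s : Fin nS, ∑ _a : Fin nA, 1 ≤ ∑ s, ∑ a, (sz (M.reward s a) + 1) :=
    Finset.sum_le_sum fun s _ => Finset.sum_le_sum fun a _ => by omega
  simp only [Finset.sum_const, Finset.card_univ, Fintype.card_fin, smul_eq_mul, mul_one] at h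
  rw [MDP.size]
  omega

theorem MDP.nS_le_size [NeZero nA] : nS ≤ M.size sz :=
  (Nat.le_mul_of_pos_right _ (NeZero.pos nA)).trans M.mul_le_size

theorem MDP.nA_le_size : nA ≤ M.size sz :=
  (Nat.le_mul_of_pos_left _ (Nat.zero_lt_of_lt M.start.2)).trans M.mul_le_size

end Size

/-! ### Polynomial bounds -/

/-- Functions that are bounded by a polynomial. -/
def PolyBdd (f : ℕ → ℕ) : Prop := ∃ C : ℕ, ∀ x, 1 ≤ x → f x ≤ C * x ^ C

theorem PolyBdd.const (c : ℕ) : PolyBdd fun _ => c :=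
  ⟨c, fun _ hx => Nat.le_mul_of_pos_right _ (Nat.pow_pos hx)⟩

theorem PolyBdd.id : PolyBdd fun x => x := ⟨1, fun x _ => by simp⟩

theorem PolyBdd.add {f g : ℕ → ℕ} (hf : PolyBdd f) (hg : PolyBdd g) :
    PolyBdd fun x => f x + g x := by
  obtain ⟨C, hC⟩ := hf
  obtain ⟨D, hD⟩ := hg
  refine ⟨C + D, fun x hx => ?_⟩
  rw [add_mul]
  exact Nat.add_le_add
    ((hC x hx).trans (Nat.mul_le_mul_left _ (Nat.pow_le_pow_right hx (by omega))))
    ((hD x hx).trans (Nat.mul_le_mul_left _ (Nat.pow_le_pow_right hx (by omega))))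

theorem PolyBdd.mul {f g : ℕ → ℕ} (hf : PolyBdd f) (hg : PolyBdd g) :
    PolyBdd fun x => f x * g x := by
  obtain ⟨C, hC⟩ := hf
  obtain ⟨D, hD⟩ := hg
  refine ⟨C * D + C + D, fun x hx => ?_⟩
  calc f x * g x ≤ (C * x ^ C) * (D * x ^ D) := Nat.mul_le_mul (hC x hx) (hD x hx)
    _ = (C * D) * x ^ (C + D) := by rw [pow_add]; ring
    _ ≤ _ := Nat.mul_le_mul (by omega) (Nat.pow_le_pow_right hx (by omega))

/-- A bound for the natural numbers in a run. -/
def capacity (d m x : ℕ) : ℕ :=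
  4 * x + m + 8 * (d + 1) + 8 * (d + 1) * (m * m) * x + 8 * (d + 1) * (m * m) * x * x + 2

/-- A bound for the sizes of field elements, relative to their level. -/
def sizeBound (R e x : ℕ) : ℕ := 2 * (2 * (x + e) + R + R * R + 3)

/-- A bound for the cost of a command. -/
def unitBound (R B : ℕ) : ℕ := 80 * (1 + 80 * R + B * (80 * (40 * (R * R)) + 1))

/-- A bound for the number of commands. -/
def commandBound (R : ℕ) : ℕ :=
  (1 + ((R * 3 + 1) + ((R * 2 + 1) + 1))) +
    ((R * 3 + 2) + (1 + ((R * ((Params.evaluateCost R + 2) + 2) + 2) + 1)))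

theorem PolyBdd.evaluateCost {f : ℕ → ℕ} (hf : PolyBdd f) :
    PolyBdd fun x => Params.evaluateCost (f x) := by
  unfold Params.evaluateCost
  repeat' first | exact hf | exact PolyBdd.const _ | apply PolyBdd.add | apply PolyBdd.mul

theorem PolyBdd.commandBound {f : ℕ → ℕ} (hf : PolyBdd f) :
    PolyBdd fun x => commandBound (f x) := by
  have he := hf.evaluateCost
  unfold PolicyDensity.commandBound
  repeat' first | exact hf | exact he | exact PolyBdd.const _ | apply PolyBdd.add | apply PolyBdd.mul

theorem PolyBdd.sizeBound {f : ℕ → ℕ} (hf : PolyBdd f) (e : ℕ) :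
    PolyBdd fun x => sizeBound (f x) e x := by
  unfold PolicyDensity.sizeBound
  repeat' first
    | exact hf | exact PolyBdd.id | exact PolyBdd.const _ | apply PolyBdd.add | apply PolyBdd.mul

theorem PolyBdd.unitBound {f g : ℕ → ℕ} (hf : PolyBdd f) (hg : PolyBdd g) :
    PolyBdd fun x => unitBound (f x) (g x) := by
  unfold PolicyDensity.unitBound
  repeat' first
    | exact hf | exact hg | exact PolyBdd.const _ | apply PolyBdd.add | apply PolyBdd.mul

/-- All bounds are built from `+` and `*` only, so closure of `PolyBdd` applies mechanically; adding
`1` makes the inequality strict. -/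
theorem exists_fuel (d m e : ℕ) : ∃ C : ℕ, ∀ x, 1 ≤ x →
    capacity d m x + commandBound (capacity d m x) *
      unitBound (capacity d m x) (sizeBound (capacity d m x) e x) < C * x ^ C := by
  have hc : PolyBdd (capacity d m) := by
    unfold capacity
    repeat' first | exact PolyBdd.const _ | exact PolyBdd.id | apply PolyBdd.add | apply PolyBdd.mul
  obtain ⟨C, hC⟩ := ((hc.add (hc.commandBound.mul (hc.unitBound (hc.sizeBound e)))).add
    (PolyBdd.const 1))
  exact ⟨C, fun x hx => hC x hx⟩

theorem evaluateCost_mono {N R : ℕ} (h : N ≤ R) :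
    Params.evaluateCost N ≤ Params.evaluateCost R := by
  unfold Params.evaluateCost
  gcongr

theorem mainCost_le {k m n N R : ℕ} (hk : k ≤ R) (hm : m ≤ R) (hn : n ≤ R) (hN : N ≤ R)
    (hkN : k * N ≤ R) : mainCost k m n N ≤ commandBound R := by
  have hs : Nat.size n ≤ R := (Nat.size_le.2 Nat.lt_two_pow_self).trans hn
  have he := evaluateCost_mono hN
  unfold mainCost commandBound
  gcongr

theorem Grading.W_le {K : Type} [Field K] [LinearOrder K] {sz : K → ℕ} (G : Grading sz) {R B : ℕ}
    (hR : G.R = R) (hB : G.b ≤ B) : G.W ≤ unitBound R B := by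
  have hs : Nat.size R ≤ R := Nat.size_le.2 Nat.lt_two_pow_self
  unfold Grading.W Grading.unit Grading.top unitBound
  rw [hR, pow_two]
  gcongr

/-! ### The main theorem -/

section Main

variable {K : Type} [Field K] [LinearOrder K] {sz : K → ℕ} {nS nA : ℕ}

theorem sampleCount_le {d m n x : ℕ} (hn : n ≤ x) :
    sampleCount d m n ≤ 8 * (d + 1) * (m * m) * x :=
  Nat.mul_le_mul_left _ ((Nat.size_le.2 Nat.lt_two_pow_self).trans hn)

/-- The same `fuel` exceeds the loop lengths, through `capacity`, and the total cost. -/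
theorem admissible_of_bounds [NeZero nA] {G : Grading sz} {d m e x fuel : ℕ} {M : MDP K nS nA} {τ ε : K}
    (hR : G.R = capacity d m x) (hB : G.b ≤ sizeBound (capacity d m x) e x)
    (hx : M.size sz ≤ x)
    (hf : capacity d m x + commandBound (capacity d m x) *
      unitBound (capacity d m x) (sizeBound (capacity d m x) e x) < fuel)
    (hγ : G.Q 1 M.gamma) (hτ : G.Q 1 τ) (hε : G.Q 1 ε) (hr : ∀ s a, G.Q 1 (M.reward s a))
    (ht : ∀ s a s', G.Q 1 (M.trans s a s')) :
    Admissible G fuel d m M τ ε ∧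
      mainCost (sampleCount d m (M.size sz)) m (M.size sz) nS * G.W < fuel := by
  have h1 := sampleCount_le (d := d) (m := m) hx
  have hnS : nS ≤ x := M.nS_le_size.trans hx
  have hnA : nA ≤ x := M.nA_le_size.trans hx
  have h2 := Nat.mul_le_mul h1 hnS
  have hcap : 4 * x + m + 8 * (d + 1) + 8 * (d + 1) * (m * m) * x +
    8 * (d + 1) * (m * m) * x * x + 2 = capacity d m x := rfl
  refine ⟨⟨by omega, by omega, by omega, by omega, by omega, by omega, by omega, by omega,
    hγ, hτ, hε, hr, ht⟩, ?_⟩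
  refine lt_of_le_of_lt (Nat.mul_le_mul (mainCost_le (R := capacity d m x) ?_ ?_ ?_ ?_ ?_)
    (G.W_le hR hB)) (lt_of_le_of_lt (Nat.le_add_left _ _) hf) <;> omega

theorem exists_mul_not_lt_one [IsStrictOrderedRing K] [Archimedean K] {ε : K} (hε : 0 < ε) :
    ∃ m : ℕ, 0 < m ∧ (∀ j < m, (j : K) * ε < 1) ∧ ¬ (m : K) * ε < 1 := by
  classical
  have h : ∃ m : ℕ, ¬ (m : K) * ε < 1 := by
    obtain ⟨m, hm⟩ := Archimedean.arch (1 : K) hε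
    exact ⟨m, not_lt.2 (by rwa [nsmul_eq_mul] at hm)⟩
  refine ⟨Nat.find h, ?_, fun j hj => not_not.1 (Nat.find_min h hj), Nat.find_spec h⟩
  rw [Nat.find_pos]
  simp

theorem sampleCount_bounds {d m : ℕ} {ε : ℝ} (hε : 0 < ε) {n : ℕ} (hn : 2 ≤ n) :
    ε * (8 * (d + 1) * (m * m)) * (Real.log n / ε) ≤ (sampleCount d m n : ℝ) ∧
      (sampleCount d m n : ℝ) ≤ ε * (8 * (d + 1) * (m * m)) * 3 * (Real.log n / ε) := by
  have hn0 : (0 : ℝ) < n := by exact_mod_cast (by omega : 0 < n)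
  -- If `Nat.size n = s + 1`, then `s log 2 ≤ log n` and `log 2 ≤ log n`. So `s` and `1` are both at
  -- most `(3 / 2) log n`, whence the constant `3`.
  have hl2 : 2 / 3 < Real.log 2 := by linarith [Real.log_two_gt_d9]
  have hl2' : Real.log 2 ≤ 1 := by linarith [Real.log_two_lt_d9]
  have hln : Real.log 2 ≤ Real.log n := Real.log_le_log (by norm_num) (by exact_mod_cast hn)
  have h1 : Real.log n ≤ Nat.size n := by
    have h := Real.log_le_log hn0 (y := (2 : ℝ) ^ Nat.size n)
      (by exact_mod_cast (Nat.lt_size_self n).le)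
    rw [Real.log_pow] at h
    refine h.trans (mul_le_of_le_one_right (Nat.cast_nonneg _) hl2')
  have h2 : (Nat.size n : ℝ) ≤ 3 * Real.log n := by
    obtain ⟨s, hs⟩ := Nat.exists_eq_succ_of_ne_zero (Nat.size_pos.2 (by omega : 0 < n)).ne'
    have hp : 2 ^ s ≤ n := Nat.lt_size.1 (by omega)
    have h := Real.log_le_log (x := (2 : ℝ) ^ s) (y := n) (by positivity)
      (by exact_mod_cast hp)
    rw [Real.log_pow] at h
    rw [hs]
    push_cast
    have hs0 : (0 : ℝ) ≤ s := Nat.cast_nonneg s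
    nlinarith
  have hc : (0 : ℝ) ≤ 8 * (d + 1) * (m * m) := by positivity
  have e : ∀ y : ℝ, ε * (8 * (d + 1) * (m * m)) * (y / ε) = 8 * (d + 1) * (m * m) * y := by
    intro y; field_simp
  constructor
  · rw [e, sampleCount]
    push_cast
    exact mul_le_mul_of_nonneg_left h1 hc
  · rw [mul_assoc _ (3 : ℝ), ← mul_div_assoc, e, sampleCount]
    push_cast
    exact mul_le_mul_of_nonneg_left h2 hc

/-- The factor `m²` in the sample count compensates `ε²` in the Chernoff exponent, because `m ε ≥
1`. -/
theorem MDP.accuracy [NeZero nA] (M : MDP ℝ nS nA) (τ : ℝ) {ε : ℝ} (hε : 0 < ε) {d m n : ℕ} (hn : 0 < n)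
    (hm : 0 < m) (hm' : ¬ (m : ℝ) * ε < 1) :
    1 - 1 / (n : ℝ) ^ d ≤
      ((PMF.uniformOfFintype (Fin (sampleCount d m n) → Policy nS nA)).toOuterMeasure
        {πs | |(M.goodFraction τ πs : ℝ) - M.GPD τ| ≤ ε}).toReal := by
  refine (one_sub_inv_pow_le (L := Nat.size n) (k := sampleCount d m n) (Nat.lt_size_self n) hn
    (Nat.size_pos.2 hn) ?_).trans
    (M.one_sub_le_measure_goodFraction τ hε (sampleCount_pos hm hn))
  have h1 : 1 ≤ (m * ε) * (m * ε) := by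
    have := not_lt.1 hm'
    nlinarith
  rw [sampleCount]
  push_cast
  have hc : (0 : ℝ) ≤ 8 * (d + 1) * Nat.size n := by positivity
  calc (8 * (d + 1) * Nat.size n : ℝ) ≤ 8 * (d + 1) * Nat.size n * ((m * ε) * (m * ε)) :=
        le_mul_of_one_le_right hc h1
    _ = _ := by ring

/-- The grading for a run on rational data. -/
theorem exists_ratGrading (d m : ℕ) (M : MDP ℚ nS nA) (τ ε : ℚ) {x : ℕ}
    (hx : M.size bitSize + bitSize τ ≤ x) :
    ∃ G : Grading bitSize, G.R = capacity d m x ∧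
      G.b ≤ sizeBound (capacity d m x) (bitSize ε + 2) x ∧ G.Q 1 M.gamma ∧ G.Q 1 τ ∧ G.Q 1 ε ∧
      (∀ s a, G.Q 1 (M.reward s a)) ∧ ∀ s a s', G.Q 1 (M.trans s a s') := by
  set R := capacity d m x with hR
  have hR2 : 2 ≤ R := by rw [hR, capacity]; omega
  set p := x + bitSize ε + R with hp
  -- The factorial makes every natural number from `1` to `R` a divisor of `E`, so the divisions of
  -- the program stay within the grading.
  set E := M.denom * τ.den * ε.den * R.factorial with hE
  have hRU : R ≤ 2 ^ p :=
    Nat.lt_two_pow_self.le.trans (Nat.pow_le_pow_right (by norm_num) (by omega))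
  have hE0 : 0 < E := Nat.mul_pos (Nat.mul_pos (Nat.mul_pos M.denom_pos τ.den_pos) ε.den_pos)
    (Nat.factorial_pos R)
  have hdvd : ∀ m, 1 ≤ m → m ≤ R → m ∣ E := fun m h1 h2 =>
    (Nat.dvd_factorial h1 h2).trans (dvd_mul_left _ _)
  have hU : ∀ {s}, s ≤ p → 2 ^ s ≤ 2 ^ p := fun h => Nat.pow_le_pow_right (by norm_num) h
  have hM : M.denom ∣ E := (dvd_mul_right _ _).trans ((dvd_mul_right _ _).trans (dvd_mul_right _ _))
  have hτ : τ.den ∣ E := (dvd_mul_left _ _).trans ((dvd_mul_right _ _).trans (dvd_mul_right _ _))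
  have hε : ε.den ∣ E := (dvd_mul_left _ _).trans (dvd_mul_right _ _)
  refine ⟨ratGrading R (2 ^ p) E hR2 hRU hE0 hdvd, rfl, ?_,
    ratGrading_mem (M.gamma_den_dvd.trans hM) M.size_gamma_le (hU (by omega)),
    ratGrading_mem hτ le_rfl (hU (by omega)),
    ratGrading_mem hε le_rfl (hU (by omega)),
    fun s a => ratGrading_mem ((M.reward_den_dvd s a).trans hM) (M.size_reward_le s a)
      (hU (by omega)),
    fun s a s' => ratGrading_mem ((M.trans_den_dvd s a s').trans hM) (M.size_trans_le s a s')
      (hU (by omega))⟩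
  have h1 : Nat.size (2 ^ p) = p + 1 := Nat.size_pow
  -- Since `R! ≤ R ^ R ≤ 2 ^ (R * R)`, the factorial adds only polynomially many bits.
  have h2 : E ≤ 2 ^ (M.size bitSize + (bitSize τ + 1) + (bitSize ε + 1) + R * R) := by
    rw [pow_add, pow_add, pow_add]
    refine Nat.mul_le_mul (Nat.mul_le_mul (Nat.mul_le_mul M.denom_le (den_le_two_pow τ))
      (den_le_two_pow ε)) ((Nat.factorial_le_pow R).trans ?_)
    rw [pow_mul]
    exact Nat.pow_le_pow_left Nat.lt_two_pow_self.le R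
  have h3 : Nat.size E ≤ M.size bitSize + (bitSize τ + 1) + (bitSize ε + 1) + R * R + 1 :=
    Nat.size_le.2 (h2.trans_lt (Nat.pow_lt_pow_right (by norm_num) (by omega)))
  change 2 * (Nat.size (2 ^ p) + Nat.size E + 1) ≤ _
  rw [h1, sizeBound]
  omega

end Main

/-! ### The specification of the runs over `ℝ` and over `ℚ`. -/

section Assembly

variable {nS nA : ℕ}

theorem goodFraction_eq (M : MDP ℝ nS nA) (hM : M.ValuesDefined) (τ : ℝ) {k : ℕ}
    (πs : Fin k → Policy nS nA) (p : Policy nS nA → Prop) (hp : ∀ π, p π ↔ M.Good τ π)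
    [DecidablePred fun j => p (πs j)] :
    M.goodFraction τ πs = (Finset.card {j | p (πs j)} : ℚ) / (k : ℚ) := by
  rw [MDP.goodFraction]
  congr 2
  refine congrArg Finset.card ?_
  ext j
  simp [hp, M.good_iff _ hM]

theorem real_run_spec [NeZero nA] {d m C : ℕ} {ε : ℝ} (hε : 0 < ε) (hm0 : 0 < m)
    (hm : ∀ j < m, (j : ℝ) * ε < 1) (hm' : ¬ (m : ℝ) * ε < 1)
    (hC : ∀ x, 1 ≤ x → capacity d m x + commandBound (capacity d m x) *
      unitBound (capacity d m x) (sizeBound (capacity d m x) 0 x) < C * x ^ C)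
    (M : MDP ℝ nS nA) (hM : M.ValuesDefined) (τ : ℝ) :
    let n : ℕ := M.size realSize
    let T : ℕ := C * n ^ C
    let law : PMF (State ℝ) := (Code.main d).run realSize T (M.input realSize τ ε)
    (∀ σ ∈ law.support, σ.time < T) ∧
    law.map State.output =
      (PMF.uniformOfFintype (Fin (sampleCount d m n) → Policy nS nA)).map
        (fun πs => (M.goodFraction τ πs : ℝ)) ∧
    1 - 1 / (n : ℝ) ^ d ≤
      (law.toOuterMeasure {σ | |σ.output - M.GPD τ| ≤ ε}).toReal := by
  classical
  intro n T law
  obtain ⟨h, ht⟩ := admissible_of_bounds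
    (G := realGrading (capacity d m n) (by rw [capacity]; omega)) (d := d) (m := m) (e := 0) (M := M)
    (τ := τ) (ε := ε) (fuel := T) rfl (Nat.zero_le _) le_rfl (hC n M.size_pos)
    trivial trivial trivial (fun _ _ => trivial) (fun _ _ _ => trivial)
  have hlaw : law.map State.output =
      (PMF.uniformOfFintype (Fin (sampleCount d m n) → Policy nS nA)).map
        (fun πs => (M.goodFraction τ πs : ℝ)) := by
    rw [h.map_output_eq hm0 hm hm']
    congr 1
    funext πs
    rw [goodFraction_eq M hM τ πs (M.Good τ) fun _ => Iff.rfl]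
    push_cast
    rfl
  refine ⟨fun σ hσ => (h.time_le hm0 hm hm' σ hσ).trans_lt ht, hlaw, ?_⟩
  have h1 := M.accuracy τ hε (d := d) (n := n) M.size_pos hm0 hm'
  -- The success event depends on the output only, so its probability can be computed for `k`
  -- independent uniform policies.
  have h2 := PMF.toOuterMeasure_map_apply State.output law {y : ℝ | |y - M.GPD τ| ≤ ε}
  rw [hlaw, PMF.toOuterMeasure_map_apply] at h2
  exact h1.trans_eq (congrArg ENNReal.toReal h2)

theorem rat_run_spec [NeZero nA] {d m C : ℕ} {ε : ℚ} (hε : 0 < ε) (hm0 : 0 < m)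
    (hm : ∀ j < m, (j : ℚ) * ε < 1) (hm' : ¬ (m : ℚ) * ε < 1)
    (hC : ∀ x, 1 ≤ x → capacity d m x + commandBound (capacity d m x) *
      unitBound (capacity d m x) (sizeBound (capacity d m x) (bitSize ε + 2) x) < C * x ^ C)
    (M : MDP ℚ nS nA) (hM : M.toReal.ValuesDefined) (τ : ℚ) :
    let n : ℕ := M.size bitSize
    let T : ℕ := C * (n + bitSize τ) ^ C
    let law : PMF (State ℚ) := (Code.main d).run bitSize T (M.input bitSize τ ε)
    (∀ σ ∈ law.support, σ.time < T) ∧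
    law.map State.output =
      (PMF.uniformOfFintype (Fin (sampleCount d m n) → Policy nS nA)).map
        (fun πs => M.toReal.goodFraction τ πs) ∧
    1 - 1 / (n : ℝ) ^ d ≤
      (law.toOuterMeasure {σ | |(σ.output : ℝ) - M.toReal.GPD τ| ≤ ε}).toReal := by
  classical
  intro n T law
  have hn : 0 < n := M.size_pos
  obtain ⟨G, hR, hB, hγ, hτ, hε', hr, htr⟩ := exists_ratGrading d m M τ ε (x := n + bitSize τ) le_rfl
  obtain ⟨h, ht⟩ := admissible_of_bounds (fuel := T) hR hB (Nat.le_add_right _ _)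
    (hC (n + bitSize τ) (by omega)) hγ hτ hε' hr htr
  have hlaw : law.map State.output =
      (PMF.uniformOfFintype (Fin (sampleCount d m n) → Policy nS nA)).map
        (fun πs => M.toReal.goodFraction τ πs) := by
    rw [h.map_output_eq hm0 hm hm']
    congr 1
    funext πs
    rw [goodFraction_eq M.toReal hM τ πs (M.Good τ) fun π => (M.good_toReal π τ).symm]
  refine ⟨fun σ hσ => (h.time_le hm0 hm hm' σ hσ).trans_lt ht, hlaw, ?_⟩
  have h1 := M.toReal.accuracy τ (ε := (ε : ℝ)) (by exact_mod_cast hε) (d := d) hn hm0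
    (by exact_mod_cast hm')
  have h2 := PMF.toOuterMeasure_map_apply State.output law
    {y : ℚ | |(y : ℝ) - M.toReal.GPD τ| ≤ ε}
  rw [hlaw, PMF.toOuterMeasure_map_apply] at h2
  exact h1.trans_eq (congrArg ENNReal.toReal h2)

end Assembly

end PolicyDensity

end



theorem mainTheorem4 (d : ℕ) :
    ∃ P : Program,
      -- real data, unit-cost real arithmetic
      (∀ ε : ℝ, 0 < ε →
        ∃ (c₁ c₂ : ℝ) (k : ℕ → ℕ) (C : ℕ), 0 < c₁ ∧ 0 < c₂ ∧
          (∀ n : ℕ, 2 ≤ n →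
            c₁ * (Real.log n / ε) ≤ (k n : ℝ) ∧ (k n : ℝ) ≤ c₂ * (Real.log n / ε)) ∧
          ∀ (nS nA : ℕ) [NeZero nA] (M : MDP ℝ nS nA), M.ValuesDefined → ∀ τ : ℝ,
            let n : ℕ := M.size realSize
            let T : ℕ := C * n ^ C
            let law : PMF (State ℝ) := P.run realSize T (M.input realSize τ ε)
            (∀ σ ∈ law.support, σ.time < T) ∧
            law.map State.output =
              (PMF.uniformOfFintype (Fin (k n) → Policy nS nA)).map
                (fun πs => (M.goodFraction τ πs : ℝ)) ∧
            1 - 1 / (n : ℝ) ^ d ≤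
              (law.toOuterMeasure {σ | |σ.output - M.GPD τ| ≤ ε}).toReal) ∧
      -- rational data, arithmetic charged by bit length
      (∀ ε : ℚ, 0 < ε →
        ∃ (c₁ c₂ : ℝ) (k : ℕ → ℕ) (C : ℕ), 0 < c₁ ∧ 0 < c₂ ∧
          (∀ n : ℕ, 2 ≤ n →
            c₁ * (Real.log n / ε) ≤ (k n : ℝ) ∧ (k n : ℝ) ≤ c₂ * (Real.log n / ε)) ∧
          ∀ (nS nA : ℕ) [NeZero nA] (M : MDP ℚ nS nA), M.toReal.ValuesDefined → ∀ τ : ℚ,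
            let n : ℕ := M.size bitSize
            let T : ℕ := C * (n + bitSize τ) ^ C
            let law : PMF (State ℚ) := P.run bitSize T (M.input bitSize τ ε)
            (∀ σ ∈ law.support, σ.time < T) ∧
            law.map State.output =
              (PMF.uniformOfFintype (Fin (k n) → Policy nS nA)).map
                (fun πs => M.toReal.goodFraction τ πs) ∧
            1 - 1 / (n : ℝ) ^ d ≤
              (law.toOuterMeasure {σ | |(σ.output : ℝ) - M.toReal.GPD τ| ≤ ε}).toReal) := by
  have hpos : ∀ m : ℕ, 0 < m → (0 : ℝ) < 8 * (d + 1) * (m * m) := fun m hm => by positivity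
  refine ⟨Code.main d, fun ε hε => ?_, fun ε hε => ?_⟩
  · obtain ⟨m, hm0, hm, hm'⟩ := exists_mul_not_lt_one hε
    obtain ⟨C, hC⟩ := exists_fuel d m 0
    exact ⟨ε * (8 * (d + 1) * (m * m)), ε * (8 * (d + 1) * (m * m)) * 3, sampleCount d m, C,
      mul_pos hε (hpos m hm0), mul_pos (mul_pos hε (hpos m hm0)) three_pos,
      fun n hn => sampleCount_bounds hε hn,
      fun nS nA _ M hM τ => real_run_spec hε hm0 hm hm' hC M hM τ⟩
  · obtain ⟨m, hm0, hm, hm'⟩ := exists_mul_not_lt_one hε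
    -- The bits of `ε` enter through a constant and those of `τ` through the argument of the
    -- polynomial, so `C` depends only on `d` and `ε`.
    obtain ⟨C, hC⟩ := exists_fuel d m (bitSize ε + 2)
    have hε' : (0 : ℝ) < ε := by exact_mod_cast hε
    exact ⟨ε * (8 * (d + 1) * (m * m)), ε * (8 * (d + 1) * (m * m)) * 3, sampleCount d m, C,
      mul_pos hε' (hpos m hm0), mul_pos (mul_pos hε' (hpos m hm0)) three_pos,
      fun n hn => sampleCount_bounds hε' hn,
      fun nS nA _ M hM τ => rat_run_spec hε hm0 hm hm' hC M hM τ⟩
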